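/- Let $M$ be a closed (compact, boundaryless, Hausdorff) smooth manifold and $f\colon M\to M$ a $C^1$-diffeomorphism. Let $\overline M$ be the quotient of $M\times\mathbb R$ by the equivalence relation generated by $(x,s+1)\sim(f(x),s)$, with the $C^1$ manifold structure for which the quotient map is a local diffeomorphism; let $\phi_t[x,s]=[x,s+t]$ be the suspension flow of $f$ (roof function $1$) with velocity field $X_\phi$, and let $\pi\colon\overline M\to M$, $\pi([x,s])=x$ for $0\le s<1$. Let $\alpha\colon\overline M\to[0,\infty)$ be a $C^1$ function (a brake), $S=\alpha^{-1}(0)$, and let $\psi$ be the singular suspension of $f$ with brake $\alpha$, that is, the flow on $\overline M$ induced by the vector field $\alpha X_\phi$. Define the first-return time $\gamma\colon M\to(0,+\infty]$ of $\psi$ to the base fiber by $\gamma(x)=+\infty$ if $x\in\pi(S)$, and otherwise $\gamma(x)=\inf\{t>0:\psi_t[x,0]=\phi_1[x,0]\}$ (with $\inf\emptyset=+\infty$). Let $h$ denote topological entropy, with $h(\psi)=h(\psi_1)$, let $h_\mu(f)$ denote metric entropy, and write $E_\mu(\gamma)=\int_M\gamma\,d\mu$. (1) If $h(f)>0$, then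 $h(\psi)=0$ if and only if $E_\mu(\gamma)=+\infty$ for every ergodic $f$-invariant Borel probability measure $\mu$ with $h_\mu(f)>0$. (2) If $h(f)=0$, then $h(\psi)=0$. -/

import Mathlib

open Set Filter Topology MeasureTheory Function
open scoped Manifold ContDiff ENNReal

noncomputable section

/-! ### Entropy -/

/-- Topological entropy (Bowen's definition, as in Mathlib) of a self-map of a compact Hausdorff
space, with respect to its unique compatible uniform structure; this is the uniformity of every
compatible metric. -/
def topEntropy {X : Type*} [TopologicalSpace X] [CompactSpace X] [T2Space X] (T : X → X) : EReal :=
  letI : UniformSpace X := uniformSpaceOfCompactR1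
  Dynamics.coverEntropy T univ

/-- The Shannon entropy `-∑ μ(P) log μ(P)` of the finite partition of `X` into the fibres of `P`. -/
def partitionEntropy {X ι : Type*} [MeasurableSpace X] [Fintype ι] (μ : Measure X) (P : X → ι) : ℝ :=
  ∑ i, Real.negMulLog (μ.real (P ⁻¹' {i}))

/-- The labelling of the points of `X` by the atoms of the join
`P ∨ T⁻¹ P ∨ ⋯ ∨ T^{-(n-1)} P`. -/
def partitionJoin {X ι : Type*} (T : X → X) (P : X → ι) (n : ℕ) : X → (Fin n → ι) :=
  fun x j => P (T^[j] x)

/-- Metric (Kolmogorov-Sinai) entropy: the supremum over finite measurable partitions `P` of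
`lim (1/n) H(P ∨ ⋯ ∨ T^{-(n-1)} P)`. For an invariant probability measure this limit exists, so it
is the `limsup`. A partition into at most `k` sets is given by a measurable labelling. -/
def metricEntropy {X : Type*} [MeasurableSpace X] (T : X → X) (μ : Measure X) : ℝ≥0∞ :=
  ⨆ (k : ℕ) (P : X → Fin k) (_ : Measurable P),
    limsup (fun n : ℕ => ENNReal.ofReal (partitionEntropy μ (partitionJoin T P n) / n)) atTop

/-! ### The suspension manifold -/

section Suspension

variable {d : ℕ} {M : Type*} [TopologicalSpace M] [ChartedSpace (EuclideanSpace ℝ (Fin d)) M]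

/-- The `n`-th iterate of the diffeomorphism `f`, for `n : ℤ`. -/
def iter (f : M ≃ₘ^1⟮𝓡 d, 𝓡 d⟯ M) (n : ℤ) (x : M) : M := (f.toEquiv ^ n : Equiv.Perm M) x

/-- The deck transformation `(x, s) ↦ (f^n x, s - n)` of `M × ℝ`. -/
def deck (f : M ≃ₘ^1⟮𝓡 d, 𝓡 d⟯ M) (n : ℤ) (z : M × ℝ) : M × ℝ := (iter f n z.1, z.2 - n)

theorem iter_zero (f : M ≃ₘ^1⟮𝓡 d, 𝓡 d⟯ M) (x : M) : iter f 0 x = x := rfl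

theorem iter_add (f : M ≃ₘ^1⟮𝓡 d, 𝓡 d⟯ M) (m n : ℤ) (x : M) :
    iter f (m + n) x = iter f m (iter f n x) := by
  simp [iter, zpow_add]

theorem deck_zero (f : M ≃ₘ^1⟮𝓡 d, 𝓡 d⟯ M) (z : M × ℝ) : deck f 0 z = z := by
  simp [deck, iter_zero]

theorem deck_add (f : M ≃ₘ^1⟮𝓡 d, 𝓡 d⟯ M) (m n : ℤ) (z : M × ℝ) :
    deck f (m + n) z = deck f m (deck f n z) := by
  simp only [deck, iter_add, Prod.mk.injEq, true_and]
  push_cast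
  ring

theorem deck_neg_deck (f : M ≃ₘ^1⟮𝓡 d, 𝓡 d⟯ M) (n : ℤ) (z : M × ℝ) :
    deck f (-n) (deck f n z) = z := by
  rw [← deck_add, neg_add_cancel, deck_zero]

theorem contMDiff_iter (f : M ≃ₘ^1⟮𝓡 d, 𝓡 d⟯ M) (n : ℤ) :
    ContMDiff (𝓡 d) (𝓡 d) 1 (iter f n) := by
  have h1 : iter f 1 = f := by
    funext x
    simp [iter]
  have h2 : iter f (-1) = f.symm := by
    funext x
    simp only [iter, zpow_neg, zpow_one]
    rfl
  induction n with
  | zero => exact contMDiff_id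
  | succ n ih =>
    have : iter f (n + 1 : ℤ) = iter f n ∘ iter f 1 := funext fun x => iter_add f _ _ x
    rw [this, h1]
    exact ih.comp f.contMDiff
  | pred n ih =>
    have : iter f (-n - 1 : ℤ) = iter f (-n) ∘ iter f (-1) := funext fun x => iter_add f _ _ x
    rw [this, h2]
    exact ih.comp f.symm.contMDiff

theorem contMDiff_deck (f : M ≃ₘ^1⟮𝓡 d, 𝓡 d⟯ M) (n : ℤ) :
    ContMDiff ((𝓡 d).prod 𝓘(ℝ, ℝ)) ((𝓡 d).prod 𝓘(ℝ, ℝ)) 1 (deck f n) := by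
  have h : ContMDiff 𝓘(ℝ, ℝ) 𝓘(ℝ, ℝ) 1 (fun s : ℝ => s - n) :=
    (contDiff_id.sub contDiff_const).contMDiff
  exact (((contMDiff_iter f n).comp contMDiff_fst).prodMk (h.comp contMDiff_snd) :)

theorem continuous_deck (f : M ≃ₘ^1⟮𝓡 d, 𝓡 d⟯ M) (n : ℤ) : Continuous (deck f n) :=
  (contMDiff_deck f n).continuous

/-- The equivalence relation on `M × ℝ` generated by `(x, s + 1) ∼ (f x, s)`. -/
def suspSetoid (f : M ≃ₘ^1⟮𝓡 d, 𝓡 d⟯ M) : Setoid (M × ℝ) where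
  r z w := ∃ n : ℤ, deck f n z = w
  iseqv :=
    { refl := fun z => ⟨0, deck_zero f z⟩
      symm := by
        rintro z w ⟨n, rfl⟩
        exact ⟨-n, deck_neg_deck f n z⟩
      trans := by
        rintro z w v ⟨n, rfl⟩ ⟨m, rfl⟩
        exact ⟨m + n, deck_add f m n z⟩ }

/-- The suspension manifold of `f` with constant roof function `1`. -/
def SuspSpace (f : M ≃ₘ^1⟮𝓡 d, 𝓡 d⟯ M) : Type _ := Quotient (suspSetoid f)

/-- The quotient map `M × ℝ → SuspSpace f`. -/
def suspMk (f : M ≃ₘ^1⟮𝓡 d, 𝓡 d⟯ M) (z : M × ℝ) : SuspSpace f := Quotient.mk (suspSetoid f) z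

instance (f : M ≃ₘ^1⟮𝓡 d, 𝓡 d⟯ M) : TopologicalSpace (SuspSpace f) :=
  inferInstanceAs (TopologicalSpace (Quotient (suspSetoid f)))

theorem suspMk_eq_iff (f : M ≃ₘ^1⟮𝓡 d, 𝓡 d⟯ M) {z w : M × ℝ} :
    suspMk f z = suspMk f w ↔ ∃ n : ℤ, deck f n z = w :=
  Quotient.eq (r := suspSetoid f)

theorem suspMk_surjective (f : M ≃ₘ^1⟮𝓡 d, 𝓡 d⟯ M) : Surjective (suspMk f) :=
  Quotient.mk_surjective

theorem continuous_suspMk (f : M ≃ₘ^1⟮𝓡 d, 𝓡 d⟯ M) : Continuous (suspMk f) :=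
  continuous_quotient_mk'

theorem isOpenMap_suspMk (f : M ≃ₘ^1⟮𝓡 d, 𝓡 d⟯ M) : IsOpenMap (suspMk f) := by
  intro U hU
  have h : suspMk f ⁻¹' (suspMk f '' U) = ⋃ n : ℤ, deck f n ⁻¹' U := by
    ext z
    simp only [mem_preimage, mem_image, mem_iUnion]
    constructor
    · rintro ⟨w, hw, hwz⟩
      obtain ⟨n, hn⟩ := (suspMk_eq_iff f).1 hwz.symm
      exact ⟨n, hn ▸ hw⟩
    · rintro ⟨n, hn⟩
      exact ⟨_, hn, ((suspMk_eq_iff f).2 ⟨n, rfl⟩).symm⟩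
  have h2 : IsOpen (suspMk f ⁻¹' (suspMk f '' U)) := by
    rw [h]
    exact isOpen_iUnion fun n => hU.preimage (continuous_deck f n)
  exact h2

theorem isOpenQuotientMap_suspMk (f : M ≃ₘ^1⟮𝓡 d, 𝓡 d⟯ M) : IsOpenQuotientMap (suspMk f) :=
  ⟨suspMk_surjective f, continuous_suspMk f, isOpenMap_suspMk f⟩

instance (f : M ≃ₘ^1⟮𝓡 d, 𝓡 d⟯ M) [CompactSpace M] : CompactSpace (SuspSpace f) := by
  have h : suspMk f '' (univ ×ˢ Icc (0 : ℝ) 1) = univ := by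
    refine eq_univ_of_forall fun p => ?_
    obtain ⟨z, rfl⟩ := suspMk_surjective f p
    refine ⟨deck f ⌊z.2⌋ z, ⟨mem_univ _, ?_, ?_⟩, ((suspMk_eq_iff f).2 ⟨_, rfl⟩).symm⟩
    · exact Int.fract_nonneg z.2
    · exact (Int.fract_lt_one z.2).le
  exact ⟨h ▸ (isCompact_univ.prod isCompact_Icc).image (continuous_suspMk f)⟩

instance (f : M ≃ₘ^1⟮𝓡 d, 𝓡 d⟯ M) [T2Space M] : T2Space (SuspSpace f) := by
  rw [t2Space_iff_of_isOpenQuotientMap (isOpenQuotientMap_suspMk f)]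
  have h : {q : (M × ℝ) × (M × ℝ) | suspMk f q.1 = suspMk f q.2} =
      ⋃ n : ℤ, {q : (M × ℝ) × (M × ℝ) | deck f n q.1 = q.2} := by
    ext q
    simp [suspMk_eq_iff]
  rw [h]
  refine LocallyFinite.isClosed_iUnion ?_ fun n =>
    isClosed_eq ((continuous_deck f n).comp continuous_fst) continuous_snd
  intro q
  refine ⟨(fun r : (M × ℝ) × (M × ℝ) => r.1.2 - r.2.2) ⁻¹'
      Metric.ball (q.1.2 - q.2.2) 1, ?_, ?_⟩
  · exact (by fun_prop : Continuous (fun r : (M × ℝ) × (M × ℝ) => r.1.2 - r.2.2)).continuousAt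
      (Metric.ball_mem_nhds _ one_pos)
  · refine (finite_Icc ⌊q.1.2 - q.2.2 - 1⌋ ⌈q.1.2 - q.2.2 + 1⌉).subset ?_
    rintro n ⟨r, hr, hr2⟩
    have e : r.1.2 - r.2.2 = n := by
      have := congrArg Prod.snd hr
      simp only [deck] at this
      linarith
    rw [mem_preimage, e, Metric.mem_ball, Real.dist_eq, abs_lt] at hr2
    constructor
    · rw [Int.floor_le_iff]
      linarith [hr2.1]
    · rw [Int.le_ceil_iff]
      linarith [hr2.2]

/-- The quotient map restricted to `M × (s - 1/2, s + 1/2)`, where `z = (x, s)`. -/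
def suspLocal (f : M ≃ₘ^1⟮𝓡 d, 𝓡 d⟯ M) (z : M × ℝ) :
    OpenPartialHomeomorph (M × ℝ) (SuspSpace f) :=
  haveI : Nonempty (M × ℝ) := ⟨z⟩
  OpenPartialHomeomorph.ofContinuousOpen
    (InjOn.toPartialEquiv (suspMk f) (univ ×ˢ Metric.ball z.2 (1 / 2)) (by
      rintro a ⟨-, ha⟩ b ⟨-, hb⟩ hab
      obtain ⟨n, rfl⟩ := (suspMk_eq_iff f).1 hab
      simp only [Metric.mem_ball, Real.dist_eq, abs_lt, deck] at ha hb
      have h1 : (n : ℝ) < 1 := by linarith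
      have h2 : (-1 : ℝ) < n := by linarith
      have h3 : n < 1 := by exact_mod_cast h1
      have h4 : -1 < n := by exact_mod_cast h2
      obtain rfl : n = 0 := by omega
      exact (deck_zero f a).symm))
    (continuous_suspMk f).continuousOn (isOpenMap_suspMk f)
    (isOpen_univ.prod Metric.isOpen_ball)

theorem suspLocal_apply (f : M ≃ₘ^1⟮𝓡 d, 𝓡 d⟯ M) (z w : M × ℝ) :
    suspLocal f z w = suspMk f w := rfl

theorem mem_suspLocal_source (f : M ≃ₘ^1⟮𝓡 d, 𝓡 d⟯ M) (z : M × ℝ) :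
    z ∈ (suspLocal f z).source :=
  ⟨mem_univ _, Metric.mem_ball_self (by norm_num)⟩

/-- A point of `M × ℝ` above `p`. -/
def suspLift (f : M ≃ₘ^1⟮𝓡 d, 𝓡 d⟯ M) (p : SuspSpace f) : M × ℝ := Quotient.out p

theorem suspMk_suspLift (f : M ≃ₘ^1⟮𝓡 d, 𝓡 d⟯ M) (p : SuspSpace f) :
    suspMk f (suspLift f p) = p := Quotient.out_eq p

/-- The manifold structure on the suspension for which the quotient map is a local
diffeomorphism: charts are local inverses of the quotient map followed by charts of `M × ℝ`. -/
instance (f : M ≃ₘ^1⟮𝓡 d, 𝓡 d⟯ M) :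
    ChartedSpace (ModelProd (EuclideanSpace ℝ (Fin d)) ℝ) (SuspSpace f) where
  atlas := {e | ∃ z : M × ℝ,
    e = (suspLocal f z).symm ≫ₕ chartAt (ModelProd (EuclideanSpace ℝ (Fin d)) ℝ) z}
  chartAt p := (suspLocal f (suspLift f p)).symm ≫ₕ
    chartAt (ModelProd (EuclideanSpace ℝ (Fin d)) ℝ) (suspLift f p)
  mem_chart_source p := by
    have h1 := mem_suspLocal_source f (suspLift f p)
    have h2 : suspLocal f (suspLift f p) (suspLift f p) = p := suspMk_suspLift f p
    rw [OpenPartialHomeomorph.trans_source]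
    refine ⟨?_, ?_⟩
    · have := (suspLocal f (suspLift f p)).map_source h1
      rwa [h2] at this
    · have := (suspLocal f (suspLift f p)).left_inv h1
      rw [h2] at this
      rw [mem_preimage, this]
      exact mem_chart_source _ _
  chart_mem_atlas p := ⟨_, rfl⟩

/-- Locally, two local inverses of the quotient map differ by a deck transformation. -/
theorem suspLocal_symm_eventuallyEq (f : M ≃ₘ^1⟮𝓡 d, 𝓡 d⟯ M) (z w : M × ℝ)
    (hw : suspMk f w ∈ (suspLocal f z).target) :
    ∃ n : ℤ, ∀ᶠ v in 𝓝 w, (suspLocal f z).symm (suspMk f v) = deck f n v := by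
  have h1 : suspMk f ((suspLocal f z).symm (suspMk f w)) = suspMk f w :=
    (suspLocal f z).right_inv hw
  obtain ⟨n, hn⟩ := (suspMk_eq_iff f).1 h1.symm
  refine ⟨n, ?_⟩
  have h2 : deck f n w ∈ (suspLocal f z).source := by
    rw [hn]
    exact (suspLocal f z).map_target hw
  filter_upwards [(continuous_deck f n).continuousAt ((suspLocal f z).open_source.mem_nhds h2)]
    with v hv
  have h3 : suspMk f v = suspLocal f z (deck f n v) := (suspMk_eq_iff f).2 ⟨n, rfl⟩
  rw [h3]
  exact (suspLocal f z).left_inv hv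

instance (f : M ≃ₘ^1⟮𝓡 d, 𝓡 d⟯ M) [IsManifold (𝓡 d) 1 M] :
    IsManifold ((𝓡 d).prod 𝓘(ℝ, ℝ)) 1 (SuspSpace f) := by
  refine isManifold_of_contDiffOn _ _ _ ?_
  rintro _ _ ⟨z, rfl⟩ ⟨z', rfl⟩
  intro u hu
  refine ContDiffAt.contDiffWithinAt ?_
  set J := (𝓡 d).prod 𝓘(ℝ, ℝ) with hJ
  have hu1 := hu.1
  simp only [mem_preimage, OpenPartialHomeomorph.trans_source, OpenPartialHomeomorph.symm_source,
    OpenPartialHomeomorph.trans_symm_eq_symm_trans_symm, OpenPartialHomeomorph.symm_symm,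
    mem_inter_iff, OpenPartialHomeomorph.coe_trans, comp_apply] at hu1
  obtain ⟨⟨hu2, hu3⟩, hu4, hu5⟩ := hu1
  set w : M × ℝ := (extChartAt J z).symm u with hw
  obtain ⟨n, hn⟩ := suspLocal_symm_eventuallyEq f z' w hu4
  have ht : u ∈ (extChartAt J z).target := by
    rw [extChartAt_target]
    exact ⟨hu2, hu.2⟩
  have hs : ContMDiffAt 𝓘(ℝ, EuclideanSpace ℝ (Fin d) × ℝ) J 1 (extChartAt J z).symm u :=
    (contMDiffOn_extChartAt_symm z).contMDiffAt
      ((isOpen_extChartAt_target z).mem_nhds ht)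
  have hd : ContMDiffAt J J 1 (deck f n) ((extChartAt J z).symm u) := contMDiff_deck f n _
  have hx : deck f n w ∈
      (chartAt (ModelProd (EuclideanSpace ℝ (Fin d)) ℝ) z').source := by
    rw [← hn.self_of_nhds]
    exact hu5
  have hc : ContDiffAt ℝ 1 (extChartAt J z' ∘ (deck f n ∘ (extChartAt J z).symm)) u :=
    ((contMDiffAt_extChartAt' (I := J) (n := 1) hx).comp u (hd.comp u hs)).contDiffAt
  refine hc.congr_of_eventuallyEq ?_
  filter_upwards [hs.continuousAt hn] with v hv
  exact congrArg (extChartAt J z') hv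

/-- The projection of the suspension to `M` along the vertical segments `{x} × [0, 1)`. -/
def suspProj (f : M ≃ₘ^1⟮𝓡 d, 𝓡 d⟯ M) : SuspSpace f → M :=
  Quotient.lift (fun z : M × ℝ => iter f ⌊z.2⌋ z.1) (by
    rintro z w ⟨n, rfl⟩
    simp [deck, ← iter_add])

/-! ### Suspension flow and singular suspensions -/

/-- The suspension flow `φ_t [x, s] = [x, s + t]`. -/
def suspFlow (f : M ≃ₘ^1⟮𝓡 d, 𝓡 d⟯ M) : Flow ℝ (SuspSpace f) where
  toFun t := Quotient.map (sa := suspSetoid f) (sb := suspSetoid f)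
    (fun z : M × ℝ => (z.1, z.2 + t)) (by
      rintro z w ⟨n, rfl⟩
      refine ⟨n, ?_⟩
      simp only [deck, Prod.mk.injEq, true_and]
      ring)
  cont' := by
    refine ((IsOpenQuotientMap.id (X := ℝ)).prodMap
      (isOpenQuotientMap_suspMk f)).isQuotientMap.continuous_iff.2 ?_
    exact (continuous_suspMk f).comp
      (by fun_prop : Continuous fun q : ℝ × (M × ℝ) => (q.2.1, q.2.2 + q.1))
  map_add' t₁ t₂ p := by
    obtain ⟨z, rfl⟩ := suspMk_surjective f p
    refine congrArg (suspMk f) ?_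
    simp only [Prod.mk.injEq, true_and]
    ring
  map_zero' p := by
    obtain ⟨z, rfl⟩ := suspMk_surjective f p
    refine congrArg (suspMk f) ?_
    simp

/-- The velocity vector field of a flow on the suspension manifold. -/
def velocityField (f : M ≃ₘ^1⟮𝓡 d, 𝓡 d⟯ M) (φ : Flow ℝ (SuspSpace f)) (p : SuspSpace f) :
    TangentSpace ((𝓡 d).prod 𝓘(ℝ, ℝ)) p :=
  mfderiv 𝓘(ℝ, ℝ) ((𝓡 d).prod 𝓘(ℝ, ℝ)) (fun t : ℝ => φ t p) 0 (1 : ℝ)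

/-- A brake: a non-negative `C^1` function on the suspension manifold. -/
structure IsBrake (f : M ≃ₘ^1⟮𝓡 d, 𝓡 d⟯ M) (α : SuspSpace f → ℝ) : Prop where
  contMDiff : ContMDiff ((𝓡 d).prod 𝓘(ℝ, ℝ)) 𝓘(ℝ, ℝ) 1 α
  nonneg : ∀ p, 0 ≤ α p

/-- `ψ` is the singular suspension of `f` with brake `α`, i.e. the flow induced by the vector
field `α X`, where `X` is the velocity field of the suspension flow. -/
structure IsSingularSuspension (f : M ≃ₘ^1⟮𝓡 d, 𝓡 d⟯ M) (α : SuspSpace f → ℝ)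
    (ψ : Flow ℝ (SuspSpace f)) : Prop where
  isBrake : IsBrake f α
  isMIntegralCurve : ∀ p, IsMIntegralCurve (I := (𝓡 d).prod 𝓘(ℝ, ℝ)) (fun t : ℝ => ψ t p)
    (fun q => α q • velocityField f (suspFlow f) q)

open Classical in
/-- The first-return time `γ` of `ψ` to the base fibre `M × {0}`: it is `+∞` on the projection of
the zero set of `α`, and otherwise the first time `t > 0` with `ψ_t (x, 0) = φ_1 (x, 0)` (`+∞` if
there is no such time). -/
def returnTime (f : M ≃ₘ^1⟮𝓡 d, 𝓡 d⟯ M) (α : SuspSpace f → ℝ) (ψ : Flow ℝ (SuspSpace f))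
    (x : M) : ℝ≥0∞ :=
  if x ∈ suspProj f '' {p | α p = 0} then ⊤
  else ⨅ (t : ℝ) (_ : 0 < t) (_ : ψ t (suspMk f (x, 0)) = suspFlow f 1 (suspMk f (x, 0))),
    ENNReal.ofReal t

end Suspension

end

/-!
The singular suspension `ψ` is a time change of the suspension flow `φ`. Writing
`h(t, p) = ∫₀ᵗ α (ψ_r p) dr` for the height which the orbit of `p` has covered at time `t`
(`coveredHeight`), one has `ψ_t p = φ_{h(t, p)} p` (`IsSingularSuspension.flow_eq`): a curve with
velocity `α X_φ` lifts locally to a vertical curve in `M × ℝ`. Since `α` is `C¹`, its zeros are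
fixed by `ψ`, so `γ x` is the time at which the orbit of `[x, 0]` has covered the height `1`,
and the sum of the first `n` return times of `x` is at most `t` if and only if `h(t, [x, 0]) ≥ n`
(`IsSingularSuspension.sum_returnTime_le_iff`). In particular the return time `γ` is lower
semicontinuous.

*Zero entropy of `ψ` forces zero entropy of every invariant measure `μ` with integrable `γ`.* If
two `ψ`-orbits starting in the base fibre stay close up to time `t`, then the heights which they
cover stay close as well, since their difference is continuous and controlled modulo `1`; hence the
underlying `f`-orbits stay close for `h(t, ·)` steps (`IsSingularSuspension.exists_shadowing`).
Therefore subexponentially many Bowen balls of length `n` cover the set where the first `n` return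
times add up to at most `c n` (`IsSingularSuspension.eventually_bowen_cover`). By Markov's
inequality this set has measure close to `1` for large `c`, and Katok's description of entropy by
covers of sets of almost full measure (`metricEntropy_eq_zero_of_bowen_cover`) gives `h_μ(f) = 0`.

*Positive entropy of `ψ` produces an ergodic measure of positive entropy with integrable `γ`.* Take
exponentially many `(N, ε)`-separated points for `ψ_1`. Two points whose `φ`-orbits stay close while
`ψ` traverses them can differ only in the timing of that traversal, and a timing is described by a
monotone sequence, of which there are few at coarse scale; so exponentially many `φ`-orbit segments
remain (`IsTimeChange.exists_isFlowSeparated_subset`). A flow has at most exponentially many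
separated segments of a given length, so the length `n` covered is at least proportional to `N`.
This gives exponentially many `(n, δ)`-separated points for `f` along which the first `n` return
times add up to at most `D n` (`IsSingularSuspension.exists_many_isBowenSeparated`). Misiurewicz'
construction applied to these points yields an invariant measure of positive entropy, and `γ` is
integrable for it by lower semicontinuity (`exists_measurePreserving_of_isBowenSeparated`).
Finally, the conditional measures with respect to the invariant sets are ergodic by the mean ergodic
theorem (`ae_ergodic_condExpKernel`), `γ` is integrable for almost all of them, and since entropy
is affine they cannot all have entropy zero (`exists_ergodic_of_measurePreserving`).

Together these give the criterion of the first part whatever the entropy of `f`. For the second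
part, `f` with zero topological entropy has no invariant measure of positive entropy
(`metricEntropy_eq_zero_of_topEntropy_eq_zero`), so the criterion holds vacuously.
-/

/-! ### Entropy of finite labellings -/

section FiniteEntropy

variable {X ι κ : Type*} [MeasurableSpace X]
  [Fintype ι] [MeasurableSpace ι] [MeasurableSingletonClass ι]
  [Fintype κ] [MeasurableSpace κ] [MeasurableSingletonClass κ]

/-- Gibbs' inequality for a single atom; summing it over the atoms of a partition compares the
entropy of `p` with the cross entropy of `p` relative to `q`. -/
theorem negMulLog_le_neg_mul_log_add {p q : ℝ} (hp : 0 ≤ p) (hq : 0 ≤ q) (h : q = 0 → p = 0) :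
    Real.negMulLog p ≤ -(p * Real.log q) + (q - p) := by
  rcases hp.eq_or_lt with rfl | hp'
  · simpa using hq
  have hq' : 0 < q := lt_of_le_of_ne hq fun h0 => hp'.ne' (h h0.symm)
  have h1 : Real.log (q / p) ≤ q / p - 1 := Real.log_le_sub_one_of_pos (div_pos hq' hp')
  rw [Real.log_div hq'.ne' hp'.ne'] at h1
  have h2 : p * (Real.log q - Real.log p) ≤ p * (q / p - 1) := mul_le_mul_of_nonneg_left h1 hp
  have h3 : p * (q / p - 1) = q - p := by field_simp
  rw [Real.negMulLog]
  nlinarith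

/-- Among the decompositions of a mass into `#s` parts the uniform one has the largest entropy. -/
theorem sum_negMulLog_le {β : Type*} (s : Finset β) (p : β → ℝ) (hp : ∀ i ∈ s, 0 ≤ p i) :
    ∑ i ∈ s, Real.negMulLog (p i) ≤
      Real.negMulLog (∑ i ∈ s, p i) + (∑ i ∈ s, p i) * Real.log s.card := by
  set t := ∑ i ∈ s, p i with ht
  have ht0 : 0 ≤ t := Finset.sum_nonneg hp
  rcases ht0.eq_or_lt with h0 | h0
  · have : ∀ i ∈ s, p i = 0 := (Finset.sum_eq_zero_iff_of_nonneg hp).1 (ht ▸ h0.symm)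
    rw [← h0, Finset.sum_eq_zero fun i hi => by rw [this i hi, Real.negMulLog_zero]]
    simp
  have hs : s.Nonempty := by
    rw [Finset.nonempty_iff_ne_empty]
    rintro rfl
    simp [ht] at h0
  have hc : (0 : ℝ) < s.card := by exact_mod_cast hs.card_pos
  have hq : 0 < t / s.card := div_pos h0 hc
  calc ∑ i ∈ s, Real.negMulLog (p i)
      ≤ ∑ i ∈ s, (-(p i * Real.log (t / s.card)) + (t / s.card - p i)) :=
        Finset.sum_le_sum fun i hi =>
          negMulLog_le_neg_mul_log_add (hp i hi) hq.le fun h => absurd h hq.ne'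
    _ = Real.negMulLog t + t * Real.log s.card := by
        rw [Finset.sum_add_distrib, Finset.sum_neg_distrib, ← Finset.sum_mul,
          Finset.sum_sub_distrib, ← ht, Real.log_div h0.ne' hc.ne', Finset.sum_const,
          nsmul_eq_mul, mul_div_cancel₀ _ hc.ne', Real.negMulLog]
        ring

theorem sum_measureReal_inter_fiber (μ : Measure X) [IsFiniteMeasure μ] {P : X → ι}
    (hP : Measurable P) (A : Set X) : ∑ i, μ.real (A ∩ P ⁻¹' {i}) = μ.real A := by
  have h := sum_measureReal_preimage_singleton (μ := μ.restrict A) (f := P) Finset.univ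
    (fun i _ => hP (measurableSet_singleton i))
  simp only [Finset.coe_univ, preimage_univ, measureReal_restrict_apply_univ] at h
  rw [← h]
  refine Finset.sum_congr rfl fun i _ => ?_
  rw [measureReal_restrict_apply (hP (measurableSet_singleton i)), inter_comm]

theorem sum_measureReal_fiber (μ : Measure X) [IsProbabilityMeasure μ] {P : X → ι}
    (hP : Measurable P) : ∑ i, μ.real (P ⁻¹' {i}) = 1 := by
  simpa using sum_measureReal_inter_fiber μ hP univ

theorem partitionEntropy_nonneg {ι : Type*} [Fintype ι] (μ : Measure X) [IsProbabilityMeasure μ]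
    (P : X → ι) : 0 ≤ partitionEntropy μ P :=
  Finset.sum_nonneg fun _ _ => Real.negMulLog_nonneg measureReal_nonneg measureReal_le_one

theorem partitionEntropy_le_log_card (μ : Measure X) [IsProbabilityMeasure μ] {P : X → ι}
    (hP : Measurable P) : partitionEntropy μ P ≤ Real.log (Fintype.card ι) := by
  have h := sum_negMulLog_le Finset.univ (fun i => μ.real (P ⁻¹' {i}))
    fun _ _ => measureReal_nonneg
  rw [sum_measureReal_fiber μ hP, Real.negMulLog_one, zero_add, one_mul] at h
  exact h

theorem negMulLog_add_le {x y : ℝ} (hx : 0 ≤ x) (hy : 0 ≤ y) :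
    Real.negMulLog (x + y) ≤ Real.negMulLog x + Real.negMulLog y := by
  rcases hx.eq_or_lt with rfl | hx'
  · simp
  rcases hy.eq_or_lt with rfl | hy'
  · simp
  have h1 : Real.log x ≤ Real.log (x + y) := Real.log_le_log hx' (by linarith)
  have h2 : Real.log y ≤ Real.log (x + y) := Real.log_le_log hy' (by linarith)
  simp only [Real.negMulLog]
  nlinarith

theorem negMulLog_sum_le {β : Type*} (s : Finset β) (p : β → ℝ) (hp : ∀ i ∈ s, 0 ≤ p i) :
    Real.negMulLog (∑ i ∈ s, p i) ≤ ∑ i ∈ s, Real.negMulLog (p i) := by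
  classical
  induction s using Finset.induction_on with
  | empty => simp
  | insert a s ha ih =>
    rw [Finset.sum_insert ha, Finset.sum_insert ha]
    have h1 := negMulLog_add_le (hp a (by simp))
      (Finset.sum_nonneg fun i hi => hp i (Finset.mem_insert_of_mem hi))
    linarith [ih fun i hi => hp i (Finset.mem_insert_of_mem hi)]

theorem partitionEntropy_comp_le {κ : Type*} [Fintype κ] (μ : Measure X) [IsProbabilityMeasure μ]
    {P : X → ι} (hP : Measurable P) (F : ι → κ) :
    partitionEntropy μ (F ∘ P) ≤ partitionEntropy μ P := by
  classical
  have h1 : ∀ c : κ, μ.real (F ∘ P ⁻¹' {c}) = ∑ i with F i = c, μ.real (P ⁻¹' {i}) := by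
    intro c
    rw [sum_measureReal_preimage_singleton _ (fun i _ => hP (measurableSet_singleton i))]
    congr 1
    ext x
    simp
  calc partitionEntropy μ (F ∘ P)
      ≤ ∑ c, ∑ i with F i = c, Real.negMulLog (μ.real (P ⁻¹' {i})) := by
        refine Finset.sum_le_sum fun c _ => ?_
        rw [h1]
        exact negMulLog_sum_le _ _ fun _ _ => measureReal_nonneg
    _ = partitionEntropy μ P := Finset.sum_fiberwise _ _ _

/-- Entropy is subadditive: the joint entropy is the cross entropy of the joint law relative to
itself, and replacing the reference law by the product of the marginals increases it. -/
theorem partitionEntropy_prodMk_le (μ : Measure X) [IsProbabilityMeasure μ] {P : X → ι}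
    (hP : Measurable P) {Q : X → κ} (hQ : Measurable Q) :
    partitionEntropy μ (fun x => (P x, Q x)) ≤ partitionEntropy μ P + partitionEntropy μ Q := by
  set a : ι → ℝ := fun i => μ.real (P ⁻¹' {i}) with ha
  set b : κ → ℝ := fun j => μ.real (Q ⁻¹' {j}) with hb
  set p : ι → κ → ℝ := fun i j => μ.real (P ⁻¹' {i} ∩ Q ⁻¹' {j}) with hp
  have hp1 : ∀ i, ∑ j, p i j = a i := fun i => sum_measureReal_inter_fiber μ hQ _
  have hp2 : ∀ j, ∑ i, p i j = b j := fun j => by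
    refine Eq.trans ?_ (sum_measureReal_inter_fiber μ hP (Q ⁻¹' {j}))
    exact Finset.sum_congr rfl fun i _ => by rw [inter_comm]
  have hpa : ∀ i j, p i j ≤ a i := fun i j => measureReal_mono inter_subset_left
  have hpb : ∀ i j, p i j ≤ b j := fun i j => measureReal_mono inter_subset_right
  have hp0 : ∀ i j, 0 ≤ p i j := fun i j => measureReal_nonneg
  have hprod : ∀ i j, μ.real ((fun x => (P x, Q x)) ⁻¹' {(i, j)}) = p i j := by
    intro i j
    simp only [hp]
    congr 1
    ext x
    simp
  have key : ∀ i j, Real.negMulLog (p i j) ≤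
      -(p i j * Real.log (a i)) - p i j * Real.log (b j) + (a i * b j - p i j) := by
    intro i j
    by_cases hz : p i j = 0
    · simp only [hz, Real.negMulLog_zero, zero_mul, neg_zero, sub_zero, zero_add]
      exact mul_nonneg measureReal_nonneg measureReal_nonneg
    have hpos : 0 < p i j := lt_of_le_of_ne (hp0 i j) (Ne.symm hz)
    have hai := hpos.trans_le (hpa i j)
    have hbj := hpos.trans_le (hpb i j)
    have := negMulLog_le_neg_mul_log_add (hp0 i j) (mul_pos hai hbj).le
      fun h => absurd h (mul_pos hai hbj).ne'
    rw [Real.log_mul hai.ne' hbj.ne'] at this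
    linarith
  calc partitionEntropy μ (fun x => (P x, Q x)) = ∑ i, ∑ j, Real.negMulLog (p i j) := by
        rw [partitionEntropy, Fintype.sum_prod_type]
        simp only [hprod]
    _ ≤ ∑ i, ∑ j, (-(p i j * Real.log (a i)) - p i j * Real.log (b j) + (a i * b j - p i j)) :=
        Finset.sum_le_sum fun i _ => Finset.sum_le_sum fun j _ => key i j
    _ = partitionEntropy μ P + partitionEntropy μ Q := by
        have e1 : ∑ i, ∑ j, p i j * Real.log (a i) = -partitionEntropy μ P := by
          simp only [← Finset.sum_mul, hp1, partitionEntropy, Real.negMulLog,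
            ← Finset.sum_neg_distrib]
          exact Finset.sum_congr rfl fun i _ => by simp only [ha]; ring
        have e2 : ∑ i, ∑ j, p i j * Real.log (b j) = -partitionEntropy μ Q := by
          rw [Finset.sum_comm]
          simp only [← Finset.sum_mul, hp2, partitionEntropy, Real.negMulLog,
            ← Finset.sum_neg_distrib]
          exact Finset.sum_congr rfl fun i _ => by simp only [hb]; ring
        have e3 : ∑ i, ∑ j, a i * b j = 1 := by
          rw [← Finset.sum_mul_sum, sum_measureReal_fiber μ hP, sum_measureReal_fiber μ hQ, one_mul]
        have e4 : ∑ i, ∑ j, p i j = 1 := by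
          simp only [hp1]
          exact sum_measureReal_fiber μ hP
        simp only [Finset.sum_add_distrib, Finset.sum_sub_distrib, Finset.sum_neg_distrib, e1, e2,
          e3, e4]
        ring

/-- Conditioning on a labelling `Q` with `|κ|` labels loses at most `log |κ|` of entropy. -/
theorem partitionEntropy_le_log_card_add_cond (μ : Measure X) [IsProbabilityMeasure μ] {P : X → ι}
    (hP : Measurable P) {Q : X → κ} (hQ : Measurable Q) :
    partitionEntropy μ P ≤ Real.log (Fintype.card κ) +
      ∑ c, μ.real (Q ⁻¹' {c}) *
        partitionEntropy (ProbabilityTheory.cond μ (Q ⁻¹' {c})) P := by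
  have h1 : partitionEntropy μ P ≤
      ∑ c, ∑ i, Real.negMulLog (μ.real (Q ⁻¹' {c} ∩ P ⁻¹' {i})) := by
    rw [Finset.sum_comm]
    refine Finset.sum_le_sum fun i _ => ?_
    rw [← sum_measureReal_inter_fiber μ hQ (P ⁻¹' {i})]
    simp only [inter_comm]
    exact negMulLog_sum_le _ _ fun _ _ => measureReal_nonneg
  have h2 : ∀ c, ∑ i, Real.negMulLog (μ.real (Q ⁻¹' {c} ∩ P ⁻¹' {i})) =
      Real.negMulLog (μ.real (Q ⁻¹' {c})) + μ.real (Q ⁻¹' {c}) *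
        partitionEntropy (ProbabilityTheory.cond μ (Q ⁻¹' {c})) P := by
    intro c
    have hQc := hQ (measurableSet_singleton c)
    rcases eq_or_ne (μ.real (Q ⁻¹' {c})) 0 with h0 | h0
    · have : ∀ i, μ.real (Q ⁻¹' {c} ∩ P ⁻¹' {i}) = 0 := fun i =>
        le_antisymm (h0 ▸ measureReal_mono inter_subset_left) measureReal_nonneg
      simp [h0, this]
    have h0' : μ (Q ⁻¹' {c}) ≠ 0 := fun h => h0 (by simp [Measure.real, h])
    have := ProbabilityTheory.cond_isProbabilityMeasure h0'
    have e : ∀ i, μ.real (Q ⁻¹' {c} ∩ P ⁻¹' {i}) = μ.real (Q ⁻¹' {c}) *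
        (ProbabilityTheory.cond μ (Q ⁻¹' {c})).real (P ⁻¹' {i}) := by
      intro i
      rw [Measure.real, Measure.real, Measure.real, ProbabilityTheory.cond_apply hQc,
        ENNReal.toReal_mul, ENNReal.toReal_inv]
      exact (mul_inv_cancel_left₀ h0 _).symm
    simp only [e, Real.negMulLog_mul, Finset.sum_add_distrib, ← Finset.sum_mul, partitionEntropy,
      ← Finset.mul_sum, sum_measureReal_fiber _ hP, one_mul]
  refine h1.trans ?_
  simp only [h2, Finset.sum_add_distrib]
  gcongr
  exact partitionEntropy_le_log_card μ hQ

theorem partitionEntropy_map {Y : Type*} [MeasurableSpace Y] (μ : Measure X) {T : X → Y}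
    (hT : Measurable T) {P : Y → ι} (hP : Measurable P) :
    partitionEntropy (μ.map T) P = partitionEntropy μ (P ∘ T) := by
  simp only [partitionEntropy, preimage_comp,
    map_measureReal_apply hT (hP (measurableSet_singleton _))]

/-- Entropy is a concave function of the measure. -/
theorem sum_partitionEntropy_le_of_average {ι : Type*} [Fintype ι] {n : ℕ} (hn : 0 < n)
    (σ : ℕ → Measure X) (μ : Measure X) (P : X → ι)
    (h : ∀ i, μ.real (P ⁻¹' {i}) = (∑ j ∈ Finset.range n, (σ j).real (P ⁻¹' {i})) / n) :
    ∑ j ∈ Finset.range n, partitionEntropy (σ j) P ≤ n * partitionEntropy μ P := by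
  have hn' : (0 : ℝ) < n := by exact_mod_cast hn
  simp only [partitionEntropy]
  rw [Finset.sum_comm, Finset.mul_sum]
  refine Finset.sum_le_sum fun i _ => ?_
  have := Real.concaveOn_negMulLog.le_map_sum (t := Finset.range n) (w := fun _ => (n : ℝ)⁻¹)
    (p := fun j => (σ j).real (P ⁻¹' {i})) (fun _ _ => by positivity)
    (by simp [hn'.ne']) (fun _ _ => by simp [measureReal_nonneg])
  simp only [smul_eq_mul, ← Finset.mul_sum] at this
  rw [h i, div_eq_inv_mul]
  rwa [inv_mul_le_iff₀ hn'] at this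

theorem measurable_partitionJoin {ι : Type*} [MeasurableSpace ι] {T : X → X}
    (hT : Measurable T) {P : X → ι} (hP : Measurable P)
    (n : ℕ) : Measurable (partitionJoin T P n) :=
  measurable_pi_lambda _ fun j => hP.comp (hT.iterate j)

theorem partitionEntropy_partitionJoin_le (μ : Measure X) [IsProbabilityMeasure μ] {T : X → X}
    (hT : Measurable T) {P : X → ι} (hP : Measurable P) (n i : ℕ) :
    partitionEntropy μ (partitionJoin T P n ∘ T^[i]) ≤ n * Real.log (Fintype.card ι) := by
  classical
  refine (partitionEntropy_le_log_card μ
    ((measurable_partitionJoin hT hP n).comp (hT.iterate i))).trans (le_of_eq ?_)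
  simp

theorem partitionEntropy_partitionJoin_mono (μ : Measure X) [IsProbabilityMeasure μ] {T : X → X}
    (hT : Measurable T) {P : X → ι} (hP : Measurable P) {m n : ℕ} (hmn : m ≤ n) (i : ℕ) :
    partitionEntropy μ (partitionJoin T P m ∘ T^[i]) ≤
      partitionEntropy μ (partitionJoin T P n ∘ T^[i]) := by
  classical
  exact partitionEntropy_comp_le μ ((measurable_partitionJoin hT hP n).comp (hT.iterate i))
    fun w j => w (Fin.castLE hmn j)

theorem partitionEntropy_partitionJoin_add_le (μ : Measure X) [IsProbabilityMeasure μ] {T : X → X}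
    (hT : Measurable T) {P : X → ι} (hP : Measurable P) (l m i : ℕ) :
    partitionEntropy μ (partitionJoin T P (l + m) ∘ T^[i]) ≤
      partitionEntropy μ (partitionJoin T P l ∘ T^[i]) +
        partitionEntropy μ (partitionJoin T P m ∘ T^[i + l]) := by
  classical
  have h1 := (measurable_partitionJoin hT hP l).comp (hT.iterate i)
  have h2 := (measurable_partitionJoin hT hP m).comp (hT.iterate (i + l))
  refine le_trans (le_of_eq ?_) ((partitionEntropy_comp_le μ (h1.prodMk h2)
    fun w => Fin.append w.1 w.2).trans (partitionEntropy_prodMk_le μ h1 h2))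
  congr 1
  funext x j
  refine Fin.addCases (fun j => ?_) (fun j => ?_) j
  · simp [partitionJoin]
  · simp only [partitionJoin, comp_apply, Fin.append_right, Fin.val_natAdd, ← iterate_add_apply]
    rw [show l + (j : ℕ) + i = j + (i + l) by ring]

theorem partitionEntropy_partitionJoin_mul_le (μ : Measure X) [IsProbabilityMeasure μ] {T : X → X}
    (hT : Measurable T) {P : X → ι} (hP : Measurable P) (q R i : ℕ) :
    partitionEntropy μ (partitionJoin T P (R * q) ∘ T^[i]) ≤
      ∑ r ∈ Finset.range R, partitionEntropy μ (partitionJoin T P q ∘ T^[i + r * q]) := by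
  induction R with
  | zero =>
    refine (partitionEntropy_partitionJoin_le μ hT hP _ i).trans ?_
    simp
  | succ R ih =>
    rw [Finset.sum_range_succ, Nat.succ_mul]
    exact (partitionEntropy_partitionJoin_add_le μ hT hP _ _ _).trans (add_le_add_left ih _)

/-- Misiurewicz' inequality: averaging over the `q` ways of cutting `[0, n)` into blocks of
length `q` bounds the entropy of the `n`-fold join. -/
theorem mul_partitionEntropy_partitionJoin_le (μ : Measure X) [IsProbabilityMeasure μ] {T : X → X}
    (hT : Measurable T) {P : X → ι} (hP : Measurable P) {q : ℕ} (hq : 0 < q) (n : ℕ) :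
    q * partitionEntropy μ (partitionJoin T P n) ≤
      ∑ i ∈ Finset.range n, partitionEntropy μ (partitionJoin T P q ∘ T^[i]) +
        2 * q ^ 2 * Real.log (Fintype.card ι) := by
  classical
  set g : ℕ → ℝ := fun i => partitionEntropy μ (partitionJoin T P q ∘ T^[i]) with hg
  set c := Real.log (Fintype.card ι) with hc
  have hc0 : 0 ≤ c := Real.log_natCast_nonneg _
  set R := n / q with hR
  have hj : ∀ j ∈ Finset.range q, partitionEntropy μ (partitionJoin T P n) ≤
      ∑ r ∈ Finset.range R, g (j + r * q) + 2 * q * c := by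
    intro j hj
    have hjq : (j : ℝ) ≤ q := by exact_mod_cast (Finset.mem_range.1 hj).le
    have hn : n ≤ j + (R * q + q) := by
      have := Nat.div_add_mod n q
      have h2 := Nat.mod_lt n hq
      rw [← hR, mul_comm] at this
      omega
    have h0 : partitionJoin T P n = partitionJoin T P n ∘ T^[0] := rfl
    rw [h0]
    have e1 := partitionEntropy_partitionJoin_mono μ hT hP hn 0
    have e2 := partitionEntropy_partitionJoin_add_le μ hT hP j (R * q + q) 0
    have e3 := partitionEntropy_partitionJoin_add_le μ hT hP (R * q) q (0 + j)
    have e4 := partitionEntropy_partitionJoin_mul_le μ hT hP q R (0 + j)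
    have e5 := partitionEntropy_partitionJoin_le μ hT hP j 0
    have e6 := partitionEntropy_partitionJoin_le μ hT hP q (0 + j + R * q)
    rw [zero_add] at *
    have e7 : j * c ≤ q * c := mul_le_mul_of_nonneg_right hjq hc0
    linarith
  have h1 := Finset.sum_le_sum hj
  rw [Finset.sum_const, Finset.card_range, nsmul_eq_mul, Finset.sum_add_distrib, Finset.sum_const,
    Finset.card_range, nsmul_eq_mul, Finset.sum_comm] at h1
  have h2 : ∀ R : ℕ, ∑ r ∈ Finset.range R, ∑ j ∈ Finset.range q, g (j + r * q) =
      ∑ i ∈ Finset.range (R * q), g i := by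
    intro R
    induction R with
    | zero => simp
    | succ R ih =>
      rw [Finset.sum_range_succ, ih, Nat.succ_mul, Finset.sum_range_add]
      simp only [add_comm]
  rw [h2] at h1
  have h3 : ∑ i ∈ Finset.range (R * q), g i ≤ ∑ i ∈ Finset.range n, g i :=
    Finset.sum_le_sum_of_subset_of_nonneg
      (Finset.range_subset_range.2 (Nat.div_mul_le_self n q))
      fun i _ _ => partitionEntropy_nonneg μ _
  linarith

/-- A set of words whose letters carry weights `w ≥ 0` has at most `(∑ w) ^ n / c` elements if
every word has total weight at least `c`. -/
theorem card_mul_le_sum_weight_pow {A : Type*} [Fintype A] {n : ℕ} (W : Finset (Fin n → A))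
    (w : A → ℝ) (hw : ∀ a, 0 ≤ w a) {c : ℝ} (hc : ∀ v ∈ W, c ≤ ∏ j, w (v j)) :
    W.card * c ≤ (∑ a, w a) ^ n := by
  classical
  calc W.card * c = ∑ v ∈ W, c := by simp
    _ ≤ ∑ v ∈ W, ∏ j, w (v j) := Finset.sum_le_sum hc
    _ ≤ ∑ v : Fin n → A, ∏ j, w (v j) :=
        Finset.sum_le_sum_of_subset_of_nonneg (Finset.subset_univ _)
          fun v _ _ => Finset.prod_nonneg fun j _ => hw _
    _ = (∑ a, w a) ^ n := by
        rw [← Fintype.piFinset_univ, ← Finset.prod_univ_sum]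
        simp

end FiniteEntropy

/-! ### Vanishing of metric entropy from small Bowen covers -/

section Katok

/-- If `P` takes its values in `W` on `Λ`, then its entropy is essentially at most `log #W`, the
contribution of the other values being weighted by the measure of the complement of `Λ`. -/
theorem partitionEntropy_le_of_mapsTo {X ι : Type*} [MeasurableSpace X] [Fintype ι]
    [MeasurableSpace ι] [MeasurableSingletonClass ι] (μ : Measure X) [IsProbabilityMeasure μ]
    {P : X → ι} (hP : Measurable P) (W : Finset ι) {Λ : Set X} (hΛ : ∀ x ∈ Λ, P x ∈ W) :
    partitionEntropy μ P ≤
      2 + Real.log W.card + μ.real Λᶜ * Real.log (Fintype.card ι) := by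
  classical
  have hle : ∀ x : ℝ, 0 ≤ x → Real.negMulLog x ≤ 1 := fun x hx => by
    have := negMulLog_le_neg_mul_log_add hx zero_le_one (by norm_num)
    simp only [Real.log_one, mul_zero, neg_zero, zero_add] at this
    linarith
  have h0 : ∀ i ∈ W, 0 ≤ μ.real (P ⁻¹' {i}) := fun _ _ => measureReal_nonneg
  have h0' : ∀ i ∈ Wᶜ, 0 ≤ μ.real (P ⁻¹' {i}) := fun _ _ => measureReal_nonneg
  have hm := fun (i : ι) (_ : i ∈ W) => hP (measurableSet_singleton i)
  have hm' := fun (i : ι) (_ : i ∈ Wᶜ) => hP (measurableSet_singleton i)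
  have h1 := sum_negMulLog_le W _ h0
  have h2 := sum_negMulLog_le Wᶜ _ h0'
  have e1 : ∑ i ∈ W, μ.real (P ⁻¹' {i}) ≤ 1 := by
    rw [sum_measureReal_preimage_singleton _ hm]
    exact measureReal_le_one
  have e2 : ∑ i ∈ Wᶜ, μ.real (P ⁻¹' {i}) ≤ μ.real Λᶜ := by
    rw [sum_measureReal_preimage_singleton _ hm']
    refine measureReal_mono fun x hx hxΛ => ?_
    have := hΛ x hxΛ
    simp_all
  have l1 : 0 ≤ Real.log W.card := Real.log_natCast_nonneg _
  have l2 : 0 ≤ Real.log (Wᶜ : Finset ι).card := Real.log_natCast_nonneg _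
  have l3 : Real.log (Wᶜ : Finset ι).card ≤ Real.log (Fintype.card ι) := by
    rcases (Wᶜ : Finset ι).card.eq_zero_or_pos with h | h
    · rw [h, Nat.cast_zero, Real.log_zero]
      exact Real.log_natCast_nonneg _
    · exact Real.log_le_log (by exact_mod_cast h) (by exact_mod_cast Finset.card_le_univ _)
  have h3 := hle _ (Finset.sum_nonneg h0)
  have h4 := hle _ (Finset.sum_nonneg h0')
  have h5 := mul_le_mul_of_nonneg_right e1 l1
  have h6 := mul_le_mul e2 l3 l2 measureReal_nonneg
  rw [partitionEntropy, ← Finset.sum_add_sum_compl W]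
  linarith

/-- A measurable function with finitely many values takes them, up to a set of small measure, on
compact sets which are a positive distance apart. -/
theorem exists_separated_compact_fibers {X ι : Type*} [MetricSpace X] [CompactSpace X]
    [MeasurableSpace X] [BorelSpace X] [Fintype ι] [MeasurableSpace ι] [MeasurableSingletonClass ι]
    (μ : Measure X) [IsProbabilityMeasure μ] {P : X → ι} (hP : Measurable P) {η : ℝ}
    (hη : 0 < η) :
    ∃ (K : Set X) (ε : ℝ), 0 < ε ∧ MeasurableSet K ∧ μ.real Kᶜ ≤ η ∧
      ∀ x ∈ K, ∀ y ∈ K, dist x y < 2 * ε → P x = P y := by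
  have hη' : ENNReal.ofReal (η / (Fintype.card ι + 1)) ≠ 0 := by
    have : 0 < η / (Fintype.card ι + 1) := by positivity
    simpa using this
  choose K hKP hK hKη using fun i : ι => (hP (measurableSet_singleton i)).exists_isCompact_sdiff_lt
    (measure_ne_top μ _) hη'
  have hsep : ∀ᶠ ε in 𝓝[>] (0 : ℝ), ∀ i j : ι, i ≠ j → ∀ x ∈ K i, ∀ y ∈ K j, 2 * ε ≤ dist x y := by
    rw [Filter.eventually_all]
    intro i
    rw [Filter.eventually_all]
    intro j
    rcases eq_or_ne i j with rfl | hij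
    · simp
    have hd : Disjoint (K i) (K j) := by
      rw [Set.disjoint_left]
      intro x hx hy
      exact hij ((hKP i hx).symm.trans (hKP j hy))
    obtain ⟨δ, hδ, hdis⟩ := hd.exists_thickenings (hK i) (hK j).isClosed
    filter_upwards [Ioo_mem_nhdsGT (half_pos hδ)] with ε hε _ x hx y hy
    by_contra! hlt
    refine Set.disjoint_left.1 hdis (Metric.self_subset_thickening hδ _ hx)
      (Metric.mem_thickening_iff.2 ⟨y, hy, ?_⟩)
    linarith [hε.2]
  obtain ⟨ε, hε, hε0⟩ := (hsep.and self_mem_nhdsWithin).exists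
  refine ⟨⋃ i, K i, ε, hε0, MeasurableSet.iUnion fun i => (hK i).measurableSet, ?_, ?_⟩
  · have hsub : (⋃ i, K i)ᶜ ⊆ ⋃ i, (P ⁻¹' {i} \ K i) := by
      intro x hx
      rw [mem_compl_iff, mem_iUnion, not_exists] at hx
      exact mem_iUnion.2 ⟨P x, rfl, hx _⟩
    have h1 : μ (⋃ i, K i)ᶜ ≤ ENNReal.ofReal η := by
      calc μ (⋃ i, K i)ᶜ ≤ ∑ i, μ (P ⁻¹' {i} \ K i) :=
            (measure_mono hsub).trans (measure_iUnion_fintype_le μ _)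
        _ ≤ ∑ _i : ι, ENNReal.ofReal (η / (Fintype.card ι + 1)) :=
            Finset.sum_le_sum fun i _ => (hKη i).le
        _ ≤ ENNReal.ofReal η := by
            rw [Finset.sum_const, nsmul_eq_mul, ← ENNReal.ofReal_natCast,
              ← ENNReal.ofReal_mul (by positivity)]
            refine ENNReal.ofReal_le_ofReal ?_
            rw [Finset.card_univ, mul_div_assoc', div_le_iff₀ (by positivity)]
            nlinarith
    exact ENNReal.toReal_le_of_le_ofReal hη.le h1
  · intro x hx y hy hxy
    obtain ⟨i, hi⟩ := mem_iUnion.1 hx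
    obtain ⟨j, hj⟩ := mem_iUnion.1 hy
    have hij : i = j := by
      by_contra hij
      linarith [hε i j hij x hi y hj]
    subst hij
    exact (hKP i hi : P x = i).trans (hKP i hj : P y = i).symm

/-- The number of visits to `A` of the first `n` points of an orbit is rarely larger than
`√(μ A) n`. -/
theorem measureReal_visits_le {X : Type*} [MeasurableSpace X] {T : X → X} (μ : Measure X)
    [IsProbabilityMeasure μ] (hT : MeasurePreserving T μ μ) {A : Set X} (hA : MeasurableSet A)
    {θ : ℝ} (hθ : 0 < θ) (hAθ : μ.real A ≤ θ ^ 2) {n : ℕ} (hn : 0 < n) :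
    MeasurableSet {x | θ * n ≤ ∑ i ∈ Finset.range n, A.indicator (fun _ => (1 : ℝ)) (T^[i] x)} ∧
    μ.real {x | θ * n ≤ ∑ i ∈ Finset.range n, A.indicator (fun _ => (1 : ℝ)) (T^[i] x)} ≤ θ := by
  have hn' : (0 : ℝ) < n := by exact_mod_cast hn
  have hmeas : ∀ i, Measurable fun x => A.indicator (fun _ => (1 : ℝ)) (T^[i] x) := fun i =>
    (measurable_const.indicator hA).comp (hT.iterate i).measurable
  have hsum : Measurable fun x =>
      ∑ i ∈ Finset.range n, A.indicator (fun _ => (1 : ℝ)) (T^[i] x) :=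
    Finset.measurable_sum _ fun i _ => hmeas i
  refine ⟨measurableSet_le measurable_const hsum, ?_⟩
  have hint : Integrable (A.indicator fun _ => (1 : ℝ)) μ :=
    (integrable_const _).indicator hA
  have hinti : ∀ i ∈ Finset.range n,
      Integrable (fun x => A.indicator (fun _ => (1 : ℝ)) (T^[i] x)) μ := fun i _ =>
    (hT.iterate i).integrable_comp_of_integrable hint
  have h1 := mul_meas_ge_le_integral_of_nonneg (μ := μ)
    (f := fun x => ∑ i ∈ Finset.range n, A.indicator (fun _ => (1 : ℝ)) (T^[i] x))
    (.of_forall fun x => Finset.sum_nonneg fun i _ => indicator_nonneg (fun _ _ => zero_le_one) _)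
    (integrable_finsetSum _ hinti) (θ * n)
  have h2 : ∀ i ∈ Finset.range n,
      ∫ x, A.indicator (fun _ => (1 : ℝ)) (T^[i] x) ∂μ = μ.real A := by
    intro i _
    have h3 : ∫ x, A.indicator (fun _ => (1 : ℝ)) (T^[i] x) ∂μ =
        ∫ x, A.indicator (fun _ => (1 : ℝ)) x ∂(μ.map T^[i]) :=
      (integral_map (hT.iterate i).aemeasurable
        (measurable_const.indicator hA).aestronglyMeasurable).symm
    rw [h3, (hT.iterate i).map_eq]
    simp [integral_indicator hA]
  rw [integral_finsetSum _ hinti, Finset.sum_congr rfl h2, Finset.sum_const, Finset.card_range,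
    nsmul_eq_mul] at h1
  have h4 : θ * n * _ ≤ θ * n * θ := h1.trans (by nlinarith)
  exact le_of_mul_le_mul_left h4 (by positivity)

/-- Words of length `n` read along orbits which stay `ε`-close to the orbit of `y`, and which visit
the complement of `K` fewer than `θ n` times: at a visit to `K` the letter is determined by `y`, so
only the letters outside `K` have to be recorded. -/
theorem card_words_near_orbit_le {X ι : Type*} [MetricSpace X] [Fintype ι] [DecidableEq ι]
    {T : X → X} {P : X → ι}
    {K : Set X} {ε : ℝ} (hK : ∀ x ∈ K, ∀ y ∈ K, dist x y < 2 * ε → P x = P y) {n : ℕ} {θ t : ℝ}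
    (ht : 0 < t) (ht1 : t ≤ 1) (y : X) (W : Finset (Fin n → ι))
    (hW : ∀ w ∈ W, ∃ x, partitionJoin T P n x = w ∧ (∀ i < n, dist (T^[i] x) (T^[i] y) < ε) ∧
      ∑ i ∈ Finset.range n, Kᶜ.indicator (fun _ => (1 : ℝ)) (T^[i] x) ≤ θ * n) :
    W.card * t ^ (θ * n) ≤ (1 + Fintype.card ι * t) ^ n := by
  classical
  have : Nonempty X := ⟨y⟩
  choose! x hx using hW
  -- forget the letters read in `K`; two words with the same code agree there because both orbits
  -- are within `2 * ε` of each other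
  let code : (Fin n → ι) → (Fin n → Option ι) := fun w j =>
    if T^[j] (x w) ∈ K then none else some (w j)
  have hinj : InjOn code W := by
    intro w hw w' hw' hww
    funext j
    have hj := congrFun hww j
    simp only [code] at hj
    obtain ⟨h1, h2, -⟩ := hx w hw
    obtain ⟨h1', h2', -⟩ := hx w' hw'
    split_ifs at hj with ha hb hb
    · rw [← h1, ← h1']
      refine hK _ ha _ hb ?_
      have := dist_triangle_right (T^[j] (x w)) (T^[j] (x w')) (T^[j] y)
      linarith [h2 j j.2, h2' j j.2]
    · exact Option.some_injective _ hj
  let wt : Option ι → ℝ := fun o => o.elim 1 fun _ => t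
  have hwt : ∀ o, 0 ≤ wt o := by
    rintro (_ | _)
    · exact zero_le_one
    · exact ht.le
  have hsum : ∑ o, wt o = 1 + Fintype.card ι * t := by
    rw [Fintype.sum_option]
    simp [wt]
  have := card_mul_le_sum_weight_pow (W.image code) wt hwt (c := t ^ (θ * n)) (by
    intro v hv
    obtain ⟨w, hw, rfl⟩ := Finset.mem_image.1 hv
    obtain ⟨-, -, h3⟩ := hx w hw
    have e : ∀ j : Fin n, wt (code w j) =
        t ^ (Kᶜ.indicator (fun _ => (1 : ℝ)) (T^[j] (x w))) := by
      intro j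
      by_cases hj : T^[j] (x w) ∈ K
      · simp [code, wt, hj]
      · simp [code, wt, hj]
    simp only [e]
    rw [← Real.rpow_sum_of_pos ht]
    rw [Finset.sum_range] at h3
    exact Real.rpow_le_rpow_of_exponent_ge ht ht1 h3)
  rwa [hsum, Finset.card_image_of_injOn hinj] at this

/-- If, for every `δ > 0`, subexponentially many Bowen balls cover a set of measure `≥ 1 - δ`,
then the metric entropy vanishes. -/
theorem metricEntropy_eq_zero_of_bowen_cover {X : Type*} [MetricSpace X] [CompactSpace X]
    [MeasurableSpace X] [BorelSpace X] {T : X → X} (μ : Measure X) [IsProbabilityMeasure μ]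
    (hT : MeasurePreserving T μ μ)
    (H : ∀ ε > 0, ∀ δ > 0, ∀ κ > 0, ∀ᶠ n : ℕ in atTop, ∃ (F : Finset X) (Λ : Set X),
      MeasurableSet Λ ∧ μ.real Λᶜ ≤ δ ∧ (F.card : ℝ) ≤ Real.exp (κ * n) ∧
      ∀ x ∈ Λ, ∃ y ∈ F, ∀ i < n, dist (T^[i] x) (T^[i] y) < ε) :
    metricEntropy T μ = 0 := by
  classical
  rw [metricEntropy]
  simp only [ENNReal.iSup_eq_zero]
  intro k P hP
  suffices h : ∀ κ > 0, ∀ᶠ n : ℕ in atTop,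
      partitionEntropy μ (partitionJoin T P n) / n ≤ 6 * κ by
    refine le_antisymm (ENNReal.le_of_forall_pos_le_add fun η hη _ => ?_) zero_le
    rw [zero_add]
    refine limsup_le_of_le (by isBoundedDefault) ?_
    filter_upwards [h (η / 6) (by positivity)] with n hn
    calc _ ≤ ENNReal.ofReal η := ENNReal.ofReal_le_ofReal (by linarith)
      _ = η := ENNReal.ofReal_coe_nnreal
  intro κ hκ
  -- `t` and `θ` make the number of words recording the visits outside `K` at most `exp (2 κ n)`
  set t : ℝ := min 1 (κ / (k + 1)) with ht
  have ht0 : 0 < t := by positivity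
  have ht1 : t ≤ 1 := min_le_left _ _
  have hkt : k * t ≤ κ := by
    calc k * t ≤ k * (κ / (k + 1)) := by gcongr; exact min_le_right _ _
      _ ≤ κ := by
        rw [mul_div_assoc', div_le_iff₀ (by positivity)]
        nlinarith
  have hlt : 0 ≤ -Real.log t := by linarith [Real.log_nonpos ht0.le ht1]
  have hlk : 0 ≤ Real.log k := Real.log_natCast_nonneg _
  set θ : ℝ := κ / (1 + -Real.log t + Real.log k) with hθ
  have hθ0 : 0 < θ := by positivity
  have hθt : θ * -Real.log t ≤ κ := by
    rw [hθ, div_mul_eq_mul_div, div_le_iff₀ (by positivity)]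
    nlinarith
  have hθk : θ * Real.log k ≤ κ := by
    rw [hθ, div_mul_eq_mul_div, div_le_iff₀ (by positivity)]
    nlinarith
  obtain ⟨K, ε, hε, hKm, hKθ, hK⟩ := exists_separated_compact_fibers μ hP (pow_pos hθ0 2)
  filter_upwards [H ε hε θ hθ0 κ hκ, eventually_gt_atTop 0,
    eventually_ge_atTop ⌈2 / κ⌉₊] with n hn hn0 hnκ
  obtain ⟨F, Λ, hΛm, hΛ, hF, hcov⟩ := hn
  have hn' : (0 : ℝ) < n := by exact_mod_cast hn0
  have hnκ' : 2 ≤ κ * n := by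
    have := (Nat.le_ceil (2 / κ)).trans (Nat.cast_le.2 hnκ)
    rwa [div_le_iff₀' hκ] at this
  obtain ⟨hVm, hV⟩ := measureReal_visits_le μ hT hKm.compl hθ0 hKθ hn0
  set V := {x | θ * n ≤ ∑ i ∈ Finset.range n, Kᶜ.indicator (fun _ => (1 : ℝ)) (T^[i] x)} with hVdef
  set Λ' := Λ \ V with hΛ'
  have hΛ'm : μ.real Λ'ᶜ ≤ 2 * θ := by
    have : Λ'ᶜ ⊆ Λᶜ ∪ V := by
      intro x hx
      by_cases hxΛ : x ∈ Λ
      · right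
        by_contra hxV
        exact hx ⟨hxΛ, hxV⟩
      · exact Or.inl hxΛ
    linarith [(measureReal_mono (μ := μ) this).trans (measureReal_union_le _ _)]
  let Wy : X → Finset (Fin n → Fin k) := fun y => Finset.univ.filter fun w =>
    ∃ x, partitionJoin T P n x = w ∧ (∀ i < n, dist (T^[i] x) (T^[i] y) < ε) ∧
      ∑ i ∈ Finset.range n, Kᶜ.indicator (fun _ => (1 : ℝ)) (T^[i] x) ≤ θ * n
  set W : Finset (Fin n → Fin k) := F.biUnion Wy with hW
  have hΛW : ∀ x ∈ Λ', partitionJoin T P n x ∈ W := by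
    rintro x ⟨hxΛ, hxV⟩
    obtain ⟨y, hy, hxy⟩ := hcov x hxΛ
    refine Finset.mem_biUnion.2 ⟨y, hy, Finset.mem_filter.2 ⟨Finset.mem_univ _, x, rfl, hxy, ?_⟩⟩
    rw [hVdef, mem_ofPred_eq, not_le] at hxV
    exact hxV.le
  have hWy : ∀ y, ((Wy y).card : ℝ) ≤ Real.exp (2 * κ * n) := by
    intro y
    have h1 := card_words_near_orbit_le hK ht0 ht1 y (Wy y) fun w hw => (Finset.mem_filter.1 hw).2
    have h2 : (1 + (Fintype.card (Fin k)) * t) ^ n ≤ Real.exp (κ * n) := by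
      rw [Fintype.card_fin]
      calc (1 + (k : ℝ) * t) ^ n ≤ (Real.exp κ) ^ n := by
            gcongr
            linarith [Real.add_one_le_exp κ]
        _ = Real.exp (κ * n) := by rw [← Real.exp_nat_mul, mul_comm]
    have h3 : Real.exp (-(κ * n)) ≤ t ^ (θ * n) := by
      rw [Real.rpow_def_of_pos ht0]
      refine Real.exp_le_exp.2 ?_
      nlinarith
    have h4 : ((Wy y).card : ℝ) * Real.exp (-(κ * n)) ≤ Real.exp (κ * n) :=
      (mul_le_mul_of_nonneg_left h3 (Nat.cast_nonneg _)).trans (h1.trans h2)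
    rw [Real.exp_neg, ← div_eq_mul_inv, div_le_iff₀ (Real.exp_pos _), ← Real.exp_add] at h4
    exact h4.trans (le_of_eq (by ring_nf))
  have hWc : (W.card : ℝ) ≤ Real.exp (3 * κ * n) := by
    calc (W.card : ℝ) ≤ ∑ y ∈ F, ((Wy y).card : ℝ) := by exact_mod_cast Finset.card_biUnion_le
      _ ≤ F.card * Real.exp (2 * κ * n) := by
        rw [← nsmul_eq_mul]
        exact Finset.sum_le_card_nsmul _ _ _ fun y _ => hWy y
      _ ≤ Real.exp (κ * n) * Real.exp (2 * κ * n) := by gcongr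
      _ = Real.exp (3 * κ * n) := by rw [← Real.exp_add]; ring_nf
  have hlogW : Real.log W.card ≤ 3 * κ * n := by
    rcases W.card.eq_zero_or_pos with h | h
    · rw [h, Nat.cast_zero, Real.log_zero]
      positivity
    · rw [Real.log_le_iff_le_exp (by exact_mod_cast h)]
      exact hWc
  have hfin := partitionEntropy_le_of_mapsTo μ (measurable_partitionJoin hT.measurable hP n) W hΛW
  have hcard : Real.log (Fintype.card (Fin n → Fin k)) = n * Real.log k := by simp
  rw [hcard] at hfin
  rw [div_le_iff₀ hn']
  have h7 : μ.real Λ'ᶜ * (n * Real.log k) ≤ 2 * θ * (n * Real.log k) :=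
    mul_le_mul_of_nonneg_right hΛ'm (by positivity)
  nlinarith

end Katok

/-! ### Counting orbits of a time change -/

section TimeChange

variable {X : Type*} [MetricSpace X]

/-- `ψ` is obtained from the flow `φ` by a non-negative change of speed, bounded by `C`: in time `t`
the `ψ`-orbit of `p` covers the `φ`-orbit segment of length `h t p`. -/
structure IsTimeChange {X : Type*} [TopologicalSpace X] (φ ψ : Flow ℝ X) (h : ℝ → X → ℝ) (C : ℝ) :
    Prop where
  continuous : ∀ p, Continuous fun t => h t p
  monotone : ∀ p, Monotone fun t => h t p
  zero : ∀ p, h 0 p = 0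
  le_mul : ∀ t p, 0 ≤ t → h t p ≤ C * t
  flow_eq : ∀ t p, ψ t p = φ (h t p) p

/-- Any two points of `E` are at least `δ` apart at some time in `[0, L]`. -/
def IsFlowSeparated (φ : Flow ℝ X) (L δ : ℝ) (E : Finset X) : Prop :=
  ∀ x ∈ E, ∀ y ∈ E, x ≠ y → ∃ u ∈ Icc 0 L, δ ≤ dist (φ u x) (φ u y)

/-- Any two points of `E` are at least `δ` apart at one of the times `0, …, n - 1`. -/
def IsBowenSeparated (T : X → X) (n : ℕ) (δ : ℝ) (E : Finset X) : Prop :=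
  ∀ x ∈ E, ∀ y ∈ E, x ≠ y → ∃ i < n, δ ≤ dist (T^[i] x) (T^[i] y)

/-- A maximal subset of `E` of pairwise unrelated elements meets the `r`-class of every element. -/
theorem Finset.exists_separated_subset {β : Type*} (E : Finset β) (r : β → β → Prop)
    (hr : ∀ x, r x x) (hs : ∀ x y, r x y → r y x) :
    ∃ G ⊆ E, (∀ x ∈ G, ∀ y ∈ G, x ≠ y → ¬ r x y) ∧ ∀ y ∈ E, ∃ g ∈ G, r y g := by
  classical
  induction E using Finset.induction_on with
  | empty => exact ⟨∅, by simp⟩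
  | insert a s _ ih =>
    obtain ⟨G, hG, hsep, hcov⟩ := ih
    by_cases ha : ∃ g ∈ G, r a g
    · refine ⟨G, hG.trans (Finset.subset_insert _ _), hsep, fun y hy => ?_⟩
      rcases Finset.mem_insert.1 hy with rfl | hy
      · exact ha
      · exact hcov y hy
    · push Not at ha
      refine ⟨insert a G, Finset.insert_subset_insert _ hG, ?_, fun y hy => ?_⟩
      · intro x hx y hy hxy
        rcases Finset.mem_insert.1 hx with hx' | hx' <;>
          rcases Finset.mem_insert.1 hy with hy' | hy'
        · exact absurd (hx'.trans hy'.symm) hxy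
        · exact hx' ▸ ha y hy'
        · exact fun h => ha x hx' (hy' ▸ hs _ _ h)
        · exact hsep x hx' y hy' hxy
      · rcases Finset.mem_insert.1 hy with rfl | hy
        · exact ⟨y, Finset.mem_insert_self _ _, hr y⟩
        · obtain ⟨g, hg, h⟩ := hcov y hy
          exact ⟨g, Finset.mem_insert_of_mem hg, h⟩

theorem exists_dist_lt_of_continuous [CompactSpace X] {Y : Type*} [PseudoMetricSpace Y]
    {F : ℝ × X → Y} (hF : Continuous F) (a b : ℝ) {ε : ℝ} (hε : 0 < ε) :
    ∃ δ > 0, ∀ s ∈ Icc a b, ∀ t ∈ Icc a b, ∀ p q : X, |s - t| < δ → dist p q < δ →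
      dist (F (s, p)) (F (t, q)) < ε := by
  have h1 : UniformContinuousOn F (Icc a b ×ˢ univ) :=
    (isCompact_Icc.prod isCompact_univ).uniformContinuousOn_of_continuous hF.continuousOn
  obtain ⟨δ, hδ, h⟩ := Metric.uniformContinuousOn_iff.1 h1 ε hε
  refine ⟨δ, hδ, fun s hs t ht p q hst hpq => h _ ⟨hs, mem_univ _⟩ _ ⟨ht, mem_univ _⟩ ?_⟩
  rw [Prod.dist_eq]
  exact max_lt hst hpq

theorem Flow.exists_dist_time_lt [CompactSpace X] (ψ : Flow ℝ X) {ε : ℝ} (hε : 0 < ε) :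
    ∃ δ > 0, ∀ s t p, |s - t| < δ → dist (ψ s p) (ψ t p) < ε := by
  obtain ⟨δ, hδ, h⟩ := exists_dist_lt_of_continuous (F := fun z : ℝ × X => ψ z.1 z.2) ψ.cont'
    (-1) 1 hε
  refine ⟨min δ 1, by positivity, fun s t p hst => ?_⟩
  have h1 := abs_lt.1 (hst.trans_le (min_le_right _ _))
  have := h (s - t) ⟨by linarith, by linarith⟩ 0 (by simp) (ψ t p) (ψ t p)
    (by simpa using hst.trans_le (min_le_left _ _)) (by simpa using hδ)
  simpa [← Flow.map_add] using this

theorem Flow.exists_dist_lt [CompactSpace X] (ψ : Flow ℝ X) (A : ℝ) {ε : ℝ} (hε : 0 < ε) :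
    ∃ δ > 0, ∀ r ∈ Icc 0 A, ∀ p q, dist p q < δ → dist (ψ r p) (ψ r q) < ε := by
  obtain ⟨δ, hδ, h⟩ := exists_dist_lt_of_continuous (F := fun z : ℝ × X => ψ z.1 z.2) ψ.cont'
    0 A hε
  exact ⟨δ, hδ, fun r hr p q hpq => h r hr r hr p q (by simpa using hδ) hpq⟩

theorem exists_finite_coloring [CompactSpace X] {δ : ℝ} (hδ : 0 < δ) :
    ∃ (A : ℕ) (c : X → Fin A), ∀ x y, c x = c y → dist x y < δ := by
  obtain ⟨t, -, ht, hcov⟩ := (isCompact_univ (X := X)).finite_cover_balls (half_pos hδ)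
  have := ht.to_subtype
  obtain ⟨A, ⟨e⟩⟩ := Finite.exists_equiv_fin t
  have hc : ∀ x : X, ∃ y : t, dist x y < δ / 2 := by
    intro x
    have := hcov (mem_univ x)
    simp only [mem_iUnion, Metric.mem_ball] at this
    obtain ⟨y, hy, h⟩ := this
    exact ⟨⟨y, hy⟩, h⟩
  choose c hc using hc
  refine ⟨A, fun x => e (c x), fun x y hxy => ?_⟩
  have h1 : c x = c y := e.injective hxy
  have h2 := hc x
  rw [h1] at h2
  linarith [dist_triangle_right x y (c y : X), hc y]

/-- A flow has only exponentially many separated orbits. This bounds the length of the orbit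
segments from below when many separated ones are present. -/
theorem exists_card_le_pow_of_isFlowSeparated [CompactSpace X] (φ : Flow ℝ X) {δ : ℝ}
    (hδ : 0 < δ) :
    ∃ A : ℕ, ∀ (n : ℕ) (G : Finset X), IsFlowSeparated φ n δ G → G.card ≤ A ^ (n + 1) := by
  classical
  obtain ⟨δ', hδ', h⟩ := φ.exists_dist_lt 1 hδ
  obtain ⟨A, c, hc⟩ := exists_finite_coloring (X := X) hδ'
  refine ⟨A, fun n G hG => ?_⟩
  have hinj : InjOn (fun x (i : Fin (n + 1)) => c (φ i x)) G := by
    intro x hx y hy hxy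
    by_contra hne
    obtain ⟨u, hu, hd⟩ := hG x hx y hy hne
    have hi : ⌊u⌋₊ < n + 1 := Nat.lt_succ_of_le (Nat.floor_le_of_le hu.2)
    have h1 := h (u - ⌊u⌋₊) ⟨by linarith [Nat.floor_le hu.1], by linarith [Nat.lt_floor_add_one u]⟩
      _ _ (hc _ _ (congrFun hxy ⟨_, hi⟩))
    simp only [← Flow.map_add, sub_add_cancel] at h1
    exact absurd h1 (not_lt.2 hd)
  calc G.card ≤ (Finset.univ : Finset (Fin (n + 1) → Fin A)).card :=
        Finset.card_le_card_of_injOn _ (fun _ _ => Finset.mem_univ _) hinj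
    _ = A ^ (n + 1) := by simp

/-- Points of `S` whose `φ`-orbits stay close to that of `x` differ only by the timing of their
`ψ`-orbits. The timing is measured by `Θ`, the time at which the orbit of `x` has covered the same
distance; since a time shift along the orbit of `x` is preserved by `ψ`, it suffices to record `Θ`
to the fixed precision `1 / K` once in every block of `l` time units. -/
theorem card_le_of_flow_close {φ ψ : Flow ℝ X} {h : ℝ → X → ℝ} {C : ℝ} (hh : IsTimeChange φ ψ h C)
    {ε δ : ℝ} {K l : ℕ} (hK : 0 < K) (hl : 0 < l)
    (hψK : ∀ s t p, |s - t| < 1 / (K : ℝ) → dist (ψ s p) (ψ t p) < ε / 3)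
    (hδ : ∀ r ∈ Icc 0 (l : ℝ), ∀ p q, dist p q < δ → dist (ψ r p) (ψ r q) < ε / 3)
    {N : ℕ} {S : Finset X} (hS : IsBowenSeparated (ψ 1) N ε S) {x : X}
    (hx : ∀ y ∈ S, h N y ≤ h N x)
    (hclose : ∀ y ∈ S, ∀ u ∈ Icc 0 (h N x), dist (φ u y) (φ u x) < δ) {z : ℝ} (hz : 0 < z)
    (hz1 : z < 1) :
    S.card * z ^ (K * N) ≤ (1 / (1 - z)) ^ (N / l + 1) := by
  classical
  have hN : (0 : ℝ) ≤ N := Nat.cast_nonneg _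
  have hK' : (0 : ℝ) < K := by exact_mod_cast hK
  have hiter : ∀ (i : ℕ) p, (ψ 1)^[i] p = ψ i p := by
    intro i p
    induction i with
    | zero => simp
    | succ i ih => rw [iterate_succ_apply', ih, ← Flow.map_add]; push_cast; rw [add_comm]
  -- a time at which the orbit of `x` has covered the distance `v`
  have hΘ : ∀ v ∈ Icc 0 (h N x), ∃ θ ∈ Icc (0 : ℝ) N, h θ x = v := by
    intro v hv
    have := intermediate_value_Icc hN (hh.continuous x).continuousOn
    simp only [hh.zero] at this
    exact this hv
  choose! Θ hΘ1 hΘ2 using hΘ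
  have hΘmono : ∀ v ∈ Icc 0 (h N x), ∀ w ∈ Icc 0 (h N x), v ≤ w → Θ v ≤ Θ w := by
    intro v hv w hw hvw
    rcases hvw.eq_or_lt with rfl | hlt
    · exact le_rfl
    by_contra! hc
    have := hh.monotone x hc.le
    simp only [hΘ2 v hv, hΘ2 w hw] at this
    linarith
  -- the distance covered by `y` up to the beginning of the `j`-th block
  let v : X → ℕ → ℝ := fun y j => h ((min (j * l) N : ℕ) : ℝ) y
  have hv : ∀ y ∈ S, ∀ j, v y j ∈ Icc 0 (h N x) := by
    intro y hy j
    refine ⟨?_, ?_⟩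
    · rw [← hh.zero y]
      exact hh.monotone y (Nat.cast_nonneg _)
    · refine (hh.monotone y ?_).trans (hx y hy)
      exact_mod_cast min_le_right _ _
  have hvmono : ∀ y, Monotone (v y) := by
    intro y i j hij
    refine hh.monotone y ?_
    exact_mod_cast min_le_min_right _ (Nat.mul_le_mul_right _ hij)
  -- the timing at the beginning of the blocks, rounded to the precision `1 / K` and preceded by `0`
  let m : X → ℕ → ℕ := fun y j => Nat.casesOn j 0 fun j => ⌊K * Θ (v y j)⌋₊
  have hm : ∀ y ∈ S, Monotone (m y) := by
    intro y hy
    refine monotone_nat_of_le_succ fun j => ?_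
    cases j with
    | zero => exact Nat.zero_le _
    | succ j =>
      refine Nat.floor_le_floor (mul_le_mul_of_nonneg_left ?_ hK'.le)
      exact hΘmono _ (hv y hy _) _ (hv y hy _) (hvmono y (Nat.le_succ j))
  have hmN : ∀ y ∈ S, ∀ j, m y j ≤ K * N := by
    intro y hy j
    cases j with
    | zero => exact Nat.zero_le _
    | succ j =>
      refine Nat.floor_le_of_le ?_
      push_cast
      exact mul_le_mul_of_nonneg_left (hΘ1 _ (hv y hy j)).2 hK'.le
  -- the increments of the timing add up to at most `K * N`, so the weight `z ^ i` for an increment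
  -- `i` gives every code a total weight of at least `z ^ (K * N)`
  let code : X → Fin (N / l + 1) → Fin (K * N + 1) := fun y j =>
    Fin.ofNat _ (m y (j + 1) - m y j)
  have hcode : ∀ y ∈ S, ∀ j, (code y j : ℕ) = m y (j + 1) - m y j := by
    intro y hy j
    exact Nat.mod_eq_of_lt (Nat.lt_succ_of_le ((Nat.sub_le _ _).trans (hmN y hy (j + 1))))
  have hinj : InjOn code S := by
    intro y hy y' hy' hyy
    by_contra hne
    have hmeq : ∀ j ≤ N / l + 1, m y j = m y' j := by
      intro j
      induction j with
      | zero => intro _; rfl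
      | succ j ih =>
        intro hj
        have h1 := congrArg Fin.val (congrFun hyy ⟨j, hj⟩)
        rw [hcode y hy, hcode y' hy'] at h1
        have h2 := ih (by omega)
        have h3 := hm y hy (Nat.le_succ j)
        have h4 := hm y' hy' (Nat.le_succ j)
        simp only [Nat.succ_eq_add_one] at *
        omega
    obtain ⟨i, hi, hd⟩ := hS y hy y' hy' hne
    set j := i / l with hj
    have hji : j * l ≤ i := Nat.div_mul_le_self i l
    have hmin : min (j * l) N = j * l := min_eq_left (hji.trans hi.le)
    have hr : ((i : ℝ) - (j * l : ℕ)) ∈ Icc (0 : ℝ) l := by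
      have h1 : i < j * l + l := by
        have := Nat.lt_div_mul_add (a := i) hl
        omega
      have h2 : (i : ℝ) < (j * l : ℕ) + l := by exact_mod_cast h1
      have h3 : ((j * l : ℕ) : ℝ) ≤ i := by exact_mod_cast hji
      exact ⟨by linarith, by linarith⟩
    set r : ℝ := (i : ℝ) - (j * l : ℕ) with hrdef
    have hnear : ∀ w ∈ S, dist (ψ i w) (ψ (r + Θ (v w j)) x) < ε / 3 := by
      intro w hw
      have e1 : ψ i w = ψ r (φ (v w j) w) := by
        have : (i : ℝ) = r + (j * l : ℕ) := by rw [hrdef]; ring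
        rw [this, Flow.map_add, hh.flow_eq ((j * l : ℕ) : ℝ)]
        simp only [v, hmin]
      have e2 : ψ (r + Θ (v w j)) x = ψ r (φ (v w j) x) := by
        rw [Flow.map_add, hh.flow_eq (Θ (v w j)), hΘ2 _ (hv w hw j)]
      rw [e1, e2]
      exact hδ r hr _ _ (hclose w hw _ (hv w hw j))
    have htime : |(r + Θ (v y j)) - (r + Θ (v y' j))| < 1 / (K : ℝ) := by
      have hfl : ⌊K * Θ (v y j)⌋₊ = ⌊K * Θ (v y' j)⌋₊ :=
        hmeq (j + 1) (Nat.succ_le_succ (Nat.div_le_div_right hi.le))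
      have p1 : 0 ≤ K * Θ (v y j) := mul_nonneg hK'.le (hΘ1 _ (hv y hy j)).1
      have p2 : 0 ≤ K * Θ (v y' j) := mul_nonneg hK'.le (hΘ1 _ (hv y' hy' j)).1
      have a1 := Nat.floor_le p1
      have a2 := Nat.lt_floor_add_one (K * Θ (v y j))
      have b1 := Nat.floor_le p2
      have b2 := Nat.lt_floor_add_one (K * Θ (v y' j))
      rw [hfl] at a1 a2
      have hmul : ∀ a : ℝ, |a| * K = |a * K| := fun a => by rw [abs_mul, abs_of_pos hK']
      rw [lt_div_iff₀ hK', hmul, abs_lt]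
      constructor <;> nlinarith
    have t1 := hnear y hy
    have t2 := hnear y' hy'
    have t3 := hψK _ _ x htime
    rw [hiter, hiter] at hd
    have t4 := dist_triangle4_right (ψ i y) (ψ i y') (ψ (r + Θ (v y j)) x) (ψ (r + Θ (v y' j)) x)
    linarith
  have hsum : ∑ i : Fin (K * N + 1), z ^ (i : ℕ) ≤ 1 / (1 - z) := by
    rw [Fin.sum_univ_eq_sum_range (fun i => z ^ i), one_div, ← tsum_geometric_of_lt_one hz.le hz1]
    exact (summable_geometric_of_lt_one hz.le hz1).sum_le_tsum _ fun i _ => by positivity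
  have := card_mul_le_sum_weight_pow (S.image code) (fun i => z ^ (i : ℕ))
    (fun i => by positivity) (c := z ^ (K * N)) (by
      intro w hw
      obtain ⟨y, hy, rfl⟩ := Finset.mem_image.1 hw
      rw [Finset.prod_pow_eq_pow_sum]
      refine pow_le_pow_of_le_one hz.le hz1.le ?_
      simp only [hcode y hy]
      rw [Fin.sum_univ_eq_sum_range (fun j => m y (j + 1) - m y j), Finset.sum_range_tsub (hm y hy)]
      exact (Nat.sub_le _ _).trans (hmN y hy (N / l + 1)))
  rw [Finset.card_image_of_injOn hinj] at this
  exact this.trans (pow_le_pow_left₀ (Finset.sum_nonneg fun i _ => by positivity) hsum _)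

/-- Up to a factor of arbitrarily small exponential rate in `N`, the orbits of length `N` of a time
change `ψ` of `φ` are counted by the `φ`-orbit segments which they cover. -/
theorem IsTimeChange.exists_isFlowSeparated_subset [CompactSpace X] {φ ψ : Flow ℝ X}
    {h : ℝ → X → ℝ} {C : ℝ} (hh : IsTimeChange φ ψ h C) {ε κ : ℝ} (hε : 0 < ε) (hκ : 0 < κ) :
    ∃ δ > 0, ∃ B > 0, ∀ (N : ℕ) (L : ℝ) (E : Finset X), IsBowenSeparated (ψ 1) N ε E →
      (∀ y ∈ E, h N y ≤ L) →
      ∃ G ⊆ E, IsFlowSeparated φ L δ G ∧ (E.card : ℝ) ≤ G.card * (B * Real.exp (κ * N)) := by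
  classical
  obtain ⟨η, hη, hψη⟩ := ψ.exists_dist_time_lt (show 0 < ε / 3 by positivity)
  obtain ⟨K', hK'⟩ := exists_nat_one_div_lt hη
  set K := K' + 1 with hK
  have hKpos : (0 : ℝ) < K := by positivity
  have hψK : ∀ s t p, |s - t| < 1 / (K : ℝ) → dist (ψ s p) (ψ t p) < ε / 3 := fun s t p hst =>
    hψη s t p (hst.trans (by rw [hK]; exact_mod_cast hK'))
  -- `z` makes the total weight `z ^ (K * N)` of a code equal to `exp (-κ N / 2)`, and `l` makes the
  -- blocks so long that the bound `(1 / (1 - z)) ^ (N / l + 1)` grows at most like `exp (κ N / 2)`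
  set z : ℝ := Real.exp (-(κ / (2 * K))) with hz
  have hz0 : 0 < z := Real.exp_pos _
  have hz1 : z < 1 := by
    rw [hz, Real.exp_lt_one_iff]
    have : 0 < κ / (2 * K) := by positivity
    linarith
  set b : ℝ := Real.log (1 / (1 - z)) with hb
  have hz2 : 0 < 1 / (1 - z) := by
    have : 0 < 1 - z := by linarith
    positivity
  have hb0 : 0 ≤ b := by
    refine Real.log_nonneg ?_
    rw [le_div_iff₀ (by linarith)]
    linarith
  obtain ⟨l', hl'⟩ := exists_nat_ge (2 * b / κ)
  set l := l' + 1 with hl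
  have hlb : b ≤ l * (κ / 2) := by
    rw [div_le_iff₀ hκ] at hl'
    rw [hl]
    push_cast
    nlinarith
  obtain ⟨δ, hδ, hψδ⟩ := ψ.exists_dist_lt l (show 0 < ε / 3 by positivity)
  refine ⟨δ / 2, by positivity, Real.exp b, Real.exp_pos _, fun N L E hE hL => ?_⟩
  obtain ⟨G, hG, hsep, hcov⟩ := Finset.exists_separated_subset E
    (fun x y => ∀ u ∈ Icc 0 L, dist (φ u x) (φ u y) < δ / 2)
    (fun x u _ => by simpa using hδ) (fun x y hxy u hu => by rw [dist_comm]; exact hxy u hu)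
  refine ⟨G, hG, ?_, ?_⟩
  · intro x hx y hy hxy
    have := hsep x hx y hy hxy
    push Not at this
    exact this
  let S : X → Finset X := fun g => E.filter fun y => ∀ u ∈ Icc 0 L, dist (φ u y) (φ u g) < δ / 2
  have hcard : ∀ g, ((S g).card : ℝ) ≤ Real.exp b * Real.exp (κ * N) := by
    intro g
    rcases (S g).eq_empty_or_nonempty with h0 | hne
    · rw [h0, Finset.card_empty, Nat.cast_zero]
      positivity
    obtain ⟨x, hx, hmax⟩ := Finset.exists_max_image (S g) (fun y => h N y) hne
    have hxE := Finset.mem_filter.1 hx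
    have key := card_le_of_flow_close hh (Nat.succ_pos K') (Nat.succ_pos l') hψK hψδ
      (S := S g) (fun y hy y' hy' => hE y (Finset.mem_filter.1 hy).1 y' (Finset.mem_filter.1 hy').1)
      hmax (by
        intro y hy u hu
        have hu' : u ∈ Icc 0 L := ⟨hu.1, hu.2.trans (hL x hxE.1)⟩
        have h1 := (Finset.mem_filter.1 hy).2 u hu'
        have h2 := hxE.2 u hu'
        linarith [dist_triangle_right (φ u y) (φ u x) (φ u g)]) hz0 hz1
    have e1 : z ^ (K * N) = Real.exp (-(κ * N / 2)) := by
      rw [hz, ← Real.exp_nat_mul]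
      congr 1
      push_cast
      field_simp
    have e2 : (1 / (1 - z)) ^ (N / l + 1) ≤ Real.exp b * Real.exp (κ * N / 2) := by
      rw [← Real.exp_log hz2, ← hb, ← Real.exp_nat_mul, ← Real.exp_add]
      refine Real.exp_le_exp.2 ?_
      have h1 : ((N / l : ℕ) : ℝ) * l ≤ N := by exact_mod_cast Nat.div_mul_le_self N l
      have h2 : ((N / l : ℕ) : ℝ) * b ≤ ((N / l : ℕ) : ℝ) * (l * (κ / 2)) :=
        mul_le_mul_of_nonneg_left hlb (Nat.cast_nonneg _)
      push_cast
      nlinarith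
    change ((S g).card : ℝ) * z ^ (K * N) ≤ (1 / (1 - z)) ^ (N / l + 1) at key
    rw [e1] at key
    have h3 := key.trans e2
    rw [Real.exp_neg, ← div_eq_mul_inv, div_le_iff₀ (Real.exp_pos _), mul_assoc,
      ← Real.exp_add] at h3
    rwa [show κ * N / 2 + κ * N / 2 = κ * N by ring] at h3
  have hsub : E ⊆ G.biUnion S := by
    intro y hy
    obtain ⟨g, hg, hyg⟩ := hcov y hy
    exact Finset.mem_biUnion.2 ⟨g, hg, Finset.mem_filter.2 ⟨hy, hyg⟩⟩
  calc (E.card : ℝ) ≤ ∑ g ∈ G, ((S g).card : ℝ) := by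
        exact_mod_cast (Finset.card_le_card hsub).trans Finset.card_biUnion_le
    _ ≤ G.card * (Real.exp b * Real.exp (κ * N)) := by
        rw [← nsmul_eq_mul]
        exact Finset.sum_le_card_nsmul _ _ _ fun g _ => hcard g

end TimeChange

/-! ### Topological entropy of maps of a compact metric space -/

section TopologicalEntropy

variable {X : Type*} [MetricSpace X] [CompactSpace X]

theorem topEntropy_eq_coverEntropy (T : X → X) : topEntropy T = Dynamics.coverEntropy T univ := by
  rw [topEntropy]
  congr 1
  exact unique_uniformity_of_compact rfl rfl

theorem exists_isBowenSeparated_of_topEntropy_pos {T : X → X} (hT : 0 < topEntropy T) :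
    ∃ ε > 0, ∃ s > 0, ∃ᶠ N : ℕ in atTop, ∃ E : Finset X,
      IsBowenSeparated T N ε E ∧ Real.exp (s * N) ≤ E.card := by
  rw [topEntropy_eq_coverEntropy,
    Dynamics.coverEntropy_eq_iSup_basis_netEntropyEntourage Metric.uniformity_basis_dist] at hT
  simp only [lt_iSup_iff] at hT
  obtain ⟨ε, hε, h⟩ := hT
  obtain ⟨s, hs0, hs⟩ := EReal.lt_iff_exists_real_btwn.1 h
  have hs0' : 0 < s := by exact_mod_cast hs0
  refine ⟨ε, hε, s / 2, half_pos hs0', ?_⟩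
  refine ((ExpGrowth.frequently_exp_le hs).and_eventually (eventually_gt_atTop 0)).mono ?_
  rintro N ⟨hN, hN0⟩
  by_contra! hc
  have hN' : (0 : ℝ) < N := by exact_mod_cast hN0
  have h1 : Dynamics.netMaxcard T univ {p : X × X | dist p.1 p.2 < ε} N ≤
      (⌊Real.exp (s / 2 * N)⌋₊ : ℕ) := by
    refine iSup₂_le fun E hE => ?_
    have hsep : IsBowenSeparated T N ε E := by
      intro x hx y hy hxy
      by_contra! hcl
      have hd := hE.2 hx hy hxy
      refine hd.le_bot (show y ∈ _ ∩ _ from ⟨?_, ?_⟩)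
      · exact Dynamics.mem_dynEntourage.2 fun i hi => hcl i hi
      · exact Dynamics.mem_dynEntourage.2 fun i hi => by simpa using hε
    exact_mod_cast Nat.le_floor (hc E hsep).le
  have h2 : EReal.exp (s * N) ≤ ENNReal.ofReal (Real.exp (s / 2 * N)) := by
    refine hN.trans ((ENat.toENNReal_mono h1).trans ?_)
    rw [ENat.toENNReal_coe, ← ENNReal.ofReal_natCast]
    exact ENNReal.ofReal_le_ofReal (Nat.floor_le (Real.exp_pos _).le)
  have h3 : (s : EReal) * (N : EReal) = ((s * N : ℝ) : EReal) := by push_cast; rfl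
  rw [h3, EReal.exp_coe, ENNReal.ofReal_le_ofReal_iff (Real.exp_pos _).le, Real.exp_le_exp] at h2
  nlinarith

theorem eventually_bowen_cover_of_topEntropy_eq_zero {T : X → X} (hT : topEntropy T = 0) {ε κ : ℝ}
    (hε : 0 < ε) (hκ : 0 < κ) :
    ∀ᶠ N : ℕ in atTop, ∃ F : Finset X, (F.card : ℝ) ≤ Real.exp (κ * N) ∧
      ∀ x, ∃ y ∈ F, ∀ i < N, dist (T^[i] x) (T^[i] y) < ε := by
  rw [topEntropy_eq_coverEntropy] at hT
  have h1 := (Dynamics.coverEntropyEntourage_le_coverEntropy T univ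
    (Metric.dist_mem_uniformity hε)).trans_eq hT
  have h2 : Dynamics.coverEntropyEntourage T univ {p : X × X | dist p.1 p.2 < ε} < (κ : EReal) :=
    h1.trans_lt (by exact_mod_cast hκ)
  filter_upwards [ExpGrowth.eventually_le_exp h2] with N hN
  have h3 : (κ : EReal) * (N : EReal) = ((κ * N : ℝ) : EReal) := by push_cast; rfl
  rw [h3, EReal.exp_coe] at hN
  have hfin : Dynamics.coverMincard T univ {p : X × X | dist p.1 p.2 < ε} N < ⊤ := by
    rw [← ENat.toENNReal_lt_top]
    exact hN.trans_lt ENNReal.ofReal_lt_top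
  obtain ⟨F, hF, hcard⟩ := (Dynamics.coverMincard_finite_iff _ _ _ _).1 hfin
  refine ⟨F, ?_, fun x => ?_⟩
  · rw [← hcard, ENat.toENNReal_coe, ← ENNReal.ofReal_natCast,
      ENNReal.ofReal_le_ofReal_iff (Real.exp_pos _).le] at hN
    exact hN
  · obtain ⟨y, hy, hxy⟩ := hF (mem_univ x)
    exact ⟨y, hy, fun i hi => Dynamics.mem_dynEntourage.1 hxy i hi⟩

theorem eventually_mul_add_le_exp (a b : ℝ) {c : ℝ} (hc : 0 < c) :
    ∀ᶠ N : ℕ in atTop, a * N + b ≤ Real.exp (c * N) := by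
  filter_upwards [eventually_ge_atTop ⌈2 * (|a| + |b|) / c ^ 2⌉₊, eventually_ge_atTop 1]
    with N hN hN1
  have h1 : 2 * (|a| + |b|) / c ^ 2 ≤ N := (Nat.le_ceil _).trans (by exact_mod_cast hN)
  rw [div_le_iff₀ (by positivity)] at h1
  have h2 : (1 : ℝ) ≤ N := by exact_mod_cast hN1
  have h3 := Real.quadratic_le_exp_of_nonneg (x := c * N) (by positivity)
  have h4 := mul_le_mul_of_nonneg_right h1 (show (0 : ℝ) ≤ N by linarith)
  have h5 : 0 ≤ c * N := by positivity
  nlinarith [le_abs_self a, le_abs_self b, abs_nonneg a, abs_nonneg b]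

/-- Exponentially many separated orbits of a time change `ψ` of `φ` produce exponentially many
separated orbit segments of `φ`, each of which is covered by `ψ` in a time proportional to its
length. -/
theorem IsTimeChange.exists_many_isFlowSeparated {φ ψ : Flow ℝ X}
    {h : ℝ → X → ℝ} {C : ℝ} (hh : IsTimeChange φ ψ h C) {ε s : ℝ} (hε : 0 < ε) (hs : 0 < s)
    (hE : ∃ᶠ N : ℕ in atTop, ∃ E : Finset X, IsBowenSeparated (ψ 1) N ε E ∧
      Real.exp (s * N) ≤ E.card) :
    ∃ δ > 0, ∃ c > 0, ∃ D : ℝ, ∀ n₀ : ℕ, ∃ n ≥ n₀, ∃ N : ℕ, N ≤ D * n ∧ ∃ G : Finset X,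
      IsFlowSeparated φ (n + 1 : ℕ) δ G ∧ Real.exp (c * n) ≤ G.card ∧ ∀ y ∈ G, n ≤ h N y := by
  classical
  obtain ⟨δ, hδ, B, hB, hG⟩ := hh.exists_isFlowSeparated_subset hε (half_pos hs)
  obtain ⟨A, hA⟩ := exists_card_le_pow_of_isFlowSeparated φ hδ
  set C' := max C 1 with hC'
  have hC0 : 0 < C' := by positivity
  set a := Real.log (A + 2) with ha
  have ha0 : 0 < a := Real.log_pos (by linarith [(Nat.cast_nonneg A : (0 : ℝ) ≤ A)])
  refine ⟨δ, hδ, s / (4 * C'), by positivity, 8 * a / s, fun n₀ => ?_⟩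
  obtain ⟨N, ⟨E, hE, hcard⟩, hN1, hN2⟩ := (hE.and_eventually
    ((eventually_mul_add_le_exp (B * C') B (show 0 < s / 4 by positivity)).and
    (eventually_ge_atTop ⌈4 * a * (n₀ + 4) / s⌉₊))).exists
  have hN2' : 4 * a * (n₀ + 4) ≤ N * s := by
    rw [← div_le_iff₀ hs]
    exact (Nat.le_ceil _).trans (by exact_mod_cast hN2)
  have hN0 : (0 : ℝ) ≤ N := Nat.cast_nonneg _
  have hh0 : ∀ y, 0 ≤ h N y := fun y => by
    rw [← hh.zero y]
    exact hh.monotone y hN0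
  have hhC : ∀ y, h N y ≤ C' * N := fun y =>
    (hh.le_mul N y hN0).trans (mul_le_mul_of_nonneg_right (le_max_left _ _) hN0)
  set R := ⌊C' * N⌋₊ + 1 with hR
  have hmaps : ∀ y ∈ E, ⌊h N y⌋₊ ∈ Finset.range R := fun y _ =>
    Finset.mem_range.2 (Nat.lt_succ_of_le (Nat.floor_le_floor (hhC y)))
  -- the most frequent integer part of the covered distance; there are only linearly many values
  obtain ⟨n, -, hmax⟩ := Finset.exists_max_image (Finset.range R)
    (fun n => (E.filter fun y => ⌊h N y⌋₊ = n).card) ⟨0, Finset.mem_range.2 (Nat.succ_pos _)⟩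
  set E' := E.filter fun y => ⌊h N y⌋₊ = n with hE'
  have hEE' : (E.card : ℝ) ≤ (C' * N + 1) * E'.card := by
    have h1 : E.card ≤ R * E'.card := by
      rw [Finset.card_eq_sum_card_fiberwise hmaps]
      exact (Finset.sum_le_card_nsmul _ _ _ hmax).trans (by simp)
    have h2 : (R : ℝ) ≤ C' * N + 1 := by
      rw [hR]
      push_cast
      linarith [Nat.floor_le (show 0 ≤ C' * N by positivity)]
    calc (E.card : ℝ) ≤ R * E'.card := by exact_mod_cast h1
      _ ≤ _ := by gcongr
  obtain ⟨G, hGE, hGsep, hGcard⟩ := hG N ((n + 1 : ℕ) : ℝ) E'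
    (fun x hx y hy => hE x (Finset.mem_filter.1 hx).1 y (Finset.mem_filter.1 hy).1) (by
      intro y hy
      have h1 := Nat.lt_floor_add_one (h N y)
      rw [(Finset.mem_filter.1 hy).2] at h1
      push_cast
      exact h1.le)
  have hGn : ∀ y ∈ G, (n : ℝ) ≤ h N y := by
    intro y hy
    rw [← (Finset.mem_filter.1 (hGE hy)).2]
    exact Nat.floor_le (hh0 y)
  have hGbig : Real.exp (s / 4 * N) ≤ G.card := by
    have h1 : Real.exp (s * N) ≤
        Real.exp (s / 4 * N) * (G.card * Real.exp (s / 2 * N)) := by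
      calc Real.exp (s * N) ≤ (C' * N + 1) * (G.card * (B * Real.exp (s / 2 * N))) :=
            hcard.trans (hEE'.trans (by gcongr))
        _ = (B * C' * N + B) * (G.card * Real.exp (s / 2 * N)) := by ring
        _ ≤ _ := by gcongr
    have h2 : Real.exp (s * N) =
        Real.exp (s / 4 * N) * (Real.exp (s / 4 * N) * Real.exp (s / 2 * N)) := by
      rw [← Real.exp_add, ← Real.exp_add]
      congr 1
      ring
    rw [h2] at h1
    exact le_of_mul_le_mul_right (le_of_mul_le_mul_left h1 (Real.exp_pos _)) (Real.exp_pos _)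
  have hGne : G.Nonempty := by
    rw [← Finset.card_pos]
    exact_mod_cast (Real.exp_pos _).trans_le hGbig
  obtain ⟨y, hy⟩ := hGne
  have hnN : (n : ℝ) ≤ C' * N := (hGn y hy).trans (hhC y)
  -- so many orbits can only be separated if their length `n` is at least proportional to `N`
  have hupper : s / 4 * N ≤ (n + 2) * a := by
    have h1 : (G.card : ℝ) ≤ (A + 2 : ℝ) ^ (n + 2) := by
      calc (G.card : ℝ) ≤ (A : ℝ) ^ (n + 1 + 1) := by exact_mod_cast hA _ G hGsep
        _ ≤ _ := by gcongr; linarith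
    have h2 : (A + 2 : ℝ) ^ (n + 2) = Real.exp ((n + 2) * a) := by
      have : Real.exp a = A + 2 := Real.exp_log (by positivity)
      rw [← this, ← Real.exp_nat_mul]
      push_cast
      rfl
    rw [← Real.exp_le_exp, ← h2]
    exact hGbig.trans h1
  have hn : (n₀ : ℝ) + 2 ≤ n := by
    have : a * (n₀ + 4) ≤ a * (n + 2) := by nlinarith
    linarith [le_of_mul_le_mul_left this ha0]
  refine ⟨n, by exact_mod_cast (show (n₀ : ℝ) ≤ n by linarith), N, ?_, G, hGsep, ?_, hGn⟩
  · rw [div_mul_eq_mul_div, le_div_iff₀ hs]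
    have : (0 : ℝ) ≤ n₀ := Nat.cast_nonneg _
    nlinarith
  · refine le_trans (Real.exp_le_exp.2 ?_) hGbig
    rw [div_mul_eq_mul_div, div_le_iff₀ (by positivity)]
    nlinarith

end TopologicalEntropy

/-! ### The singular suspension as a time change of the suspension flow -/

section SingularSuspension

variable {d : ℕ} {M : Type*} [TopologicalSpace M] [ChartedSpace (EuclideanSpace ℝ (Fin d)) M]

theorem suspFlow_suspMk (f : M ≃ₘ^1⟮𝓡 d, 𝓡 d⟯ M) (t : ℝ) (z : M × ℝ) :
    suspFlow f t (suspMk f z) = suspMk f (z.1, z.2 + t) := rfl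

/-- In the preferred chart at `p = [x, s]` the suspension has the coordinates of `M × ℝ`. -/
theorem extChartAt_suspMk (f : M ≃ₘ^1⟮𝓡 d, 𝓡 d⟯ M) (p : SuspSpace f) {w : M × ℝ}
    (hw : w ∈ (suspLocal f (suspLift f p)).source) :
    extChartAt ((𝓡 d).prod 𝓘(ℝ, ℝ)) p (suspMk f w) =
      (extChartAt (𝓡 d) (suspLift f p).1 w.1, w.2) := by
  have h1 : (suspLocal f (suspLift f p)).symm (suspMk f w) = w :=
    (suspLocal f (suspLift f p)).left_inv hw
  have h2 : chartAt (ModelProd (EuclideanSpace ℝ (Fin d)) ℝ) p =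
    (suspLocal f (suspLift f p)).symm ≫ₕ
      chartAt (ModelProd (EuclideanSpace ℝ (Fin d)) ℝ) (suspLift f p) := rfl
  simp only [extChartAt, h2, OpenPartialHomeomorph.extend_coe, comp_apply,
    OpenPartialHomeomorph.coe_trans, h1, prodChartedSpace_chartAt]
  rfl

/-- In the preferred chart the velocity of the suspension flow is the vertical unit vector. -/
theorem velocityField_suspFlow (f : M ≃ₘ^1⟮𝓡 d, 𝓡 d⟯ M) (p : SuspSpace f) :
    velocityField f (suspFlow f) p = ((0, 1) : EuclideanSpace ℝ (Fin d) × ℝ) := by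
  set z := suspLift f p with hz
  have hp : suspMk f z = p := suspMk_suspLift f p
  have h0 : suspFlow f 0 p = p := (suspFlow f).map_zero_apply p
  have hd : HasFDerivAt (fun t : ℝ =>
      ((extChartAt (𝓡 d) z.1 z.1, z.2 + t) : EuclideanSpace ℝ (Fin d) × ℝ))
      ((1 : ℝ →L[ℝ] ℝ).smulRight ((0, 1) : EuclideanSpace ℝ (Fin d) × ℝ)) 0 := by
    have h1 : HasDerivAt (fun t : ℝ =>
        ((extChartAt (𝓡 d) z.1 z.1, z.2 + t) : EuclideanSpace ℝ (Fin d) × ℝ)) (0, 1) 0 :=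
      (hasDerivAt_const _ _).prodMk ((hasDerivAt_id _).const_add _)
    exact h1.hasFDerivAt
  have hm : HasMFDerivAt 𝓘(ℝ, ℝ) ((𝓡 d).prod 𝓘(ℝ, ℝ)) (fun t : ℝ => suspFlow f t p) 0
      ((1 : ℝ →L[ℝ] ℝ).smulRight ((0, 1) : EuclideanSpace ℝ (Fin d) × ℝ)) := by
    refine ⟨((suspFlow f).continuous continuous_id continuous_const).continuousAt, ?_⟩
    have hev : writtenInExtChartAt 𝓘(ℝ, ℝ) ((𝓡 d).prod 𝓘(ℝ, ℝ)) 0 (fun t : ℝ => suspFlow f t p)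
        =ᶠ[𝓝 0] fun t : ℝ =>
          ((extChartAt (𝓡 d) z.1 z.1, z.2 + t) : EuclideanSpace ℝ (Fin d) × ℝ) := by
      filter_upwards [Metric.ball_mem_nhds (0 : ℝ) (show (0 : ℝ) < 1 / 2 by norm_num)] with t ht
      have hs : ((z.1, z.2 + t) : M × ℝ) ∈ (suspLocal f z).source := by
        refine ⟨mem_univ _, ?_⟩
        simpa [Metric.mem_ball, Real.dist_eq] using ht
      have h3 := extChartAt_suspMk f p hs
      rw [← suspFlow_suspMk, hp] at h3
      simp only [writtenInExtChartAt, comp_apply, extChartAt_model_space_eq_id,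
        PartialEquiv.refl_symm,
        PartialEquiv.refl_coe, id_eq, h0]
      exact h3
    have := hd.congr_of_eventuallyEq hev
    exact this.hasFDerivWithinAt
  rw [velocityField, hm.mfderiv]
  exact one_smul ℝ ((0, 1) : EuclideanSpace ℝ (Fin d) × ℝ)

/-- A curve in a manifold whose velocity vanishes near `t₀` is constant near `t₀`. -/
theorem eventually_eq_of_eventually_hasMFDerivAt_zero [IsManifold (𝓡 d) 1 M] {c : ℝ → M} {t₀ : ℝ}
    (h : ∀ᶠ t in 𝓝 t₀, HasMFDerivAt 𝓘(ℝ, ℝ) (𝓡 d) c t 0) : ∀ᶠ t in 𝓝 t₀, c t = c t₀ := by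
  have hc : ContinuousAt c t₀ := h.self_of_nhds.1
  have h1 : ∀ᶠ t in 𝓝 t₀, HasMFDerivAt 𝓘(ℝ, ℝ) (𝓡 d) c t 0 ∧
      c t ∈ (chartAt (EuclideanSpace ℝ (Fin d)) (c t₀)).source :=
    h.and (hc ((chartAt _ (c t₀)).open_source.mem_nhds (mem_chart_source _ _)))
  obtain ⟨ε, hε, hball⟩ := Metric.eventually_nhds_iff_ball.1 h1
  have hder : ∀ t ∈ Metric.ball t₀ ε, HasFDerivAt (extChartAt (𝓡 d) (c t₀) ∘ c)
      (0 : ℝ →L[ℝ] EuclideanSpace ℝ (Fin d)) t := by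
    intro t ht
    obtain ⟨h2, h3⟩ := hball t ht
    have h4 := (mdifferentiableAt_extChartAt (I := 𝓡 d) h3).hasMFDerivAt.comp t h2
    rw [ContinuousLinearMap.comp_zero] at h4
    exact h4.hasFDerivAt
  filter_upwards [Metric.ball_mem_nhds t₀ hε] with t ht
  have h5 : (extChartAt (𝓡 d) (c t₀) ∘ c) t = (extChartAt (𝓡 d) (c t₀) ∘ c) t₀ :=
    Metric.isOpen_ball.is_const_of_fderiv_eq_zero (convex_ball t₀ ε).isPreconnected
      (fun s hs => (hder s hs).differentiableAt.differentiableWithinAt)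
      (fun s hs => (hder s hs).fderiv) ht (Metric.mem_ball_self hε)
  exact (extChartAt (𝓡 d) (c t₀)).injOn (by simpa using (hball t ht).2)
    (by simp) h5

variable {f : M ≃ₘ^1⟮𝓡 d, 𝓡 d⟯ M} {α : SuspSpace f → ℝ} {ψ : Flow ℝ (SuspSpace f)}

/-- A curve with velocity `α X` lifts locally to `M × ℝ`; the first component of the lift is locally
constant and the second one has derivative `α`. -/
theorem IsSingularSuspension.eventually_eq_suspMk [IsManifold (𝓡 d) 1 M]
    (hψ : IsSingularSuspension f α ψ) (p : SuspSpace f) {t₀ : ℝ} {w : M × ℝ}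
    (hw : ψ t₀ p = suspMk f w) :
    ∃ U : ℝ → ℝ, U t₀ = w.2 ∧ ∀ᶠ t in 𝓝 t₀, ψ t p = suspMk f (w.1, U t) ∧
      HasDerivAt U (α (ψ t p)) t := by
  have hcont : Continuous fun t => ψ t p := ψ.continuous continuous_id continuous_const
  set e := suspLocal f w with he
  have hws : w ∈ e.source := mem_suspLocal_source f w
  have hwt : ψ t₀ p ∈ e.target := by
    rw [hw]
    exact e.map_source hws
  set ζ : ℝ → M × ℝ := fun t => e.symm (ψ t p) with hζ
  have hζ0 : ζ t₀ = w := by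
    simp only [hζ, hw]
    exact e.left_inv hws
  have htarget : ∀ᶠ t in 𝓝 t₀, ψ t p ∈ e.target :=
    hcont.continuousAt (e.open_target.mem_nhds hwt)
  have hζmk : ∀ t, ψ t p ∈ e.target → suspMk f (ζ t) = ψ t p := fun t ht => e.right_inv ht
  have key : ∀ t₁, ψ t₁ p ∈ e.target →
      HasMFDerivAt 𝓘(ℝ, ℝ) (𝓡 d) (fun t => (ζ t).1) t₁ 0 ∧
      HasDerivAt (fun t => (ζ t).2) (α (ψ t₁ p)) t₁ := by
    intro t₁ ht₁
    have hζc : ContinuousAt ζ t₁ :=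
      ContinuousAt.comp (f := fun t => ψ t p) (e.continuousAt_symm ht₁) hcont.continuousAt
    set q := ψ t₁ p with hq
    set z := suspLift f q with hz
    have hzq : suspMk f z = q := suspMk_suspLift f q
    have hqt : suspMk f (ζ t₁) ∈ (suspLocal f z).target := by
      rw [hζmk _ ht₁, ← hq, ← hzq]
      exact (suspLocal f z).map_source (mem_suspLocal_source f z)
    obtain ⟨n, hn⟩ := suspLocal_symm_eventuallyEq f z (ζ t₁) hqt
    have hdeck : deck f n (ζ t₁) = z := by
      rw [← hn.self_of_nhds, hζmk _ ht₁, ← hq, ← hzq]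
      exact (suspLocal f z).left_inv (mem_suspLocal_source f z)
    have hsrc : ∀ᶠ t in 𝓝 t₁, deck f n (ζ t) ∈ (suspLocal f z).source := by
      refine ((continuous_deck f n).continuousAt.comp hζc) ((suspLocal f z).open_source.mem_nhds ?_)
      rw [comp_apply, hdeck]
      exact mem_suspLocal_source f z
    have hcoord : ∀ᶠ t in 𝓝 t₁, extChartAt ((𝓡 d).prod 𝓘(ℝ, ℝ)) q (ψ t p) =
        (extChartAt (𝓡 d) z.1 (iter f n (ζ t).1), (ζ t).2 - n) := by
      filter_upwards [hsrc, hcont.continuousAt (e.open_target.mem_nhds ht₁)] with t ht ht'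
      have h1 : suspMk f (deck f n (ζ t)) = ψ t p := by
        rw [← hζmk t ht']
        exact ((suspMk_eq_iff f).2 ⟨n, rfl⟩).symm
      have h2 := extChartAt_suspMk f q ht
      rw [h1] at h2
      exact h2
    have hI := (hψ.isMIntegralCurve p t₁).2
    simp only [writtenInExtChartAt, comp_def, extChartAt_model_space_eq_id, PartialEquiv.refl_symm,
        PartialEquiv.refl_coe, id_eq, velocityField_suspFlow, modelWithCornersSelf_coe,
        range_id] at hI
    have hI' : HasFDerivAt (fun t => (extChartAt ((𝓡 d).prod 𝓘(ℝ, ℝ)) q (ψ t p) :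
        EuclideanSpace ℝ (Fin d) × ℝ)) ((1 : ℝ →L[ℝ] ℝ).smulRight
          (α q • ((0, 1) : EuclideanSpace ℝ (Fin d) × ℝ))) t₁ := hasFDerivWithinAt_univ.1 hI
    have hder : HasDerivAt (fun t => ((extChartAt (𝓡 d) z.1 (iter f n (ζ t).1), (ζ t).2 - n) :
        EuclideanSpace ℝ (Fin d) × ℝ)) (α q • ((0, 1) : EuclideanSpace ℝ (Fin d) × ℝ)) t₁ := by
      have h3 := HasFDerivAt.hasDerivAt hI'
      have h4 : ((1 : ℝ →L[ℝ] ℝ).smulRight (α q • ((0, 1) : EuclideanSpace ℝ (Fin d) × ℝ))) 1 =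
          α q • ((0, 1) : EuclideanSpace ℝ (Fin d) × ℝ) := by simp
      rw [← h4]
      exact h3.congr_of_eventuallyEq (hcoord.mono fun t ht => ht.symm)
    have hder1 : HasDerivAt (fun t => extChartAt (𝓡 d) z.1 (iter f n (ζ t).1)) 0 t₁ := by
      refine ((ContinuousLinearMap.fst ℝ (EuclideanSpace ℝ (Fin d)) ℝ).hasFDerivAt.comp_hasDerivAt
        t₁ hder).congr_deriv ?_
      simp
    have hder2 : HasDerivAt (fun t => (ζ t).2 - n) (α q) t₁ := by
      refine ((ContinuousLinearMap.snd ℝ (EuclideanSpace ℝ (Fin d)) ℝ).hasFDerivAt.comp_hasDerivAt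
        t₁ hder).congr_deriv ?_
      simp
    refine ⟨?_, by simpa using hder2.add_const (n : ℝ)⟩
    have hz1 : iter f n (ζ t₁).1 = z.1 := congrArg Prod.fst hdeck
    have hm : HasMFDerivAt 𝓘(ℝ, ℝ) (𝓡 d) (fun t => iter f n (ζ t).1) t₁ 0 := by
      refine ⟨((contMDiff_iter f n).continuous.continuousAt.comp hζc.fst), ?_⟩
      simp only [writtenInExtChartAt, comp_def, extChartAt_model_space_eq_id,
        PartialEquiv.refl_symm, PartialEquiv.refl_coe, id_eq, modelWithCornersSelf_coe, range_id,
        hz1]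
      have h7 : HasFDerivAt (fun t => extChartAt (𝓡 d) z.1 (iter f n (ζ t).1))
          (0 : ℝ →L[ℝ] EuclideanSpace ℝ (Fin d)) t₁ := by simpa using hder1.hasFDerivAt
      exact hasFDerivWithinAt_univ.2 h7
    have h5 := (((contMDiff_iter f (-n)).mdifferentiable one_ne_zero)
      (iter f n (ζ t₁).1)).hasMFDerivAt.comp t₁ hm
    rw [ContinuousLinearMap.comp_zero] at h5
    have h6 : iter f (-n) ∘ (fun t => iter f n (ζ t).1) = fun t => (ζ t).1 := by
      funext t
      rw [comp_apply, ← iter_add, neg_add_cancel, iter_zero]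
    rwa [h6] at h5
  refine ⟨fun t => (ζ t).2, congrArg Prod.snd hζ0, ?_⟩
  have hconst := eventually_eq_of_eventually_hasMFDerivAt_zero (c := fun t => (ζ t).1)
    (htarget.mono fun t ht => (key t ht).1)
  filter_upwards [hconst, htarget] with t ht ht'
  refine ⟨?_, (key t ht').2⟩
  rw [hζ0] at ht
  rw [← ht]
  exact (hζmk t ht').symm

/-- The distance covered along the suspension flow by the `ψ`-orbit of `p` up to time `t`. -/
noncomputable def coveredHeight (α : SuspSpace f → ℝ) (ψ : Flow ℝ (SuspSpace f)) (t : ℝ)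
    (p : SuspSpace f) : ℝ :=
  ∫ r in (0 : ℝ)..t, α (ψ r p)

theorem IsSingularSuspension.continuous_speed (hψ : IsSingularSuspension f α ψ)
    (p : SuspSpace f) : Continuous fun t => α (ψ t p) :=
  hψ.isBrake.contMDiff.continuous.comp (ψ.continuous continuous_id continuous_const)

theorem IsSingularSuspension.hasDerivAt_coveredHeight (hψ : IsSingularSuspension f α ψ)
    (p : SuspSpace f) (t : ℝ) :
    HasDerivAt (fun t => coveredHeight α ψ t p) (α (ψ t p)) t :=
  intervalIntegral.integral_hasDerivAt_right ((hψ.continuous_speed p).intervalIntegrable _ _)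
    ((hψ.continuous_speed p).stronglyMeasurableAtFilter _ _) (hψ.continuous_speed p).continuousAt

theorem coveredHeight_zero (α : SuspSpace f → ℝ) (ψ : Flow ℝ (SuspSpace f)) (p : SuspSpace f) :
    coveredHeight α ψ 0 p = 0 := intervalIntegral.integral_same

/-- The singular suspension moves along the orbits of the suspension flow. The times at which the
identity holds form a closed set, which is open because both sides are lifted by curves with the
same vertical velocity. -/
theorem IsSingularSuspension.flow_eq [IsManifold (𝓡 d) 1 M] [T2Space M]
    (hψ : IsSingularSuspension f α ψ) (t : ℝ) (p : SuspSpace f) :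
    ψ t p = suspFlow f (coveredHeight α ψ t p) p := by
  obtain ⟨w, rfl⟩ := suspMk_surjective f p
  set p := suspMk f w
  have hcont : Continuous fun t => ψ t p := ψ.continuous continuous_id continuous_const
  have hh : Continuous fun t => coveredHeight α ψ t p :=
    continuous_iff_continuousAt.2 fun t => (hψ.hasDerivAt_coveredHeight p t).continuousAt
  have hclosed : IsClosed {t | ψ t p = suspFlow f (coveredHeight α ψ t p) p} :=
    isClosed_eq hcont ((suspFlow f).continuous hh continuous_const)
  have hopen : IsOpen {t | ψ t p = suspFlow f (coveredHeight α ψ t p) p} := by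
    rw [isOpen_iff_mem_nhds]
    intro t₀ ht₀
    obtain ⟨U, hU0, hU⟩ := hψ.eventually_eq_suspMk p
      (w := (w.1, w.2 + coveredHeight α ψ t₀ p)) ht₀
    obtain ⟨ε, hε, hball⟩ := Metric.eventually_nhds_iff_ball.1 hU
    filter_upwards [Metric.ball_mem_nhds t₀ hε] with t ht
    have h1 : EqOn U (fun t => w.2 + coveredHeight α ψ t p) (Metric.ball t₀ ε) := by
      refine Metric.isOpen_ball.eqOn_of_deriv_eq (convex_ball t₀ ε).isPreconnected
        (fun s hs => (hball s hs).2.differentiableAt.differentiableWithinAt)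
        (fun s hs => ((hψ.hasDerivAt_coveredHeight p s).const_add
          w.2).differentiableAt.differentiableWithinAt) (fun s hs => ?_)
        (Metric.mem_ball_self hε) hU0
      rw [(hball s hs).2.deriv, ((hψ.hasDerivAt_coveredHeight p s).const_add w.2).deriv]
    have h2 := (hball t ht).1
    rw [h1 ht] at h2
    exact h2
  have huniv := IsClopen.eq_univ ⟨hclosed, hopen⟩ ⟨0, by
    rw [mem_ofPred_eq, coveredHeight_zero, Flow.map_zero_apply, Flow.map_zero_apply]⟩
  exact eq_univ_iff_forall.1 huniv t

end SingularSuspension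

/-! ### The first-return time -/

section ReturnTime

variable {d : ℕ} {M : Type*} [TopologicalSpace M] [ChartedSpace (EuclideanSpace ℝ (Fin d)) M]
  {f : M ≃ₘ^1⟮𝓡 d, 𝓡 d⟯ M} {α : SuspSpace f → ℝ} {ψ : Flow ℝ (SuspSpace f)}

theorem iter_natCast (f : M ≃ₘ^1⟮𝓡 d, 𝓡 d⟯ M) (n : ℕ) (x : M) : iter f n x = f^[n] x := by
  rw [iter, zpow_natCast, ← Equiv.Perm.iterate_eq_pow]
  rfl

theorem suspMk_iter (f : M ≃ₘ^1⟮𝓡 d, 𝓡 d⟯ M) (n : ℤ) (x : M) (s : ℝ) :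
    suspMk f (iter f n x, s) = suspMk f (x, s + n) :=
  ((suspMk_eq_iff f).2 ⟨n, by simp [deck]⟩).symm

theorem suspMk_iterate (f : M ≃ₘ^1⟮𝓡 d, 𝓡 d⟯ M) (n : ℕ) (x : M) (s : ℝ) :
    suspMk f (f^[n] x, s) = suspMk f (x, s + n) := by
  rw [← iter_natCast, suspMk_iter, Int.cast_natCast]

theorem contMDiff_suspMk_vertical [IsManifold (𝓡 d) 1 M] (f : M ≃ₘ^1⟮𝓡 d, 𝓡 d⟯ M) (x : M) :
    ContMDiff 𝓘(ℝ, ℝ) ((𝓡 d).prod 𝓘(ℝ, ℝ)) 1 fun s : ℝ => suspMk f (x, s) := by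
  intro s₀
  have hc : Continuous fun s : ℝ => suspMk f (x, s) :=
    (continuous_suspMk f).comp (by fun_prop)
  set z := suspLift f (suspMk f (x, s₀)) with hz
  obtain ⟨n, hn⟩ := (suspMk_eq_iff f).1 (suspMk_suspLift f (suspMk f (x, s₀))).symm
  rw [contMDiffAt_iff]
  refine ⟨hc.continuousAt, ?_⟩
  have hsrc : ∀ᶠ s : ℝ in 𝓝 s₀, ((iter f n x, s - n) : M × ℝ) ∈ (suspLocal f z).source := by
    have h1 : Continuous fun s : ℝ => ((iter f n x, s - n) : M × ℝ) := by fun_prop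
    refine h1.continuousAt ((suspLocal f z).open_source.mem_nhds ?_)
    have : ((iter f n x, s₀ - n) : M × ℝ) = z := hn
    rw [this]
    exact mem_suspLocal_source f z
  have hev : (extChartAt ((𝓡 d).prod 𝓘(ℝ, ℝ)) (suspMk f (x, s₀)) ∘ fun s : ℝ => suspMk f (x, s))
      =ᶠ[𝓝 s₀] fun s : ℝ => ((extChartAt (𝓡 d) z.1 (iter f n x), s - n) :
        EuclideanSpace ℝ (Fin d) × ℝ) := by
    filter_upwards [hsrc] with s hs
    have h2 := extChartAt_suspMk f (suspMk f (x, s₀)) hs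
    rw [suspMk_iter, sub_add_cancel] at h2
    exact h2
  have hd : ContDiffAt ℝ 1 (fun s : ℝ => ((extChartAt (𝓡 d) z.1 (iter f n x), s - n) :
      EuclideanSpace ℝ (Fin d) × ℝ)) s₀ := by fun_prop
  simp only [extChartAt_model_space_eq_id, PartialEquiv.refl_symm, PartialEquiv.refl_coe, comp_id,
    modelWithCornersSelf_coe, range_id, id_eq]
  exact (hd.congr_of_eventuallyEq hev).contDiffWithinAt

theorem IsBrake.contDiff_vertical [IsManifold (𝓡 d) 1 M] (hα : IsBrake f α) (x : M) :
    ContDiff ℝ 1 fun s : ℝ => α (suspMk f (x, s)) :=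
  (hα.contMDiff.comp (contMDiff_suspMk_vertical f x)).contDiff

/-- The covered height is an additive cocycle over the flow. -/
theorem IsSingularSuspension.coveredHeight_add (hψ : IsSingularSuspension f α ψ) (s t : ℝ)
    (p : SuspSpace f) :
    coveredHeight α ψ (s + t) p = coveredHeight α ψ s (ψ t p) + coveredHeight α ψ t p := by
  have hi := fun a b => (hψ.continuous_speed p).intervalIntegrable (μ := volume) a b
  have h1 : coveredHeight α ψ s (ψ t p) = ∫ r in t..s + t, α (ψ r p) := by
    have := intervalIntegral.integral_comp_add_right (a := 0) (b := s) (fun r => α (ψ r p)) t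
    rw [zero_add] at this
    simp only [coveredHeight, ← Flow.map_add]
    exact this
  rw [h1, add_comm (∫ r in t..s + t, α (ψ r p))]
  exact (intervalIntegral.integral_add_adjacent_intervals (hi _ _) (hi _ _)).symm

theorem IsSingularSuspension.continuous_coveredHeight (hψ : IsSingularSuspension f α ψ)
    (p : SuspSpace f) : Continuous fun t => coveredHeight α ψ t p :=
  continuous_iff_continuousAt.2 fun t => (hψ.hasDerivAt_coveredHeight p t).continuousAt

theorem IsSingularSuspension.monotone_coveredHeight (hψ : IsSingularSuspension f α ψ)
    (p : SuspSpace f) : Monotone fun t => coveredHeight α ψ t p :=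
  monotone_of_hasDerivAt_nonneg (fun t => hψ.hasDerivAt_coveredHeight p t)
    fun t => hψ.isBrake.nonneg (ψ t p)

theorem IsSingularSuspension.coveredHeight_nonneg (hψ : IsSingularSuspension f α ψ)
    (p : SuspSpace f) {t : ℝ} (ht : 0 ≤ t) : 0 ≤ coveredHeight α ψ t p := by
  rw [← coveredHeight_zero α ψ p]
  exact hψ.monotone_coveredHeight p ht

theorem IsSingularSuspension.continuous_coveredHeight_right (hψ : IsSingularSuspension f α ψ)
    (t : ℝ) : Continuous fun p => coveredHeight α ψ t p := by
  refine intervalIntegral.continuous_parametric_intervalIntegral_of_continuous' ?_ 0 t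
  exact hψ.isBrake.contMDiff.continuous.comp (ψ.continuous continuous_snd continuous_fst)

theorem IsSingularSuspension.exists_coveredHeight_le [CompactSpace M]
    (hψ : IsSingularSuspension f α ψ) :
    ∃ C, ∀ t p, 0 ≤ t → coveredHeight α ψ t p ≤ C * t := by
  obtain ⟨C, hC⟩ := (isCompact_range hψ.isBrake.contMDiff.continuous).bddAbove
  refine ⟨C, fun t p ht => ?_⟩
  have := intervalIntegral.integral_mono_on ht
    ((hψ.continuous_speed p).intervalIntegrable (μ := volume) 0 t)
    (intervalIntegrable_const (c := C)) fun r _ => hC (mem_range_self (ψ r p))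
  rw [intervalIntegral.integral_const, sub_zero, smul_eq_mul, mul_comm] at this
  exact this

theorem IsSingularSuspension.exists_coveredHeight_eq (hψ : IsSingularSuspension f α ψ)
    {p : SuspSpace f} {t v : ℝ} (ht : 0 ≤ t) (hv : 0 ≤ v) (hvt : v ≤ coveredHeight α ψ t p) :
    ∃ r ∈ Icc 0 t, coveredHeight α ψ r p = v := by
  have := intermediate_value_Icc ht (hψ.continuous_coveredHeight p).continuousOn
  simp only [coveredHeight_zero] at this
  exact this ⟨hv, hvt⟩

variable [IsManifold (𝓡 d) 1 M] [T2Space M]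

/-- Zeros of the brake are never left. -/
theorem IsSingularSuspension.coveredHeight_eq_zero (hψ : IsSingularSuspension f α ψ)
    {p : SuspSpace f} (hp : α p = 0) {t : ℝ} (ht : 0 ≤ t) : coveredHeight α ψ t p = 0 := by
  obtain ⟨⟨x, s⟩, rfl⟩ := suspMk_surjective f p
  set p := suspMk f (x, s)
  set g : ℝ → ℝ := fun u => α (suspMk f (x, s + u)) with hg
  have hgC : ContDiff ℝ 1 g :=
    (hψ.isBrake.contDiff_vertical x).comp (contDiff_const.add contDiff_id)
  set b := coveredHeight α ψ t p with hb
  obtain ⟨K, hK⟩ := (hgC.locallyLipschitz.locallyLipschitzOn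
    (s := Icc 0 b)).exists_lipschitzOnWith_of_compact isCompact_Icc
  have hder : ∀ r, HasDerivAt (fun r => coveredHeight α ψ r p) (g (coveredHeight α ψ r p)) r := by
    intro r
    have h1 := hψ.hasDerivAt_coveredHeight p r
    rw [hψ.flow_eq r p] at h1
    exact h1
  have hg0 : g 0 = 0 := by
    simp only [hg, add_zero]
    exact hp
  -- the covered height and the constant `0` solve `u' = g u`, and `g` is Lipschitz on `[0, b]`
  have := ODE_solution_unique_of_mem_Icc_right (v := fun _ => g) (s := fun _ => Icc 0 b) (K := K)
    (f := fun r => coveredHeight α ψ r p) (g := fun _ => (0 : ℝ)) (a := 0) (b := t)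
    (fun _ _ => hK) (hψ.continuous_coveredHeight p).continuousOn
    (fun r _ => (hder r).hasDerivWithinAt)
    (fun r hr => ⟨hψ.coveredHeight_nonneg p hr.1, hψ.monotone_coveredHeight p hr.2.le⟩)
    continuousOn_const
    (fun r _ => by rw [hg0]; exact (hasDerivAt_const r (0 : ℝ)).hasDerivWithinAt)
    (fun r _ => ⟨le_rfl, hψ.coveredHeight_nonneg p ht⟩) (coveredHeight_zero α ψ p)
  exact this ⟨ht, le_rfl⟩

/-- An orbit which climbs from height `0` to height `1` meets no zero of the brake on the way. -/
theorem IsSingularSuspension.brake_ne_zero (hψ : IsSingularSuspension f α ψ) {x : M} {t s : ℝ}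
    (ht : 0 ≤ t) (h : 1 ≤ coveredHeight α ψ t (suspMk f (x, 0))) (hs : s ∈ Ico (0 : ℝ) 1) :
    α (suspMk f (x, s)) ≠ 0 := by
  intro h0
  obtain ⟨r, hr, hrs⟩ := hψ.exists_coveredHeight_eq ht hs.1 (hs.2.le.trans h)
  have h1 : ψ r (suspMk f (x, 0)) = suspMk f (x, s) := by
    rw [hψ.flow_eq, hrs, suspFlow_suspMk, zero_add]
  have h2 := hψ.coveredHeight_add (t - r) r (suspMk f (x, 0))
  rw [h1, hψ.coveredHeight_eq_zero h0 (sub_nonneg.2 hr.2), hrs, sub_add_cancel] at h2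
  linarith [hs.2]

omit [IsManifold (𝓡 d) 1 M] [T2Space M] in
theorem mem_suspProj_image_iff {x : M} {S : Set (SuspSpace f)} :
    x ∈ suspProj f '' S ↔ ∃ s ∈ Ico (0 : ℝ) 1, suspMk f (x, s) ∈ S := by
  constructor
  · rintro ⟨p, hp, rfl⟩
    obtain ⟨z, rfl⟩ := suspMk_surjective f p
    refine ⟨Int.fract z.2, ⟨Int.fract_nonneg _, Int.fract_lt_one _⟩, ?_⟩
    have : suspMk f (suspProj f (suspMk f z), Int.fract z.2) = suspMk f z := by
      change suspMk f (iter f ⌊z.2⌋ z.1, Int.fract z.2) = suspMk f z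
      rw [suspMk_iter, Int.fract_add_floor]
    rwa [this]
  · rintro ⟨s, hs, hp⟩
    refine ⟨_, hp, ?_⟩
    change iter f ⌊s⌋ x = x
    rw [Int.floor_eq_zero_iff.2 hs, iter_zero]

/-- The return time is at most `t` exactly when the orbit has climbed to height `1` by time `t`. -/
theorem IsSingularSuspension.returnTime_le_iff (hψ : IsSingularSuspension f α ψ) {x : M} {t : ℝ}
    (ht : 0 ≤ t) :
    returnTime f α ψ x ≤ ENNReal.ofReal t ↔ 1 ≤ coveredHeight α ψ t (suspMk f (x, 0)) := by
  set p := suspMk f (x, 0) with hp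
  constructor
  · intro h
    by_contra! hlt
    have hx : x ∉ suspProj f '' {p | α p = 0} := by
      intro hx
      rw [returnTime, if_pos hx] at h
      exact absurd h (by simp)
    obtain ⟨t', ht', htt'⟩ : ∃ t', coveredHeight α ψ t' p < 1 ∧ t < t' := by
      have h1 : ∀ᶠ r in 𝓝[>] t, coveredHeight α ψ r p < 1 :=
        nhdsWithin_le_nhds ((hψ.continuous_coveredHeight p).continuousAt (Iio_mem_nhds hlt))
      exact (h1.and self_mem_nhdsWithin).exists
    have h2 : returnTime f α ψ x < ENNReal.ofReal t' :=
      h.trans_lt ((ENNReal.ofReal_lt_ofReal_iff (ht.trans_lt htt')).2 htt')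
    rw [returnTime, if_neg hx] at h2
    simp only [iInf_lt_iff] at h2
    obtain ⟨r, hr0, hr, hrt⟩ := h2
    have hrt' : r ≤ t' := (ENNReal.ofReal_lt_ofReal_iff (ht.trans_lt htt')).1 hrt |>.le
    have h3 : coveredHeight α ψ r p < 1 := (hψ.monotone_coveredHeight p hrt').trans_lt ht'
    have h4 := hψ.coveredHeight_nonneg p hr0.le
    rw [hψ.flow_eq, suspFlow_suspMk, suspFlow_suspMk, suspMk_eq_iff] at hr
    obtain ⟨n, hn⟩ := hr
    have h5 := congrArg Prod.snd hn
    simp only [deck, zero_add] at h5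
    have h6 : (n : ℝ) < 0 := by linarith
    have h7 : n ≤ -1 := by
      have : n < 0 := by exact_mod_cast h6
      omega
    have h8 : (n : ℝ) ≤ -1 := by exact_mod_cast h7
    -- a return at height `0` means that the orbit has not moved, so `α` vanishes at `p`
    have h9 : coveredHeight α ψ r p = 0 := by linarith
    have h10 : α p = 0 := by
      have hzero : ∀ s ∈ Ioo 0 r, coveredHeight α ψ s p = 0 := fun s hs =>
        le_antisymm (h9 ▸ hψ.monotone_coveredHeight p hs.2.le) (hψ.coveredHeight_nonneg p hs.1.le)
      have hmid : r / 2 ∈ Ioo 0 r := ⟨by linarith, by linarith⟩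
      have hd1 := hψ.hasDerivAt_coveredHeight p (r / 2)
      have hd2 : HasDerivAt (fun s => coveredHeight α ψ s p) 0 (r / 2) :=
        (hasDerivAt_const (r / 2) (0 : ℝ)).congr_of_eventuallyEq
          (Filter.eventually_of_mem (Ioo_mem_nhds hmid.1 hmid.2) hzero)
      have := hd1.unique hd2
      rwa [hψ.flow_eq, hzero _ hmid, Flow.map_zero_apply] at this
    exact hx (mem_suspProj_image_iff.2 ⟨0, by simp, h10⟩)
  · intro h
    have hx : x ∉ suspProj f '' {p | α p = 0} := by
      rw [mem_suspProj_image_iff]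
      rintro ⟨s, hs, h0⟩
      exact hψ.brake_ne_zero ht h hs h0
    obtain ⟨r, hr, hr1⟩ := hψ.exists_coveredHeight_eq ht zero_le_one h
    have hr0 : 0 < r := by
      rcases hr.1.eq_or_lt with h0 | h0
      · rw [← h0, coveredHeight_zero] at hr1
        norm_num at hr1
      · exact h0
    rw [returnTime, if_neg hx]
    refine (iInf₂_le_of_le r hr0 (iInf_le_of_le ?_ le_rfl)).trans (ENNReal.ofReal_le_ofReal hr.2)
    rw [hψ.flow_eq, hr1]

/-- The sublevel sets of the return time are closed, being given by a lower bound on the covered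
height, which is continuous. -/
theorem IsSingularSuspension.lowerSemicontinuous_returnTime (hψ : IsSingularSuspension f α ψ) :
    LowerSemicontinuous (returnTime f α ψ) := by
  rw [lowerSemicontinuous_iff_isClosed_preimage]
  intro y
  rcases eq_or_ne y ⊤ with rfl | hy
  · simp
  have h1 : returnTime f α ψ ⁻¹' Iic y =
      {x | 1 ≤ coveredHeight α ψ y.toReal (suspMk f (x, 0))} := by
    ext x
    rw [mem_preimage, mem_Iic, mem_ofPred_eq, ← hψ.returnTime_le_iff ENNReal.toReal_nonneg,
      ENNReal.ofReal_toReal hy]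
  rw [h1]
  exact isClosed_le continuous_const ((hψ.continuous_coveredHeight_right _).comp
    ((continuous_suspMk f).comp (by fun_prop)))

/-- The sum of the first `n` return times is at most `t` exactly when the orbit has climbed to
height `n` by time `t`. -/
theorem IsSingularSuspension.sum_returnTime_le_iff (hψ : IsSingularSuspension f α ψ) (n : ℕ)
    {x : M} {t : ℝ} (ht : 0 ≤ t) :
    ∑ i ∈ Finset.range n, returnTime f α ψ (f^[i] x) ≤ ENNReal.ofReal t ↔
      n ≤ coveredHeight α ψ t (suspMk f (x, 0)) := by
  have hclimb : ∀ (x : M) (r : ℝ), coveredHeight α ψ r (suspMk f (x, 0)) = 1 →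
      ∀ t, coveredHeight α ψ t (suspMk f (x, 0)) =
        coveredHeight α ψ (t - r) (suspMk f (f x, 0)) + 1 := by
    intro x r hr t
    have h1 : ψ r (suspMk f (x, 0)) = suspMk f (f x, 0) := by
      have := suspMk_iterate f 1 x 0
      rw [hψ.flow_eq, hr, suspFlow_suspMk]
      simpa using this.symm
    have h2 := hψ.coveredHeight_add (t - r) r (suspMk f (x, 0))
    rwa [h1, hr, sub_add_cancel] at h2
  induction n generalizing x t with
  | zero => simpa using hψ.coveredHeight_nonneg _ ht
  | succ n ih =>
    rw [Finset.sum_range_succ']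
    simp only [iterate_succ_apply, iterate_zero, id_eq]
    constructor
    · intro h
      have hγ : returnTime f α ψ x ≤ ENNReal.ofReal t := le_add_self.trans h
      have hγt : returnTime f α ψ x ≠ ⊤ := (hγ.trans_lt ENNReal.ofReal_lt_top).ne
      have ha := ENNReal.ofReal_toReal hγt
      obtain ⟨r, hr, hr1⟩ := hψ.exists_coveredHeight_eq ENNReal.toReal_nonneg zero_le_one
        ((hψ.returnTime_le_iff ENNReal.toReal_nonneg).1 ha.ge)
      have hat : (returnTime f α ψ x).toReal ≤ t := ENNReal.toReal_le_of_le_ofReal ht hγ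
      have h3 : ∑ i ∈ Finset.range n, returnTime f α ψ (f^[i] (f x)) ≤ ENNReal.ofReal (t - r) := by
        have h4 : ∑ i ∈ Finset.range n, returnTime f α ψ (f^[i] (f x)) ≤
            ENNReal.ofReal t - returnTime f α ψ x := ENNReal.le_sub_of_add_le_right hγt h
        refine h4.trans ?_
        rw [← ha, ← ENNReal.ofReal_sub _ ENNReal.toReal_nonneg]
        exact ENNReal.ofReal_le_ofReal (by linarith [hr.2])
      have h5 := (ih (x := f x) (show 0 ≤ t - r by linarith [hr.2])).1 h3
      rw [hclimb x r hr1 t]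
      push_cast
      linarith
    · intro h
      push_cast at h
      have hn : (0 : ℝ) ≤ n := Nat.cast_nonneg n
      obtain ⟨r, hr, hr1⟩ := hψ.exists_coveredHeight_eq ht zero_le_one
        (show 1 ≤ coveredHeight α ψ t (suspMk f (x, 0)) by linarith)
      have h1 : returnTime f α ψ x ≤ ENNReal.ofReal r := (hψ.returnTime_le_iff hr.1).2 hr1.ge
      rw [hclimb x r hr1 t] at h
      have h2 := (ih (x := f x) (sub_nonneg.2 hr.2)).2 (by linarith)
      calc _ ≤ ENNReal.ofReal (t - r) + ENNReal.ofReal r := add_le_add h2 h1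
        _ = ENNReal.ofReal t := by
          rw [← ENNReal.ofReal_add (sub_nonneg.2 hr.2) hr.1, sub_add_cancel]

end ReturnTime

/-! ### Comparing orbits of the singular suspension with orbits of the base map -/

section Shadowing

variable {d : ℕ} {M : Type*} [MetricSpace M] [CompactSpace M]
  [ChartedSpace (EuclideanSpace ℝ (Fin d)) M]
  {f : M ≃ₘ^1⟮𝓡 d, 𝓡 d⟯ M} {α : SuspSpace f → ℝ} {ψ : Flow ℝ (SuspSpace f)}

theorem int_eq_zero_of_abs_le_quarter {n : ℤ} (h : |(n : ℝ)| ≤ 1 / 4) : n = 0 := by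
  rw [abs_le] at h
  have h1 : (n : ℝ) < 1 := by linarith
  have h2 : (-1 : ℝ) < n := by linarith
  have h3 : n < 1 := by exact_mod_cast h1
  have h4 : -1 < n := by exact_mod_cast h2
  omega

/-- A neighbourhood of the diagonal such that two close points have nearby heights modulo `1`, and
close base points as soon as their heights are nearby. -/
theorem exists_nhdsSet_diagonal_suspMk (f : M ≃ₘ^1⟮𝓡 d, 𝓡 d⟯ M) {ε : ℝ} (hε : 0 < ε) :
    ∃ W ∈ 𝓝ˢ (diagonal (SuspSpace f)),
      (∀ x y a b, |a - b| = 1 / 4 → (suspMk f (x, a), suspMk f (y, b)) ∉ W) ∧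
      ∀ x y r, |r| ≤ 1 / 4 → (suspMk f (x, 0), suspMk f (y, r)) ∈ W → dist x y < ε := by
  set F : (M × M) × (ℝ × ℝ) → SuspSpace f × SuspSpace f :=
    fun z => (suspMk f (z.1.1, z.2.1), suspMk f (z.1.2, z.2.1 + z.2.2)) with hF
  have hFc : Continuous F :=
    ((continuous_suspMk f).comp (by fun_prop)).prodMk ((continuous_suspMk f).comp (by fun_prop))
  -- `K₁` parametrizes the pairs whose heights differ by `1 / 4`, and `K₂` the pairs of points of
  -- nearby heights, the first in the base fibre, whose base points are far apart
  set K₁ : Set ((M × M) × (ℝ × ℝ)) := univ ×ˢ (Icc 0 1 ×ˢ {-(1 / 4), 1 / 4}) with hK₁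
  set K₂ : Set ((M × M) × (ℝ × ℝ)) := {u | ε ≤ dist u.1 u.2} ×ˢ ({0} ×ˢ Icc (-(1 / 4)) (1 / 4))
    with hK₂
  have c₁ : IsCompact K₁ := isCompact_univ.prod (isCompact_Icc.prod (toFinite _).isCompact)
  have c₂ : IsCompact K₂ :=
    (isClosed_le continuous_const continuous_dist).isCompact.prod
      (isCompact_singleton.prod isCompact_Icc)
  refine ⟨(F '' K₁)ᶜ ∩ (F '' K₂)ᶜ, ?_, ?_, ?_⟩
  · refine ((c₁.image hFc).isClosed.isOpen_compl.inter
      (c₂.image hFc).isClosed.isOpen_compl).mem_nhdsSet.2 ?_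
    rintro ⟨p, q⟩ hpq
    obtain rfl : p = q := hpq
    constructor
    · rintro ⟨z, hz, hzp⟩
      obtain ⟨n, hn⟩ := (suspMk_eq_iff f).1
        ((congrArg Prod.fst hzp).trans (congrArg Prod.snd hzp).symm)
      have h1 := congrArg Prod.snd hn
      simp only [deck] at h1
      have h2 : (n : ℝ) = -z.2.2 := by linarith
      have h4 : |(n : ℝ)| = 1 / 4 := by
        have h3 : z.2.2 ∈ ({-(1 / 4), 1 / 4} : Set ℝ) := hz.2.2
        rw [h2, abs_neg]
        rcases h3 with h3 | h3
        · rw [h3]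
          norm_num
        · rw [mem_singleton_iff.1 h3]
          norm_num
      rw [int_eq_zero_of_abs_le_quarter h4.le] at h4
      norm_num at h4
    · rintro ⟨z, hz, hzp⟩
      obtain ⟨n, hn⟩ := (suspMk_eq_iff f).1
        ((congrArg Prod.fst hzp).trans (congrArg Prod.snd hzp).symm)
      have h1 := congrArg Prod.snd hn
      simp only [deck] at h1
      have h2 : (n : ℝ) = -z.2.2 := by linarith
      have h4 : |(n : ℝ)| ≤ 1 / 4 := by
        rw [h2, abs_neg]
        exact abs_le.2 hz.2.2
      have h5 := congrArg Prod.fst hn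
      rw [int_eq_zero_of_abs_le_quarter h4] at h5
      have h6 : z.1.1 = z.1.2 := h5
      have h7 : ε ≤ dist z.1.1 z.1.2 := hz.1
      rw [h6, dist_self] at h7
      linarith
  · intro x y a b hab hW
    refine hW.1 ⟨((iter f ⌊a⌋ x, iter f ⌊a⌋ y), (Int.fract a, b - a)),
      ⟨mem_univ _, ⟨Int.fract_nonneg _, (Int.fract_lt_one _).le⟩, ?_⟩, ?_⟩
    · rw [abs_sub_comm] at hab
      rcases abs_choice (b - a) with h | h
      · right
        exact h.symm.trans hab
      · left
        change b - a = -(1 / 4)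
        linarith
    · simp only [hF, suspMk_iter]
      rw [Int.fract_add_floor]
      have : Int.fract a + (b - a) + ⌊a⌋ = b := by
        linarith [Int.fract_add_floor a]
      rw [this]
  · intro x y r hr hW
    by_contra! h
    exact hW.2 ⟨((x, y), (0, r)), ⟨h, rfl, abs_le.1 hr⟩, by simp [hF]⟩

variable [IsManifold (𝓡 d) 1 M]

/-- If the `ψ`-orbits of `(x, 0)` and `(y, 0)` stay close up to time `T`, then the `f`-orbits of `x`
and `y` stay close for as long as the orbit of `(x, 0)` has climbed. -/
theorem IsSingularSuspension.exists_shadowing (hψ : IsSingularSuspension f α ψ) {ε : ℝ}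
    (hε : 0 < ε) :
    ∃ W ∈ 𝓝ˢ (diagonal (SuspSpace f)), ∀ (x y : M) (T : ℝ),
      (∀ t ∈ Icc 0 T, (ψ t (suspMk f (x, 0)), ψ t (suspMk f (y, 0))) ∈ W) → 0 ≤ T →
      ∀ k : ℕ, k ≤ coveredHeight α ψ T (suspMk f (x, 0)) → dist (f^[k] x) (f^[k] y) < ε := by
  obtain ⟨W, hW, h1, h2⟩ := exists_nhdsSet_diagonal_suspMk f hε
  refine ⟨W, hW, fun x y T hT hT0 k hk => ?_⟩
  set a := fun t => coveredHeight α ψ t (suspMk f (x, 0)) with ha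
  set b := fun t => coveredHeight α ψ t (suspMk f (y, 0)) with hb
  have hab : ∀ t ∈ Icc 0 T, (suspMk f (x, a t), suspMk f (y, b t)) ∈ W := by
    intro t ht
    have := hT t ht
    rwa [hψ.flow_eq, hψ.flow_eq t (suspMk f (y, 0)), suspFlow_suspMk, suspFlow_suspMk, zero_add,
      zero_add] at this
  -- the height difference starts at `0` and never takes the value `1 / 4`
  have hlt : ∀ t ∈ Icc 0 T, |a t - b t| < 1 / 4 := by
    intro t ht
    by_contra! hge
    have hc : ContinuousOn (fun t => |a t - b t|) (Icc 0 t) :=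
      ((hψ.continuous_coveredHeight _).sub (hψ.continuous_coveredHeight _)).abs.continuousOn
    have hz : |a 0 - b 0| = 0 := by simp [ha, hb, coveredHeight_zero]
    obtain ⟨s, hs, hs4⟩ := intermediate_value_Icc ht.1 hc
      (show (1 / 4 : ℝ) ∈ Icc (|a 0 - b 0|) (|a t - b t|) from ⟨by rw [hz]; norm_num, hge⟩)
    exact h1 x y _ _ hs4 (hab s ⟨hs.1, hs.2.trans ht.2⟩)
  obtain ⟨t, ht, hk'⟩ := hψ.exists_coveredHeight_eq hT0 (Nat.cast_nonneg k) hk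
  refine h2 _ _ (b t - k) ?_ ?_
  · rw [abs_sub_comm, ← hk']
    exact (hlt t ht).le
  · have := hab t ht
    rw [suspMk_iterate, suspMk_iterate, zero_add, sub_add_cancel]
    rwa [show a t = k from hk'] at this

omit [IsManifold (𝓡 d) 1 M] [CompactSpace M] in
/-- Every point of the suspension lies on the flow line through a point of the base fibre reached
within one unit of time. -/
theorem exists_suspMk_eq (p : SuspSpace f) :
    ∃ b : M, ∃ v ∈ Icc (-1 : ℝ) 0, suspMk f (b, v) = p := by
  obtain ⟨z, rfl⟩ := suspMk_surjective f p
  refine ⟨iter f ⌈z.2⌉ z.1, z.2 - ⌈z.2⌉, ⟨?_, ?_⟩, ?_⟩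
  · linarith [Int.ceil_lt_add_one z.2]
  · linarith [Int.le_ceil z.2]
  · rw [suspMk_iter, sub_add_cancel]

omit [CompactSpace M] in
/-- Starting at the next point of the base fibre costs at most one unit of covered height. -/
theorem IsSingularSuspension.le_coveredHeight_base (hψ : IsSingularSuspension f α ψ) {b : M}
    {v t : ℝ} (ht : 0 ≤ t) (hv : v ∈ Icc (-1 : ℝ) 0) {r : ℝ} (hr : 0 ≤ r)
    (h : r + 1 ≤ coveredHeight α ψ t (suspMk f (b, v))) :
    r ≤ coveredHeight α ψ t (suspMk f (b, 0)) := by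
  obtain ⟨s, hs, hsv⟩ := hψ.exists_coveredHeight_eq ht (neg_nonneg.2 hv.2)
    (by linarith [hv.1] : -v ≤ coveredHeight α ψ t (suspMk f (b, v)))
  have h1 : ψ s (suspMk f (b, v)) = suspMk f (b, 0) := by
    rw [hψ.flow_eq, hsv, suspFlow_suspMk, add_neg_cancel]
  have h2 := hψ.coveredHeight_add (t - s) s (suspMk f (b, v))
  rw [h1, hsv, sub_add_cancel] at h2
  have h3 := hψ.monotone_coveredHeight (suspMk f (b, 0)) (show t - s ≤ t by linarith [hs.1])
  simp only at h3
  linarith [hv.1]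

omit [IsManifold (𝓡 d) 1 M] in
/-- Orbit segments of the suspension flow that are separated and start at nearby heights are
separated by `f`. -/
theorem exists_le_dist_iterate_of_suspFlow {X : Type*} [MetricSpace X] (g : SuspSpace f → X)
    (hg : Continuous g) {δ : ℝ} (hδ : 0 < δ) :
    ∃ δ₁ > 0, ∀ (n : ℕ) (b b' : M), ∀ v ∈ Icc (-1 : ℝ) 0, ∀ v' ∈ Icc (-1 : ℝ) 0, |v - v'| < δ₁ →
      (∃ u ∈ Icc (0 : ℝ) (n + 3), δ ≤ dist (g (suspFlow f u (suspMk f (b, v))))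
        (g (suspFlow f u (suspMk f (b', v'))))) →
      ∃ i < n + 1, δ₁ ≤ dist (f^[i] b) (f^[i] b') := by
  obtain ⟨δ₁, hδ₁, h⟩ := exists_dist_lt_of_continuous
    (F := fun z : ℝ × M => g (suspMk f (z.2, z.1)))
    (hg.comp ((continuous_suspMk f).comp (by fun_prop))) (-2) 4 hδ
  refine ⟨min δ₁ 1, by positivity, ?_⟩
  rintro n b b' v hv v' hv' hvv ⟨u, hu, hdist⟩
  by_contra! hcl
  set i := min ⌊max (v + u) 0⌋₊ n with hi
  have hi1 : -1 ≤ v + u - i := by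
    have h0 : (i : ℝ) ≤ max (v + u) 0 := by
      refine le_trans ?_ (Nat.floor_le (le_max_right (v + u) 0))
      exact_mod_cast min_le_left _ _
    rcases max_choice (v + u) 0 with h1 | h1
    · rw [h1] at h0
      linarith
    · rw [h1] at h0
      linarith [hv.1, hu.1]
  have hi2 : v + u - i ≤ 3 := by
    rcases min_choice ⌊max (v + u) 0⌋₊ n with h1 | h1
    · have h2 := Nat.lt_floor_add_one (max (v + u) 0)
      rw [hi, h1]
      linarith [le_max_left (v + u) 0]
    · rw [hi, h1]
      linarith [hv.2, hu.2]
  have hd := hcl i (Nat.lt_succ_of_le (min_le_right _ _))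
  have hvv' := hvv.trans_le (min_le_right δ₁ 1)
  have hvv1 : |v + u - i - (v' + u - i)| < δ₁ := by
    rw [show v + u - i - (v' + u - i) = v - v' by ring]
    exact hvv.trans_le (min_le_left _ _)
  rw [abs_lt] at hvv'
  have := h (v + u - i) ⟨by linarith, by linarith⟩ (v' + u - i) ⟨by linarith, by linarith⟩
    (f^[i] b) (f^[i] b') hvv1 (hd.trans_le (min_le_left _ _))
  simp only [suspMk_iterate, sub_add_cancel] at this
  simp only [suspFlow_suspMk] at hdist
  linarith

omit [IsManifold (𝓡 d) 1 M] in
theorem metrizableSpace_suspSpace (f : M ≃ₘ^1⟮𝓡 d, 𝓡 d⟯ M) :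
    TopologicalSpace.MetrizableSpace (SuspSpace f) :=
  Manifold.metrizableSpace ((𝓡 d).prod 𝓘(ℝ, ℝ)) (SuspSpace f)

theorem IsSingularSuspension.isTimeChange (hψ : IsSingularSuspension f α ψ) :
    ∃ C, IsTimeChange (suspFlow f) ψ (coveredHeight α ψ) C := by
  obtain ⟨C, hC⟩ := hψ.exists_coveredHeight_le
  exact ⟨C, hψ.continuous_coveredHeight, hψ.monotone_coveredHeight, coveredHeight_zero α ψ, hC,
    hψ.flow_eq⟩

/-- If the singular suspension has positive entropy then there are exponentially many separated
`f`-orbit segments along which the mean return time is bounded. -/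
theorem IsSingularSuspension.exists_many_isBowenSeparated (hψ : IsSingularSuspension f α ψ)
    (hpos : 0 < topEntropy (ψ 1)) :
    ∃ δ > 0, ∃ c > 0, ∃ D : ℝ, ∀ n₀ : ℕ, ∃ n ≥ n₀, ∃ E : Finset M, IsBowenSeparated f n δ E ∧
      Real.exp (c * n) ≤ E.card ∧
      ∀ x ∈ E, ∑ i ∈ Finset.range n, returnTime f α ψ (f^[i] x) ≤ ENNReal.ofReal (D * n) := by
  classical
  have := metrizableSpace_suspSpace f
  let _ : MetricSpace (SuspSpace f) := TopologicalSpace.metrizableSpaceMetric _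
  obtain ⟨C, hC⟩ := hψ.isTimeChange
  obtain ⟨ε, hε, s, hs, hE⟩ := exists_isBowenSeparated_of_topEntropy_pos hpos
  obtain ⟨δ, hδ, c, hc, D, hG⟩ := hC.exists_many_isFlowSeparated hε hs hE
  obtain ⟨δ₁, hδ₁, hsep⟩ := exists_le_dist_iterate_of_suspFlow (f := f) id continuous_id hδ
  obtain ⟨K, hK⟩ := exists_nat_gt (1 / δ₁)
  have hK0 : (0 : ℝ) < K := lt_trans (by positivity) hK
  choose b v hv hbv using exists_suspMk_eq (f := f)
  refine ⟨δ₁, hδ₁, c / 2, half_pos hc, |D| * 2, fun n₀ => ?_⟩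
  obtain ⟨n₁, hn₁⟩ := eventually_atTop.1 (eventually_mul_add_le_exp 0 (K + 1) (half_pos hc))
  obtain ⟨n, hn, N, hN, G, hGsep, hGcard, hGh⟩ := hG (n₀ + n₁ + 2)
  -- passing to the base points loses one unit of height, so `n - 1 = m + 1` returns remain
  obtain ⟨m, rfl⟩ : ∃ m, n = m + 2 := ⟨n - 2, by omega⟩
  -- keep the points whose starting heights lie in the most populated interval of length `1 / K`
  set col : SuspSpace f → ℕ := fun y => ⌊(v y + 1) * K⌋₊ with hcol
  have hmaps : ∀ y ∈ G, col y ∈ Finset.range (K + 1) := by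
    intro y _
    refine Finset.mem_range.2 (Nat.lt_succ_of_le (Nat.floor_le_of_le ?_))
    nlinarith [(hv y).2]
  have hcell : ∀ y y', col y = col y' → |v y - v y'| < δ₁ := by
    intro y y' h
    have h1 : |(v y + 1) * K - (v y' + 1) * K| < 1 :=
      Int.abs_sub_lt_one_of_floor_eq_floor (by
        rw [← Int.natCast_floor_eq_floor (by nlinarith [(hv y).1]),
          ← Int.natCast_floor_eq_floor (by nlinarith [(hv y').1])]
        exact congrArg _ h)
    rw [← sub_mul, abs_mul, abs_of_pos hK0, add_sub_add_right_eq_sub] at h1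
    rw [one_div_lt hδ₁ hK0] at hK
    refine lt_trans ?_ hK
    rwa [lt_div_iff₀ hK0]
  obtain ⟨j, -, hj⟩ := Finset.exists_max_image (Finset.range (K + 1))
    (fun j => {y ∈ G | col y = j}.card) ⟨0, by simp⟩
  set G' := {y ∈ G | col y = j} with hG'
  have hcard : (G.card : ℝ) ≤ (K + 1) * G'.card := by
    have h1 := Finset.card_eq_sum_card_fiberwise hmaps
    have h2 := Finset.sum_le_card_nsmul (Finset.range (K + 1))
      (fun j => {y ∈ G | col y = j}.card) _ hj
    rw [← h1, Finset.card_range, smul_eq_mul] at h2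
    exact_mod_cast h2
  have hfs : ∀ y ∈ G', ∀ y' ∈ G', y ≠ y' → ∃ i < m + 1, δ₁ ≤ dist (f^[i] (b y)) (f^[i] (b y')) := by
    intro y hy y' hy' hne
    rw [hG', Finset.mem_filter] at hy hy'
    obtain ⟨u, hu, hd⟩ := hGsep y hy.1 y' hy'.1 hne
    refine hsep m (b y) (b y') _ (hv y) _ (hv y') (hcell _ _ (hy.2.trans hy'.2.symm)) ⟨u, ?_, ?_⟩
    · push_cast at hu
      exact ⟨hu.1, by linarith [hu.2]⟩
    · rw [hbv, hbv]
      exact hd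
  have hinj : InjOn b G' := by
    intro y hy y' hy' h
    by_contra hne
    obtain ⟨i, -, hi⟩ := hfs y hy y' hy' hne
    rw [h, dist_self] at hi
    linarith
  have hm : (0 : ℝ) ≤ m := Nat.cast_nonneg _
  refine ⟨m + 1, by omega, G'.image b, ?_, ?_, ?_⟩
  · intro x hx x' hx' hne
    obtain ⟨y, hy, rfl⟩ := Finset.mem_image.1 hx
    obtain ⟨y', hy', rfl⟩ := Finset.mem_image.1 hx'
    exact hfs y hy y' hy' fun h => hne (congrArg b h)
  · rw [Finset.card_image_of_injOn hinj]
    have h1 := hn₁ (m + 1) (by omega)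
    rw [zero_mul, zero_add] at h1
    refine le_of_mul_le_mul_left (a := (K + 1 : ℝ)) ?_ (by positivity)
    calc (K + 1 : ℝ) * Real.exp (c / 2 * (m + 1 : ℕ))
        ≤ Real.exp (c / 2 * (m + 1 : ℕ)) * Real.exp (c / 2 * (m + 1 : ℕ)) := by gcongr
      _ = Real.exp (c * (m + 1)) := by
          rw [← Real.exp_add]
          push_cast
          ring_nf
      _ ≤ Real.exp (c * (m + 2 : ℕ)) := Real.exp_le_exp.2 (by push_cast; nlinarith)
      _ ≤ _ := hGcard.trans hcard
  · intro x hx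
    obtain ⟨y, hy, rfl⟩ := Finset.mem_image.1 hx
    rw [hG', Finset.mem_filter] at hy
    have hND : (N : ℝ) ≤ |D| * 2 * (m + 1 : ℕ) := by
      push_cast at hN ⊢
      calc (N : ℝ) ≤ D * (m + 2) := hN
        _ ≤ |D| * (m + 2) := by gcongr; exact le_abs_self D
        _ ≤ |D| * 2 * (m + 1) := by nlinarith [abs_nonneg D]
    refine le_trans ?_ (ENNReal.ofReal_le_ofReal hND)
    rw [hψ.sum_returnTime_le_iff _ (Nat.cast_nonneg N)]
    refine hψ.le_coveredHeight_base (Nat.cast_nonneg N) (hv y) (Nat.cast_nonneg _) ?_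
    rw [hbv]
    have := hGh y hy.1
    push_cast at this ⊢
    linarith

/-- If the singular suspension has zero entropy then subexponentially many `f`-orbit segments
suffice to shadow those along which the mean return time is bounded. -/
theorem IsSingularSuspension.eventually_bowen_cover (hψ : IsSingularSuspension f α ψ)
    (h0 : topEntropy (ψ 1) = 0) {ε κ c : ℝ} (hε : 0 < ε) (hκ : 0 < κ) (hc : 0 < c) :
    ∀ᶠ n : ℕ in atTop, ∃ F : Finset M, (F.card : ℝ) ≤ Real.exp (κ * n) ∧
      ∀ x, ∑ i ∈ Finset.range n, returnTime f α ψ (f^[i] x) ≤ ENNReal.ofReal (c * n) →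
        ∃ y ∈ F, ∀ i < n, dist (f^[i] x) (f^[i] y) < ε := by
  classical
  have := metrizableSpace_suspSpace f
  let _ : MetricSpace (SuspSpace f) := TopologicalSpace.metrizableSpaceMetric _
  obtain ⟨W, hW, hshadow⟩ := hψ.exists_shadowing hε
  rw [nhdsSet_diagonal_eq_uniformity] at hW
  obtain ⟨ε₁, hε₁, hWε⟩ := Metric.mem_uniformity_dist.1 hW
  obtain ⟨δ, hδ, hδε⟩ := ψ.exists_dist_lt 1 hε₁
  set κ' := κ / (c + 2) with hκ'
  have hκ'0 : 0 < κ' := by positivity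
  obtain ⟨N₀, hN₀⟩ := eventually_atTop.1
    (eventually_bowen_cover_of_topEntropy_eq_zero h0 (half_pos hδ) hκ'0)
  have hlarge : ∀ᶠ n : ℕ in atTop, N₀ ≤ ⌊c * n⌋₊ + 1 := by
    have h1 : Tendsto (fun n : ℕ => c * (n : ℝ)) atTop atTop :=
      tendsto_natCast_atTop_atTop.const_mul_atTop hc
    filter_upwards [h1.eventually_ge_atTop (N₀ : ℝ)] with n hn
    exact (Nat.le_floor hn).trans (Nat.le_succ _)
  filter_upwards [hlarge, eventually_ge_atTop 1] with n hn hn1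
  obtain ⟨F, hF, hcov⟩ := hN₀ _ hn
  have hn1' : (1 : ℝ) ≤ n := by exact_mod_cast hn1
  have hcn : 0 ≤ c * n := by positivity
  set P : SuspSpace f → M → Prop := fun p y => ∀ i < ⌊c * n⌋₊ + 1,
    dist ((ψ 1)^[i] (suspMk f (y, 0))) ((ψ 1)^[i] p) < δ / 2 with hP
  -- replace the centres whose Bowen ball meets the base fibre by points of the base fibre
  set F' := {p ∈ F | ∃ y, P p y} with hF'
  have hrep : ∀ p, ∃ y : M, p ∈ F' → P p y := by
    intro p
    by_cases hp : p ∈ F'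
    · obtain ⟨y, hy⟩ := (Finset.mem_filter.1 hp).2
      exact ⟨y, fun _ => hy⟩
    · obtain ⟨z, -⟩ := suspMk_surjective f p
      exact ⟨z.1, fun h => absurd h hp⟩
  choose y hy using hrep
  refine ⟨F'.image y, ?_, fun x hx => ?_⟩
  · have h1 : ((F'.image y).card : ℝ) ≤ F.card := by
      exact_mod_cast Finset.card_image_le.trans (Finset.card_filter_le _ _)
    refine h1.trans (hF.trans (Real.exp_le_exp.2 ?_))
    rw [hκ', div_mul_eq_mul_div, div_le_iff₀ (by positivity), mul_assoc]
    gcongr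
    push_cast
    have := Nat.floor_le hcn
    nlinarith
  · obtain ⟨p, hpF, hp⟩ := hcov (suspMk f (x, 0))
    have hpF' : p ∈ F' := Finset.mem_filter.2 ⟨hpF, x, hp⟩
    refine ⟨y p, Finset.mem_image_of_mem _ hpF', fun i hi => ?_⟩
    have hh := (hψ.sum_returnTime_le_iff n hcn).1 hx
    refine hshadow x (y p) (c * n) (fun t ht => hWε ?_) hcn i
      (le_trans (by exact_mod_cast hi.le) hh)
    have hiter : ∀ q, ψ t q = ψ (t - ⌊t⌋₊) ((ψ 1)^[⌊t⌋₊] q) := by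
      intro q
      have h1 : ∀ k : ℕ, (ψ 1)^[k] q = ψ k q := by
        intro k
        induction k with
        | zero => simp
        | succ k ih =>
          rw [iterate_succ_apply', ih, ← Flow.map_add]
          congr 1
          push_cast
          ring
      rw [h1, ← Flow.map_add, sub_add_cancel]
    rw [hiter, hiter (suspMk f (y p, 0))]
    refine hδε _ ⟨by linarith [Nat.floor_le ht.1], by linarith [Nat.lt_floor_add_one t]⟩ _ _ ?_
    have hlt : ⌊t⌋₊ < ⌊c * n⌋₊ + 1 := Nat.lt_succ_of_le (Nat.floor_le_floor ht.2)
    have d1 := hp _ hlt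
    have d2 := hy p hpF' _ hlt
    linarith [dist_triangle_right ((ψ 1)^[⌊t⌋₊] (suspMk f (x, 0)))
      ((ψ 1)^[⌊t⌋₊] (suspMk f (y p, 0))) ((ψ 1)^[⌊t⌋₊] p)]

end Shadowing

/-! ### An invariant measure of positive entropy carried by separated orbits -/

section Misiurewicz

/-- The average of the measures `ν i` over `i ∈ s`. -/
noncomputable def avgMeasure {X ι : Type*} [MeasurableSpace X] (s : Finset ι) (ν : ι → Measure X) :
    Measure X :=
  (s.card : ℝ≥0∞)⁻¹ • ∑ i ∈ s, ν i

section Average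

variable {X ι : Type*} [MeasurableSpace X] {s : Finset ι} {ν : ι → Measure X}

theorem avgMeasure_apply (A : Set X) :
    avgMeasure s ν A = (s.card : ℝ≥0∞)⁻¹ * ∑ i ∈ s, ν i A := by
  rw [avgMeasure, Measure.smul_apply, Measure.finsetSum_apply, smul_eq_mul]

theorem isProbabilityMeasure_avgMeasure (hs : s.Nonempty) [∀ i, IsProbabilityMeasure (ν i)] :
    IsProbabilityMeasure (avgMeasure s ν) := by
  constructor
  rw [avgMeasure_apply]
  simp only [measure_univ, Finset.sum_const, nsmul_eq_mul, mul_one]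
  exact ENNReal.inv_mul_cancel (by exact_mod_cast hs.card_pos.ne') (ENNReal.natCast_ne_top _)

theorem avgMeasure_real [∀ i, IsFiniteMeasure (ν i)] (A : Set X) :
    (avgMeasure s ν).real A = (∑ i ∈ s, (ν i).real A) / s.card := by
  rw [measureReal_def, avgMeasure_apply, ENNReal.toReal_mul,
    ENNReal.toReal_sum fun i _ => measure_ne_top _ _, ENNReal.toReal_inv, ENNReal.toReal_natCast,
    div_eq_inv_mul]
  rfl

theorem integral_avgMeasure {g : X → ℝ} (hg : ∀ i ∈ s, Integrable g (ν i)) :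
    ∫ x, g x ∂avgMeasure s ν = (∑ i ∈ s, ∫ x, g x ∂ν i) / s.card := by
  rw [avgMeasure, integral_smul_measure, integral_finsetSum_measure hg, ENNReal.toReal_inv,
    ENNReal.toReal_natCast, div_eq_inv_mul, smul_eq_mul]

theorem lintegral_avgMeasure (g : X → ℝ≥0∞) :
    ∫⁻ x, g x ∂avgMeasure s ν = (s.card : ℝ≥0∞)⁻¹ * ∑ i ∈ s, ∫⁻ x, g x ∂ν i := by
  rw [avgMeasure, lintegral_smul_measure, lintegral_finsetSum_measure, smul_eq_mul]

theorem lintegral_avgMeasure_le {g : X → ℝ≥0∞} {K : ℝ≥0∞} (hs : s.Nonempty)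
    (h : ∀ i ∈ s, ∫⁻ x, g x ∂ν i ≤ K) : ∫⁻ x, g x ∂avgMeasure s ν ≤ K := by
  rw [lintegral_avgMeasure]
  calc _ ≤ (s.card : ℝ≥0∞)⁻¹ * (s.card • K) := by gcongr; exact Finset.sum_le_card_nsmul _ _ _ h
    _ = K := by
      rw [nsmul_eq_mul, ← mul_assoc, ENNReal.inv_mul_cancel (by exact_mod_cast hs.card_pos.ne')
        (ENNReal.natCast_ne_top _), one_mul]

end Average

theorem log_le_partitionEntropy {X ι : Type*} [MeasurableSpace X] [Fintype ι] [MeasurableSpace ι]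
    [MeasurableSingletonClass ι] (μ : Measure X) [IsProbabilityMeasure μ] {P : X → ι}
    (hP : Measurable P) {a : ℝ} (h : ∀ i, μ.real (P ⁻¹' {i}) ≤ 1 / a) :
    Real.log a ≤ partitionEntropy μ P := by
  have h1 : ∀ i, μ.real (P ⁻¹' {i}) * Real.log a ≤ Real.negMulLog (μ.real (P ⁻¹' {i})) := by
    intro i
    rcases (measureReal_nonneg (μ := μ) (s := P ⁻¹' {i})).eq_or_lt with h0 | h0
    · rw [← h0]
      simp
    · rw [Real.negMulLog, neg_mul, ← mul_neg]
      refine mul_le_mul_of_nonneg_left ?_ h0.le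
      rw [le_neg, ← Real.log_inv, ← one_div]
      exact Real.log_le_log h0 (h i)
  calc Real.log a = ∑ i, μ.real (P ⁻¹' {i}) * Real.log a := by
        rw [← Finset.sum_mul, sum_measureReal_fiber μ hP, one_mul]
    _ ≤ _ := Finset.sum_le_sum fun i _ => h1 i

/-- The layer-cake comparison of a function with its super-level sets at integer heights. -/
theorem le_one_add_tsum_indicator {X : Type*} {γ : X → ℝ≥0∞} (x : X) :
    γ x ≤ 1 + ∑' k : ℕ, {x | ((k + 1 : ℕ) : ℝ≥0∞) < γ x}.indicator 1 x := by
  set S := ∑' k : ℕ, {x | ((k + 1 : ℕ) : ℝ≥0∞) < γ x}.indicator (1 : X → ℝ≥0∞) x with hS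
  have hN : ∀ N : ℕ, (N : ℝ≥0∞) < γ x → (N : ℝ≥0∞) ≤ S := by
    intro N h
    refine le_trans (le_of_eq ?_) (ENNReal.sum_le_tsum (Finset.range N))
    have h1 : ∀ k ∈ Finset.range N,
        {x | ((k + 1 : ℕ) : ℝ≥0∞) < γ x}.indicator (1 : X → ℝ≥0∞) x = 1 := fun k hk =>
      indicator_of_mem (s := {x | ((k + 1 : ℕ) : ℝ≥0∞) < γ x}) (lt_of_le_of_lt
        (Nat.cast_le.2 (Nat.succ_le_of_lt (Finset.mem_range.1 hk))) h) _
    rw [Finset.sum_congr rfl h1]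
    simp
  by_contra! hlt
  have hS0 : S ≠ ⊤ := by
    intro h
    rw [h] at hlt
    simp at hlt
  have h1 := ENNReal.ofReal_toReal hS0
  have h2 : ((⌊S.toReal⌋₊ + 1 : ℕ) : ℝ≥0∞) ≤ S := by
    refine hN _ (lt_of_le_of_lt ?_ hlt)
    push_cast
    rw [add_comm]
    gcongr
    rw [← ENNReal.ofReal_natCast]
    exact (ENNReal.ofReal_le_ofReal (Nat.floor_le ENNReal.toReal_nonneg)).trans_eq h1
  rw [← ENNReal.ofReal_natCast] at h2
  have h3 := h2.trans_eq h1.symm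
  rw [ENNReal.ofReal_le_ofReal_iff ENNReal.toReal_nonneg] at h3
  push_cast at h3
  linarith [Nat.lt_floor_add_one S.toReal]

theorem sum_indicator_le {X : Type*} {γ : X → ℝ≥0∞} (K : ℕ) (x : X) :
    ∑ k ∈ Finset.range K, {x | ((k + 1 : ℕ) : ℝ≥0∞) < γ x}.indicator (1 : X → ℝ≥0∞) x ≤ γ x := by
  induction K with
  | zero => simp
  | succ K ih =>
    rw [Finset.sum_range_succ]
    by_cases h : ((K + 1 : ℕ) : ℝ≥0∞) < γ x
    · refine le_trans ?_ h.le
      push_cast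
      gcongr
      · refine (Finset.sum_le_card_nsmul _ _ 1 fun k _ => ?_).trans (by simp)
        exact indicator_le_self' (fun _ _ => zero_le) x
      · exact indicator_le_self' (fun _ _ => zero_le) x
    · rw [indicator_of_notMem (by exact h), add_zero]
      exact ih

variable {X : Type*} [MetricSpace X] [MeasurableSpace X] [BorelSpace X]

omit [BorelSpace X] in
theorem measure_frontier_inter_eq_zero {μ : Measure X} {A B : Set X} (hA : μ (frontier A) = 0)
    (hB : μ (frontier B) = 0) : μ (frontier (A ∩ B)) = 0 :=
  measure_mono_null ((frontier_inter_subset A B).trans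
    (union_subset_union inter_subset_left inter_subset_right)) (measure_union_null hA hB)

omit [BorelSpace X] in
theorem measure_frontier_iInter_eq_zero {ι : Type*} [Finite ι] {μ : Measure X} {A : ι → Set X}
    (hA : ∀ i, μ (frontier (A i)) = 0) : μ (frontier (⋂ i, A i)) = 0 := by
  classical
  cases nonempty_fintype ι
  have : ∀ s : Finset ι, μ (frontier (⋂ i ∈ s, A i)) = 0 := by
    intro s
    induction s using Finset.induction_on with
    | empty => simp
    | insert a s _ ih =>
      rw [Finset.set_biInter_insert]
      exact measure_frontier_inter_eq_zero (hA a) ih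
  simpa using this Finset.univ

/-- There are finite measurable partitions into arbitrarily small cells with negligible boundary:
only countably many of the concentric balls around a point have boundary of positive measure. -/
theorem exists_partition_null_frontier [CompactSpace X] (μ : Measure X) [IsFiniteMeasure μ] {δ : ℝ}
    (hδ : 0 < δ) :
    ∃ (k : ℕ) (P : X → Fin k), Measurable P ∧ (∀ i, μ (frontier (P ⁻¹' {i})) = 0) ∧
      ∀ x y, P x = P y → dist x y < δ := by
  classical
  obtain ⟨t, -, ht, hcov⟩ := (isCompact_univ (X := X)).finite_cover_balls
    (show 0 < δ / 4 by positivity)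
  have := ht.to_subtype
  obtain ⟨k, ⟨e⟩⟩ := Finite.exists_equiv_fin t
  choose r hr hr0 using fun i : Fin k => exists_null_frontier_thickening μ {(e.symm i : X)}
    (show δ / 4 < δ / 2 by linarith)
  simp only [Metric.thickening_singleton] at hr0
  set U : Fin k → Set X := fun i => Metric.ball (e.symm i : X) (r i) with hU
  have hex : ∀ x, ∃ i, x ∈ U i ∧ ∀ j < i, x ∉ U j := by
    intro x
    have h1 := hcov (mem_univ x)
    simp only [mem_iUnion] at h1
    obtain ⟨y, hy, hxy⟩ := h1
    obtain ⟨i, hi, hmin⟩ := wellFounded_lt.has_min {i | x ∈ U i} ⟨e ⟨y, hy⟩, by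
      refine Metric.ball_subset_ball (hr _).1.le ?_
      simpa using hxy⟩
    exact ⟨i, hi, fun j hj hxj => hmin j hxj hj⟩
  choose P hPU hPmin using hex
  have hfib : ∀ i, P ⁻¹' {i} = U i ∩ ⋂ j : Fin k, (if j < i then (U j)ᶜ else univ) := by
    intro i
    ext x
    simp only [mem_preimage, mem_singleton_iff, mem_inter_iff, mem_iInter]
    constructor
    · rintro rfl
      refine ⟨hPU x, fun j => ?_⟩
      split_ifs with h
      · exact hPmin x j h
      · trivial
    · rintro ⟨h1, h2⟩
      rcases lt_trichotomy (P x) i with h | h | h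
      · have := h2 (P x)
        rw [if_pos h] at this
        exact absurd (hPU x) this
      · exact h
      · exact absurd h1 (hPmin x i h)
  refine ⟨k, P, measurable_to_countable' fun i => ?_, fun i => ?_, fun x y hxy => ?_⟩
  · rw [hfib]
    refine Metric.isOpen_ball.measurableSet.inter (MeasurableSet.iInter fun j => ?_)
    split_ifs
    · exact Metric.isOpen_ball.measurableSet.compl
    · exact MeasurableSet.univ
  · rw [hfib]
    refine measure_frontier_inter_eq_zero (hr0 i) (measure_frontier_iInter_eq_zero fun j => ?_)
    split_ifs
    · rw [frontier_compl]
      exact hr0 j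
    · simp
  · have h1 := Metric.mem_ball.1 (hPU x)
    have h2 := Metric.mem_ball.1 (hPU y)
    rw [hxy] at h1
    linarith [dist_triangle_right x y (e.symm (P y) : X), (hr (P y)).2]

/-- Along weakly converging measures, a bound on the integrals of a lower semicontinuous function
passes to the limit, up to an additive constant. -/
theorem lintegral_le_of_tendsto {ι : Type*} {L : Filter ι} [L.NeBot] {μs : ι → ProbabilityMeasure X}
    {μ : ProbabilityMeasure X} (hμ : Tendsto μs L (𝓝 μ)) {γ : X → ℝ≥0∞}
    (hγ : LowerSemicontinuous γ) {D : ℝ} (hD : 0 ≤ D)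
    (h : ∀ᶠ i in L, ∫⁻ x, γ x ∂(μs i : Measure X) ≤ ENNReal.ofReal D) :
    ∫⁻ x, γ x ∂(μ : Measure X) ≤ ENNReal.ofReal (1 + D) := by
  have hG : ∀ k : ℕ, IsOpen {x | ((k + 1 : ℕ) : ℝ≥0∞) < γ x} := fun k => hγ.isOpen_preimage _
  have hsum : ∀ K : ℕ, ∑ k ∈ Finset.range K, (μ : Measure X) {x | ((k + 1 : ℕ) : ℝ≥0∞) < γ x} ≤
      ENNReal.ofReal D := by
    intro K
    have h1 : ∀ η > 0, ∑ k ∈ Finset.range K,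
        (μ : Measure X).real {x | ((k + 1 : ℕ) : ℝ≥0∞) < γ x} ≤ D + K * η := by
      intro η hη
      have h2 : ∀ k : ℕ, ∀ᶠ i in L, (μ : Measure X).real {x | ((k + 1 : ℕ) : ℝ≥0∞) < γ x} - η <
          (μs i : Measure X).real {x | ((k + 1 : ℕ) : ℝ≥0∞) < γ x} := by
        intro k
        rcases lt_or_ge ((μ : Measure X).real {x | ((k + 1 : ℕ) : ℝ≥0∞) < γ x} - η) 0 with h3 | h3
        · exact Eventually.of_forall fun i => h3.trans_le measureReal_nonneg
        · have h4 : ENNReal.ofReal ((μ : Measure X).real {x | ((k + 1 : ℕ) : ℝ≥0∞) < γ x} - η) <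
              liminf (fun i => (μs i : Measure X) {x | ((k + 1 : ℕ) : ℝ≥0∞) < γ x}) L := by
            refine lt_of_lt_of_le ?_
              (ProbabilityMeasure.le_liminf_measure_open_of_tendsto hμ (hG k))
            rw [ENNReal.ofReal_lt_iff_lt_toReal h3 (measure_ne_top _ _)]
            change _ < (μ : Measure X).real _
            linarith
          filter_upwards [eventually_lt_of_lt_liminf h4] with i hi
          rwa [ENNReal.ofReal_lt_iff_lt_toReal h3 (measure_ne_top _ _)] at hi
      obtain ⟨i, hi, hi'⟩ := (((Finset.range K).eventually_all.2 fun k _ => h2 k).and h).exists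
      have h5 : ∑ k ∈ Finset.range K, (μs i : Measure X).real {x | ((k + 1 : ℕ) : ℝ≥0∞) < γ x} ≤
          D := by
        have h6 : ∑ k ∈ Finset.range K, (μs i : Measure X) {x | ((k + 1 : ℕ) : ℝ≥0∞) < γ x} ≤
            ENNReal.ofReal D := by
          refine le_trans ?_ hi'
          refine le_trans (le_of_eq ?_) (lintegral_mono (sum_indicator_le K))
          rw [lintegral_finsetSum _ fun k _ => measurable_one.indicator (hG k).measurableSet]
          exact Finset.sum_congr rfl fun k _ => (lintegral_indicator_one (hG k).measurableSet).symm
        have h7 := ENNReal.toReal_le_of_le_ofReal hD h6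
        rwa [ENNReal.toReal_sum fun k _ => measure_ne_top _ _] at h7
      calc _ ≤ ∑ k ∈ Finset.range K,
            ((μs i : Measure X).real {x | ((k + 1 : ℕ) : ℝ≥0∞) < γ x} + η) :=
            Finset.sum_le_sum fun k hk => by linarith [hi k hk]
        _ ≤ D + K * η := by
          rw [Finset.sum_add_distrib, Finset.sum_const, Finset.card_range, nsmul_eq_mul]
          linarith
    have h2 : ∑ k ∈ Finset.range K, (μ : Measure X).real {x | ((k + 1 : ℕ) : ℝ≥0∞) < γ x} ≤ D := by
      refine le_of_forall_pos_le_add fun η hη => (h1 (η / (K + 1)) (by positivity)).trans ?_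
      gcongr
      rw [mul_div_assoc', div_le_iff₀ (by positivity)]
      nlinarith
    rw [← ENNReal.ofReal_toReal (a := ∑ k ∈ Finset.range K, _)
      (ENNReal.sum_ne_top.2 fun k _ => measure_ne_top _ _)]
    refine ENNReal.ofReal_le_ofReal ?_
    rwa [ENNReal.toReal_sum fun k _ => measure_ne_top _ _]
  calc ∫⁻ x, γ x ∂(μ : Measure X)
      ≤ ∫⁻ x, 1 + ∑' k : ℕ, {x | ((k + 1 : ℕ) : ℝ≥0∞) < γ x}.indicator 1 x ∂(μ : Measure X) :=
        lintegral_mono le_one_add_tsum_indicator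
    _ = 1 + ∑' k : ℕ, (μ : Measure X) {x | ((k + 1 : ℕ) : ℝ≥0∞) < γ x} := by
        rw [lintegral_add_left measurable_const, lintegral_tsum fun k =>
          (measurable_one.indicator (hG k).measurableSet).aemeasurable]
        simp only [lintegral_indicator_one (hG _).measurableSet, lintegral_one, measure_univ]
    _ ≤ 1 + ENNReal.ofReal D := by
        gcongr
        rw [ENNReal.tsum_eq_iSup_nat]
        exact iSup_le hsum
    _ = _ := by rw [ENNReal.ofReal_add zero_le_one hD, ENNReal.ofReal_one]

/-- Limits of averages along longer and longer orbit segments are invariant. -/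
theorem measurePreserving_of_tendsto_avgMeasure {ι : Type*} {L : Filter ι} [L.NeBot] {T : X → X}
    (hT : Continuous T) {σ : ι → Measure X} [∀ i, IsProbabilityMeasure (σ i)] {n : ι → ℕ}
    (hn : Tendsto n L atTop) {μs : ι → ProbabilityMeasure X}
    (hμs : ∀ i, (μs i : Measure X) = avgMeasure (Finset.range (n i)) fun j => (σ i).map T^[j])
    {μ : ProbabilityMeasure X} (hμ : Tendsto μs L (𝓝 μ)) :
    MeasurePreserving T (μ : Measure X) μ := by
  refine ⟨hT.measurable, ?_⟩
  have := Measure.isProbabilityMeasure_map (μ := (μ : Measure X)) hT.measurable.aemeasurable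
  refine ext_of_forall_integral_eq_of_IsFiniteMeasure fun g => ?_
  rw [integral_map hT.measurable.aemeasurable g.continuous.aestronglyMeasurable]
  have h1 := ProbabilityMeasure.tendsto_iff_forall_integral_tendsto.1 hμ g
  have h2 := ProbabilityMeasure.tendsto_iff_forall_integral_tendsto.1 hμ
    (g.compContinuous ⟨T, hT⟩)
  have h3 := h2.sub h1
  have hint : ∀ (i : ι) (g : BoundedContinuousFunction X ℝ),
      ∫ x, g x ∂(μs i : Measure X) =
        (∑ j ∈ Finset.range (n i), ∫ x, g (T^[j] x) ∂σ i) / n i := by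
    intro i g
    have hp : ∀ j, IsProbabilityMeasure ((σ i).map T^[j]) := fun j =>
      Measure.isProbabilityMeasure_map (hT.iterate j).measurable.aemeasurable
    rw [hμs, integral_avgMeasure fun j _ => g.integrable _, Finset.card_range]
    congr 1
    exact Finset.sum_congr rfl fun j _ => integral_map (hT.iterate j).measurable.aemeasurable
      g.continuous.aestronglyMeasurable
  have hbound : ∀ i, |∫ x, (g.compContinuous ⟨T, hT⟩) x ∂(μs i : Measure X) -
      ∫ x, g x ∂(μs i : Measure X)| ≤ 2 * ‖g‖ / n i := by
    intro i
    rw [hint, hint, ← sub_div, ← Finset.sum_sub_distrib]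
    have h4 : ∑ j ∈ Finset.range (n i), (∫ x, (g.compContinuous ⟨T, hT⟩) (T^[j] x) ∂σ i -
        ∫ x, g (T^[j] x) ∂σ i) = ∫ x, g (T^[n i] x) ∂σ i - ∫ x, g (T^[0] x) ∂σ i := by
      rw [← Finset.sum_range_sub fun j => ∫ x, g (T^[j] x) ∂σ i]
      refine Finset.sum_congr rfl fun j _ => ?_
      simp only [iterate_succ_apply']
      rfl
    have h5 : ∀ j, |∫ x, g (T^[j] x) ∂σ i| ≤ ‖g‖ := by
      intro j
      have := norm_integral_le_of_norm_le_const (μ := σ i) (f := fun x => g (T^[j] x))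
        (Eventually.of_forall fun x => g.norm_coe_le_norm (T^[j] x))
      simpa using this
    rw [h4, abs_div, Nat.abs_cast]
    gcongr
    refine (abs_sub _ _).trans ?_
    linarith [h5 (n i), h5 0]
  have h6 : Tendsto (fun i => 2 * ‖g‖ / n i) L (𝓝 0) :=
    (tendsto_const_nhds.div_atTop tendsto_natCast_atTop_atTop).comp hn
  have h7 := squeeze_zero_norm (fun i => (Real.norm_eq_abs _).trans_le (hbound i)) h6
  have h8 := tendsto_nhds_unique h3 h7
  exact sub_eq_zero.1 h8

theorem tendsto_partitionEntropy {ι κ : Type*} [Fintype κ] {L : Filter ι}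
    {μs : ι → ProbabilityMeasure X} {μ : ProbabilityMeasure X} (hμ : Tendsto μs L (𝓝 μ))
    {P : X → κ} (hP : ∀ i, (μ : Measure X) (frontier (P ⁻¹' {i})) = 0) :
    Tendsto (fun i => partitionEntropy (μs i : Measure X) P) L
      (𝓝 (partitionEntropy (μ : Measure X) P)) := by
  refine tendsto_finsetSum _ fun j _ => (Real.continuous_negMulLog.tendsto _).comp ?_
  exact (ENNReal.tendsto_toReal (measure_ne_top _ _)).comp
    (ProbabilityMeasure.tendsto_measure_of_null_frontier_of_tendsto' hμ (hP j))

theorem measure_frontier_partitionJoin {ι : Type*} {T : X → X} (hT : Continuous T) {μ : Measure X}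
    (hμ : MeasurePreserving T μ μ) {P : X → ι} (hP : ∀ i, μ (frontier (P ⁻¹' {i})) = 0) (n : ℕ)
    (w : Fin n → ι) : μ (frontier (partitionJoin T P n ⁻¹' {w})) = 0 := by
  have h1 : partitionJoin T P n ⁻¹' {w} = ⋂ j : Fin n, T^[j] ⁻¹' (P ⁻¹' {w j}) := by
    ext x
    simp [partitionJoin, funext_iff]
  rw [h1]
  refine measure_frontier_iInter_eq_zero fun j => ?_
  refine measure_mono_null ((hT.iterate j).frontier_preimage_subset _) ?_
  rw [(hμ.iterate j).measure_preimage isClosed_frontier.measurableSet.nullMeasurableSet]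
  exact hP _

/-- The construction in Misiurewicz's proof of the variational principle: exponentially many
separated orbit segments along which the mean of `γ` is bounded yield an invariant measure and a
partition with linearly growing entropy, for which `γ` is integrable. -/
theorem exists_measurePreserving_of_isBowenSeparated [CompactSpace X] {T : X → X}
    (hT : Continuous T) {γ : X → ℝ≥0∞} (hγ : LowerSemicontinuous γ) {δ c D : ℝ} (hδ : 0 < δ)
    (hE : ∀ n₀ : ℕ, ∃ n ≥ n₀, ∃ E : Finset X, IsBowenSeparated T n δ E ∧
      Real.exp (c * n) ≤ E.card ∧
      ∀ x ∈ E, ∑ i ∈ Finset.range n, γ (T^[i] x) ≤ ENNReal.ofReal (D * n)) :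
    ∃ μ : Measure X, IsProbabilityMeasure μ ∧ MeasurePreserving T μ μ ∧ ∫⁻ x, γ x ∂μ < ⊤ ∧
      ∃ (k : ℕ) (P : X → Fin k), Measurable P ∧
        ∀ q : ℕ, c * q ≤ partitionEntropy μ (partitionJoin T P q) := by
  classical
  choose n hn E hsep hcard hsum using fun m : ℕ => hE (m + 1)
  have hn0 : ∀ m, 0 < n m := fun m => lt_of_lt_of_le m.succ_pos (hn m)
  have hEne : ∀ m, (E m).Nonempty := fun m => by
    rw [← Finset.card_pos]
    exact_mod_cast (Real.exp_pos _).trans_le (hcard m)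
  set σ : ℕ → Measure X := fun m => avgMeasure (E m) Measure.dirac with hσ
  have hσp : ∀ m, IsProbabilityMeasure (σ m) := fun m => isProbabilityMeasure_avgMeasure (hEne m)
  have hσT : ∀ m j, IsProbabilityMeasure ((σ m).map T^[j]) := fun m j =>
    Measure.isProbabilityMeasure_map (hT.iterate j).measurable.aemeasurable
  set ν : ℕ → Measure X := fun m => avgMeasure (Finset.range (n m)) fun j => (σ m).map T^[j] with hν
  have hνp : ∀ m, IsProbabilityMeasure (ν m) := fun m =>
    isProbabilityMeasure_avgMeasure (Finset.nonempty_range_iff.2 (hn0 m).ne')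
  -- the space of probability measures is compact, so a limit along an ultrafilter exists
  set μs : ℕ → ProbabilityMeasure X := fun m => ⟨ν m, hνp m⟩ with hμs
  set L : Filter ℕ := (hyperfilter ℕ : Filter ℕ) with hL
  have hLtop : L ≤ atTop := Nat.hyperfilter_le_atTop
  obtain ⟨μ, hμ⟩ : ∃ μ, Tendsto μs L (𝓝 μ) := ⟨_, ((hyperfilter ℕ).map μs).le_nhds_lim⟩
  have hntop : Tendsto n L atTop :=
    (tendsto_atTop_mono (fun m => (Nat.le_succ m).trans (hn m)) tendsto_id).mono_left hLtop
  have hinv : MeasurePreserving T (μ : Measure X) μ :=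
    measurePreserving_of_tendsto_avgMeasure hT hntop (fun _ => rfl) hμ
  refine ⟨μ, inferInstance, hinv, ?_, ?_⟩
  · refine (lintegral_le_of_tendsto hμ hγ (le_max_right D 0)
      (Eventually.of_forall fun m => ?_)).trans_lt ENNReal.ofReal_lt_top
    change ∫⁻ x, γ x ∂ν m ≤ _
    rw [hν, lintegral_avgMeasure, Finset.card_range]
    have h1 : ∑ j ∈ Finset.range (n m), ∫⁻ x, γ x ∂(σ m).map T^[j] ≤ ENNReal.ofReal (D * n m) := by
      simp only [lintegral_map hγ.measurable (hT.iterate _).measurable]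
      rw [← lintegral_finsetSum (f := fun j x => γ (T^[j] x)) _ fun j _ =>
        hγ.measurable.comp (hT.iterate j).measurable]
      refine lintegral_avgMeasure_le (hEne m) fun x hx => ?_
      rw [lintegral_dirac]
      exact hsum m x hx
    have h2 : (n m : ℝ≥0∞) ≠ 0 := by exact_mod_cast (hn0 m).ne'
    calc _ ≤ (n m : ℝ≥0∞)⁻¹ * ENNReal.ofReal (D * n m) := by gcongr
      _ ≤ (n m : ℝ≥0∞)⁻¹ * ENNReal.ofReal (max D 0 * n m) := by gcongr; exact le_max_left _ _
      _ = ENNReal.ofReal (max D 0) := by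
        rw [ENNReal.ofReal_mul (le_max_right _ _), ENNReal.ofReal_natCast, mul_comm, mul_assoc,
          ENNReal.mul_inv_cancel h2 (ENNReal.natCast_ne_top _), mul_one]
  · obtain ⟨k, P, hP, hP0, hPδ⟩ := exists_partition_null_frontier (μ : Measure X) hδ
    refine ⟨k, P, hP, fun q => ?_⟩
    rcases q.eq_zero_or_pos with rfl | hq
    · rw [Nat.cast_zero, mul_zero]
      exact partitionEntropy_nonneg _ _
    have hlim := tendsto_partitionEntropy hμ (measure_frontier_partitionJoin hT hinv hP0 q)
    have hrem : Tendsto (fun m => 2 * q ^ 2 * Real.log (Fintype.card (Fin k)) / n m) L (𝓝 0) :=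
      (tendsto_const_nhds.div_atTop tendsto_natCast_atTop_atTop).comp hntop
    have hlim2 := hlim.add hrem
    rw [add_zero] at hlim2
    refine ge_of_tendsto hlim2 (Eventually.of_forall fun m => ?_)
    have hn0' : (0 : ℝ) < n m := by exact_mod_cast hn0 m
    -- the points of `E m` have different names, so `σ m` gives them the full entropy `log #(E m)`
    have hfull : c * n m ≤ partitionEntropy (σ m) (partitionJoin T P (n m)) := by
      have hcpos : (0 : ℝ) < (E m).card := by exact_mod_cast (hEne m).card_pos
      refine le_trans ?_ (log_le_partitionEntropy (σ m) (a := (E m).card)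
        (measurable_partitionJoin hT.measurable hP _)
        fun w => ?_)
      · rw [Real.le_log_iff_exp_le hcpos]
        exact hcard m
      · have hw : MeasurableSet (partitionJoin T P (n m) ⁻¹' {w}) :=
          measurable_partitionJoin hT.measurable hP _ (measurableSet_singleton w)
        rw [hσ, avgMeasure_real]
        gcongr
        have h1 : ∀ x, (Measure.dirac x).real (partitionJoin T P (n m) ⁻¹' {w}) =
            if partitionJoin T P (n m) x = w then 1 else 0 := by
          intro x
          rw [measureReal_def, Measure.dirac_apply' _ hw]
          split_ifs with h <;> simp [h]
        simp only [h1, Finset.sum_boole]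
        norm_cast
        refine Finset.card_le_one.2 fun x hx y hy => ?_
        rw [Finset.mem_filter] at hx hy
        by_contra hxy
        obtain ⟨i, hi, hd⟩ := hsep m x hx.1 y hy.1 hxy
        exact absurd (hPδ _ _ (congrFun (hx.2.trans hy.2.symm) ⟨i, hi⟩)) (not_lt.2 hd)
    have hmis := mul_partitionEntropy_partitionJoin_le (σ m) hT.measurable hP hq (n m)
    have hconc : ∑ j ∈ Finset.range (n m), partitionEntropy (σ m) (partitionJoin T P q ∘ T^[j]) ≤
        n m * partitionEntropy (ν m) (partitionJoin T P q) := by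
      have := sum_partitionEntropy_le_of_average (hn0 m) (fun j => (σ m).map T^[j]) (ν m)
        (partitionJoin T P q) fun w => by rw [hν, avgMeasure_real, Finset.card_range]
      simpa only [partitionEntropy_map _ (hT.iterate _).measurable
        (measurable_partitionJoin hT.measurable hP q)] using this
    have hfin : q * (c * n m) ≤ n m * partitionEntropy (ν m) (partitionJoin T P q) +
        2 * q ^ 2 * Real.log (Fintype.card (Fin k)) :=
      (mul_le_mul_of_nonneg_left hfull (Nat.cast_nonneg q)).trans (hmis.trans (by linarith))
    change c * q ≤ partitionEntropy (ν m) (partitionJoin T P q) + _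
    rw [← sub_le_iff_le_add', le_div_iff₀ hn0']
    linarith

end Misiurewicz

/-! ### Ergodicity of the conditional measures on the invariant sets -/

section ErgodicComponent

open ProbabilityTheory

variable {X : Type*} [MeasurableSpace X] {T : X → X}

/-- By the mean ergodic theorem, the Birkhoff averages of an indicator function converge almost
everywhere along a subsequence. -/
theorem exists_seq_tendsto_birkhoffAverage_indicator {ν : Measure X} [IsFiniteMeasure ν]
    (hT : MeasurePreserving T ν ν) {A : Set X} (hA : MeasurableSet A) :
    ∃ ns : ℕ → ℕ, StrictMono ns ∧ ∃ u : X → ℝ, ∀ᵐ y ∂ν,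
      Tendsto (fun k => birkhoffAverage ℝ T (A.indicator 1) (ns k) y) atTop (𝓝 (u y)) := by
  set K : Lp ℝ 2 ν →L[ℝ] Lp ℝ 2 ν :=
    (Lp.compMeasurePreservingₗᵢ ℝ T hT).toContinuousLinearMap with hK
  set x₀ : Lp ℝ 2 ν := indicatorConstLp 2 hA (measure_ne_top ν A) (1 : ℝ) with hx₀
  obtain ⟨g, h1⟩ : ∃ g : Lp ℝ 2 ν,
      Tendsto (birkhoffAverage ℝ K _root_.id · x₀) atTop (𝓝 g) :=
    ⟨_, K.tendsto_birkhoffAverage_orthogonalProjection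
      (LinearIsometry.norm_toContinuousLinearMap_le _) x₀⟩
  obtain ⟨ns, hns, h2⟩ := (tendstoInMeasure_of_tendsto_Lp h1).exists_seq_tendsto_ae
  have hiter : ∀ i : ℕ, (K^[i] x₀ : X → ℝ) =ᵐ[ν] fun y => A.indicator 1 (T^[i] y) := by
    intro i
    induction i with
    | zero => exact indicatorConstLp_coeFn (hs := hA) (hμs := measure_ne_top ν A)
    | succ i ih =>
      rw [iterate_succ_apply']
      refine (Lp.coeFn_compMeasurePreserving (K^[i] x₀) hT).trans ?_
      exact hT.quasiMeasurePreserving.ae_eq_comp ih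
  have hsum : ∀ n : ℕ, ((birkhoffSum K _root_.id n x₀ : Lp ℝ 2 ν) : X → ℝ) =ᵐ[ν]
      birkhoffSum T (A.indicator 1) n := by
    intro n
    induction n with
    | zero =>
      simp only [birkhoffSum_zero]
      exact Lp.coeFn_zero ℝ 2 ν
    | succ n ih =>
      rw [birkhoffSum_succ]
      filter_upwards [Lp.coeFn_add (birkhoffSum K _root_.id n x₀) (_root_.id (K^[n] x₀)), ih,
        hiter n] with y h3 h4 h5
      rw [h3, Pi.add_apply, h4, birkhoffSum_succ]
      exact congrArg _ h5
  have havg : ∀ n : ℕ, ((birkhoffAverage ℝ K _root_.id n x₀ : Lp ℝ 2 ν) : X → ℝ) =ᵐ[ν]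
      birkhoffAverage ℝ T (A.indicator 1) n := by
    intro n
    filter_upwards [Lp.coeFn_smul ((n : ℝ)⁻¹) (birkhoffSum K _root_.id n x₀), hsum n] with y h3 h4
    change (((n : ℝ)⁻¹ • birkhoffSum K _root_.id n x₀ : Lp ℝ 2 ν) : X → ℝ) y = _
    rw [h3, Pi.smul_apply, h4]
    rfl
  refine ⟨ns, hns, g, ?_⟩
  filter_upwards [h2, ae_all_iff.2 fun k => havg (ns k)] with y h3 h4
  simpa only [h4] using h3

omit [MeasurableSpace X] in
theorem abs_birkhoffAverage_indicator_le (A : Set X) (n : ℕ) (y : X) :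
    |birkhoffAverage ℝ T (A.indicator (1 : X → ℝ)) n y| ≤ 1 := by
  rw [birkhoffAverage, birkhoffSum, smul_eq_mul, abs_mul, abs_inv, Nat.abs_cast]
  have h1 : |∑ k ∈ Finset.range n, A.indicator (1 : X → ℝ) (T^[k] y)| ≤ n := by
    refine (Finset.abs_sum_le_sum_abs _ _).trans ?_
    refine (Finset.sum_le_card_nsmul _ _ 1 fun k _ => ?_).trans (by simp)
    by_cases h : T^[k] y ∈ A <;> simp [h]
  rcases n.eq_zero_or_pos with rfl | hn
  · simp
  · rw [inv_mul_le_iff₀ (by exact_mod_cast hn), mul_one]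
    exact h1

theorem measurable_birkhoffAverage_indicator (hT : Measurable T) {A : Set X} (hA : MeasurableSet A)
    (n : ℕ) : Measurable (birkhoffAverage ℝ T (A.indicator (1 : X → ℝ)) n) := by
  have : birkhoffAverage ℝ T (A.indicator (1 : X → ℝ)) n =
      fun y => (n : ℝ)⁻¹ • ∑ k ∈ Finset.range n, A.indicator (1 : X → ℝ) (T^[k] y) := rfl
  rw [this]
  exact (Finset.measurable_fun_sum _ fun k _ =>
    (measurable_one.indicator hA).comp (hT.iterate k)).const_smul (n : ℝ)⁻¹

theorem setIntegral_birkhoffAverage_indicator {m : Measure X} [IsFiniteMeasure m]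
    (hT : MeasurePreserving T m m) {A B : Set X} (hA : MeasurableSet A) (hB : MeasurableSet B)
    (hTB : T ⁻¹' B = B) {n : ℕ} (hn : n ≠ 0) :
    ∫ y in B, birkhoffAverage ℝ T (A.indicator (1 : X → ℝ)) n y ∂m = m.real (A ∩ B) := by
  have h1 : ∀ i, ∫ y in B, A.indicator (1 : X → ℝ) (T^[i] y) ∂m = m.real (A ∩ B) := by
    intro i
    have hi : MeasurableSet (T^[i] ⁻¹' A) := hA.preimage (hT.iterate i).measurable
    have hB' : T^[i] ⁻¹' B = B := by
      induction i with
      | zero => rfl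
      | succ i ih =>
        rw [iterate_succ, preimage_comp, ih (hA.preimage (hT.iterate i).measurable), hTB]
    have h2 : (fun y => A.indicator (1 : X → ℝ) (T^[i] y)) = (T^[i] ⁻¹' A).indicator 1 := rfl
    rw [h2, integral_indicator_one hi, measureReal_restrict_apply hi]
    nth_rw 1 [← hB']
    rw [← preimage_inter, (hT.iterate i).measureReal_preimage (hA.inter hB).nullMeasurableSet]
  simp only [birkhoffAverage, birkhoffSum]
  rw [integral_smul, integral_finsetSum, Finset.sum_congr rfl fun i _ => h1 i, Finset.sum_const,
    Finset.card_range, nsmul_eq_mul, smul_eq_mul, ← mul_assoc,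
    inv_mul_cancel₀ (by exact_mod_cast hn), one_mul]
  intro i _
  refine Integrable.of_bound (C := 1)
    ((measurable_one.indicator hA).comp (hT.iterate i).measurable).aestronglyMeasurable
    (Eventually.of_forall fun y => ?_)
  by_cases h : T^[i] y ∈ A <;> simp [h]

/-- An invariant measure is ergodic as soon as the Birkhoff averages of the indicators of a
generating `π`-system converge to constants along subsequences. -/
theorem ergodic_of_tendsto_birkhoffAverage {m : Measure X} [IsProbabilityMeasure m]
    (hT : MeasurePreserving T m m) {S : Set (Set X)}
    (hgen : ‹MeasurableSpace X› = MeasurableSpace.generateFrom S) (hpi : IsPiSystem S)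
    (hS : ∀ A ∈ S, ∃ ns : ℕ → ℕ, StrictMono ns ∧ ∃ a : ℝ, ∀ᵐ y ∂m,
      Tendsto (fun k => birkhoffAverage ℝ T (A.indicator 1) (ns k) y) atTop (𝓝 a)) :
    Ergodic T m := by
  have hmeas : ∀ A ∈ S, MeasurableSet A := fun A hA => by
    rw [hgen]
    exact MeasurableSpace.measurableSet_generateFrom hA
  have key : ∀ A ∈ S, ∀ B, MeasurableSet B → T ⁻¹' B = B →
      m.real (A ∩ B) = m.real A * m.real B := by
    intro A hA
    obtain ⟨ns, hns, a, ha⟩ := hS A hA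
    have h1 : ∀ B, MeasurableSet B → T ⁻¹' B = B → m.real (A ∩ B) = m.real B * a := by
      intro B hB hTB
      have h2 : Tendsto (fun k => ∫ y in B, birkhoffAverage ℝ T (A.indicator 1) (ns k) y ∂m) atTop
          (𝓝 (∫ _ in B, a ∂m)) := by
        refine tendsto_integral_of_dominated_convergence (fun _ => 1) (fun k =>
          (measurable_birkhoffAverage_indicator hT.measurable (hmeas A hA) _).aestronglyMeasurable)
          (integrable_const _) (fun k => Eventually.of_forall fun y => ?_)
          (ae_restrict_of_ae ha)
        exact abs_birkhoffAverage_indicator_le A _ y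
      rw [setIntegral_const, smul_eq_mul] at h2
      refine tendsto_nhds_unique (tendsto_const_nhds.congr' ?_) h2
      filter_upwards [eventually_ge_atTop 1] with k hk
      exact (setIntegral_birkhoffAverage_indicator hT (hmeas A hA) hB hTB
        (by have := hns.le_apply (x := k); omega)).symm
    have h3 := h1 univ MeasurableSet.univ rfl
    rw [inter_univ, probReal_univ, one_mul] at h3
    intro B hB hTB
    rw [h1 B hB hTB, h3, mul_comm]
  refine ⟨hT, ⟨fun B hB hTB => ?_⟩⟩
  -- `A` and `B` are independent for all `A ∈ S`, hence for all measurable `A`, hence for `A = B`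
  have h1 : m.restrict B = m B • m := by
    refine ext_of_generate_finite S hgen hpi (fun A hA => ?_) (by simp)
    rw [Measure.restrict_apply (hmeas A hA), Measure.smul_apply, smul_eq_mul, mul_comm,
      ← ENNReal.toReal_eq_toReal_iff' (measure_ne_top _ _)
      (ENNReal.mul_ne_top (measure_ne_top _ _) (measure_ne_top _ _)), ENNReal.toReal_mul]
    exact key A hA B hB hTB
  have h2 : m B = m B * m B := by
    have := congrArg (fun μ => μ B) h1
    simpa using this
  have h3 : m B = 0 ∨ m B = 1 := by
    rcases eq_or_ne (m B) 0 with h | h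
    · exact Or.inl h
    · right
      have h4 : m B * 1 = m B * m B := by rw [mul_one]; exact h2
      exact ((ENNReal.mul_right_inj h (measure_ne_top _ _)).1 h4).symm
  rw [eventuallyConst_set]
  rcases h3 with h | h
  · right
    exact measure_eq_zero_iff_ae_notMem.1 h
  · left
    exact (prob_compl_eq_zero_iff hB).2 h

section CondExpKernel

variable {X : Type*} {m mX : MeasurableSpace X} [StandardBorelSpace X] {ν : Measure X}
  [IsProbabilityMeasure ν]

theorem setIntegral_condExpKernel_real (hm : m ≤ mX)
    {C W : Set X} (hC : MeasurableSet[m] C) (hW : MeasurableSet W) :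
    ∫ x in C, (condExpKernel ν m x).real W ∂ν = ν.real (C ∩ W) := by
  rw [setIntegral_congr_ae (g := ν[W.indicator (fun _ => (1 : ℝ)) | m]) (hm _ hC)
    ((condExpKernel_ae_eq_condExp hm hW).mono fun x hx _ => hx),
    setIntegral_condExp hm ((integrable_const _).indicator hW) hC]
  have : (W.indicator fun _ => (1 : ℝ)) = W.indicator 1 := rfl
  rw [this, integral_indicator_one hW, measureReal_restrict_apply hW, inter_comm]

/-- The conditional measures are carried by the fibres of measurable functions. -/
theorem ae_condExpKernel_eq (hm : m ≤ mX) {u : X → ℝ}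
    (hu : Measurable[m] u) : ∀ᵐ x ∂ν, ∀ᵐ y ∂condExpKernel ν m x, u y = u x := by
  have h1 : ∀ q : ℚ, ∀ᵐ x ∂ν, (condExpKernel ν m x).real (u ⁻¹' Iio (q : ℝ)) =
      (u ⁻¹' Iio (q : ℝ)).indicator (fun _ => (1 : ℝ)) x := by
    intro q
    have hq : MeasurableSet[m] (u ⁻¹' Iio (q : ℝ)) := hu measurableSet_Iio
    have h2 := condExpKernel_ae_eq_condExp (μ := ν) hm (hm _ hq)
    rwa [condExp_of_stronglyMeasurable hm (stronglyMeasurable_const.indicator hq)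
      ((integrable_const _).indicator (hm _ hq))] at h2
  filter_upwards [ae_all_iff.2 h1] with x hx
  have h3 : ∀ q : ℚ, ∀ᵐ y ∂condExpKernel ν m x, u y < q ↔ u x < q := by
    intro q
    have hq : MeasurableSet (u ⁻¹' Iio (q : ℝ)) := hm _ (hu measurableSet_Iio)
    have h4 := hx q
    by_cases hxq : u x < q
    · rw [indicator_of_mem (by exact hxq), measureReal_def] at h4
      have h5 : condExpKernel ν m x (u ⁻¹' Iio (q : ℝ)) = 1 := by
        rw [← ENNReal.ofReal_toReal (measure_ne_top (condExpKernel ν m x) _), h4,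
          ENNReal.ofReal_one]
      have h6 : ∀ᵐ y ∂condExpKernel ν m x, y ∈ u ⁻¹' Iio (q : ℝ) := (prob_compl_eq_zero_iff hq).2 h5
      filter_upwards [h6] with y hy
      exact iff_of_true hy hxq
    · rw [indicator_of_notMem (by exact hxq), measureReal_eq_zero_iff] at h4
      filter_upwards [measure_eq_zero_iff_ae_notMem.1 h4] with y hy
      exact iff_of_false hy hxq
  filter_upwards [ae_all_iff.2 h3] with y hy
  exact eq_of_forall_lt_rat_iff_lt hy

theorem lintegral_lintegral_condExpKernel (hm : m ≤ mX)
    {γ : X → ℝ≥0∞} (hγ : Measurable γ) :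
    ∫⁻ x, ∫⁻ y, γ y ∂condExpKernel ν m x ∂ν.trim hm = ∫⁻ x, γ x ∂ν := by
  have h := condExpKernel_comp_trim (μ := ν) hm
  rw [← Measure.lintegral_bind (condExpKernel ν m).measurable.aemeasurable hγ.aemeasurable, h]

theorem ae_ae_condExpKernel (hm : m ≤ mX) {p : X → Prop}
    (hp : ∀ᵐ y ∂ν, p y) : ∀ᵐ x ∂ν, ∀ᵐ y ∂condExpKernel ν m x, p y := by
  refine ae_of_ae_trim hm (Measure.ae_ae_of_ae_comp ?_)
  rw [condExpKernel_comp_trim hm]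
  exact hp

end CondExpKernel

variable [StandardBorelSpace X]

/-- The `σ`-algebra of a standard Borel space is generated by a countable `π`-system, the preimages
of the half-lines `(-∞, q)` under an embedding into `ℝ`. -/
theorem exists_countable_isPiSystem (X : Type*) [h : MeasurableSpace X] [StandardBorelSpace X] :
    ∃ A : ℚ → Set X, h = MeasurableSpace.generateFrom (range A) ∧ IsPiSystem (range A) ∧
      ∀ q, MeasurableSet (A q) := by
  have he := measurableEmbedding_embeddingReal X
  refine ⟨fun q => embeddingReal X ⁻¹' Iio (q : ℝ), ?_, ?_,
    fun q => he.measurable measurableSet_Iio⟩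
  · refine he.comap_eq.symm.trans ?_
    rw [BorelSpace.measurable_eq (α := ℝ), Real.borel_eq_generateFrom_Iio_rat,
      MeasurableSpace.comap_generateFrom]
    congr 1
    ext s
    simp [eq_comm]
  · have := Real.isPiSystem_Iio_rat.comap (embeddingReal X)
    convert this using 1
    ext s
    simp

variable {ν : Measure X} [IsProbabilityMeasure ν]

open MeasurableSpace (invariants invariants_le)

/-- Almost every conditional measure with respect to the invariant sets is invariant. -/
theorem ae_measurePreserving_condExpKernel (hT : MeasurePreserving T ν ν) :
    ∀ᵐ x ∂ν, MeasurePreserving T (condExpKernel ν (invariants T) x)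
      (condExpKernel ν (invariants T) x) := by
  obtain ⟨A, hgen, hpi, hA⟩ := exists_countable_isPiSystem X
  have hm := invariants_le T
  have h1 : ∀ q, ∀ᵐ x ∂ν, (condExpKernel ν (invariants T) x).real (T ⁻¹' A q) =
      (condExpKernel ν (invariants T) x).real (A q) := by
    intro q
    have hTA := hA q |>.preimage hT.measurable
    refine (condExpKernel_ae_eq_condExp hm hTA).trans
      (EventuallyEq.trans ?_ (condExpKernel_ae_eq_condExp hm (hA q)).symm)
    refine ae_eq_condExp_of_forall_setIntegral_eq hm ((integrable_const _).indicator (hA q))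
      (fun _ _ _ => integrable_condExp.integrableOn) (fun C hC _ => ?_)
      stronglyMeasurable_condExp.aestronglyMeasurable
    rw [setIntegral_condExp hm ((integrable_const _).indicator hTA) hC]
    have h2 : ∀ W : Set X, (W.indicator fun _ => (1 : ℝ)) = W.indicator 1 := fun _ => rfl
    rw [h2, h2, integral_indicator_one hTA, integral_indicator_one (hA q),
      measureReal_restrict_apply hTA, measureReal_restrict_apply (hA q)]
    nth_rw 1 [← hC.2]
    rw [← preimage_inter, hT.measureReal_preimage ((hA q).inter hC.1).nullMeasurableSet]
  filter_upwards [ae_all_iff.2 h1] with x hx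
  refine ⟨hT.measurable, ?_⟩
  have := Measure.isProbabilityMeasure_map (μ := condExpKernel ν (invariants T) x)
    hT.measurable.aemeasurable
  refine ext_of_generate_finite (range A) hgen hpi ?_ (by simp)
  rintro _ ⟨q, rfl⟩
  rw [Measure.map_apply hT.measurable (hA q)]
  exact (ENNReal.toReal_eq_toReal_iff' (measure_ne_top _ _) (measure_ne_top _ _)).1 (hx q)

omit [StandardBorelSpace X] in
/-- The limit of Birkhoff averages, where it exists, can be chosen invariant. -/
theorem exists_measurable_invariants_tendsto (hT : Measurable T) {A : Set X} (hA : MeasurableSet A)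
    {ns : ℕ → ℕ} (hns : StrictMono ns) :
    ∃ v : X → ℝ, Measurable[invariants T] v ∧ ∀ y l,
      Tendsto (fun k => birkhoffAverage ℝ T (A.indicator 1) (ns k) y) atTop (𝓝 l) → v y = l := by
  classical
  set F : ℕ → X → ℝ := fun k => birkhoffAverage ℝ T (A.indicator 1) (ns k) with hF
  have hFm : ∀ k, Measurable (F k) := fun k => measurable_birkhoffAverage_indicator hT hA _
  set D : Set X := {y | ∃ l, Tendsto (fun k => F k y) atTop (𝓝 l)} with hD
  have hDm : MeasurableSet D := measurableSet_exists_tendsto hFm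
  set v : X → ℝ := fun y => if h : ∃ l, Tendsto (fun k => F k y) atTop (𝓝 l) then h.choose else 0
    with hv
  have hvl : ∀ y l, Tendsto (fun k => F k y) atTop (𝓝 l) → v y = l := by
    intro y l hl
    have h : ∃ l, Tendsto (fun k => F k y) atTop (𝓝 l) := ⟨l, hl⟩
    simp only [hv, dif_pos h]
    exact tendsto_nhds_unique h.choose_spec hl
  have hshift : ∀ y l, Tendsto (fun k => F k (T y)) atTop (𝓝 l) ↔
      Tendsto (fun k => F k y) atTop (𝓝 l) := by
    intro y l
    have hb : Bornology.IsBounded (range (A.indicator (1 : X → ℝ))) := by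
      refine isBounded_iff_forall_norm_le.2 ⟨1, ?_⟩
      rintro _ ⟨z, rfl⟩
      by_cases h : z ∈ A <;> simp [h]
    have h0 : Tendsto (fun k => F k (T y) - F k y) atTop (𝓝 0) :=
      (tendsto_birkhoffAverage_apply_sub_birkhoffAverage' ℝ hb T y).comp hns.tendsto_atTop
    constructor
    · intro h
      simpa using h.sub h0
    · intro h
      simpa using h.add h0
  have hvT : v ∘ T = v := by
    funext y
    simp only [hv, comp_apply, hshift]
  refine ⟨v, MeasurableSpace.measurable_invariants_dom.2 ⟨?_, fun s _ => by rw [hvT]⟩, hvl⟩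
  refine measurable_of_tendsto_metrizable (f := fun k => D.indicator (F k))
    (fun k => (hFm k).indicator hDm) (tendsto_pi_nhds.2 fun y => ?_)
  by_cases hy : y ∈ D
  · obtain ⟨l, hl⟩ := hy
    rw [hvl y l hl]
    simp only [indicator_of_mem (show y ∈ D from ⟨l, hl⟩)]
    exact hl
  · simp only [indicator_of_notMem hy]
    have : v y = 0 := dif_neg hy
    rw [this]
    exact tendsto_const_nhds

/-- Almost every conditional measure with respect to the invariant sets is ergodic. -/
theorem ae_ergodic_condExpKernel (hT : MeasurePreserving T ν ν) :
    ∀ᵐ x ∂ν, Ergodic T (condExpKernel ν (invariants T) x) := by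
  obtain ⟨A, hgen, hpi, hA⟩ := exists_countable_isPiSystem X
  choose ns hns u hu using fun q => exists_seq_tendsto_birkhoffAverage_indicator hT (hA q)
  choose v hvm hv using fun q => exists_measurable_invariants_tendsto hT.measurable (hA q) (hns q)
  filter_upwards [ae_measurePreserving_condExpKernel hT,
    ae_all_iff.2 fun q => ae_ae_condExpKernel (invariants_le T) (hu q),
    ae_all_iff.2 fun q => ae_condExpKernel_eq (ν := ν) (invariants_le T) (hvm q)] with x h1 h2 h3
  refine ergodic_of_tendsto_birkhoffAverage h1 hgen hpi ?_
  rintro _ ⟨q, rfl⟩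
  refine ⟨ns q, hns q, v q x, ?_⟩
  filter_upwards [h2 q, h3 q] with y h4 h5
  rw [← h5, hv q y _ h4]
  exact h4

end ErgodicComponent

/-! ### Entropy of ergodic components -/

section ErgodicEntropy

open ProbabilityTheory
open MeasurableSpace (invariants invariants_le)

variable {X ι : Type*} [MeasurableSpace X] {T : X → X} {ν : Measure X} [IsProbabilityMeasure ν]
  [Fintype ι] [MeasurableSpace ι] [MeasurableSingletonClass ι] {P : X → ι}

omit [IsProbabilityMeasure ν] in
theorem measurePreserving_cond (hT : MeasurePreserving T ν ν) {C : Set X} (hC : MeasurableSet C)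
    (hTC : T ⁻¹' C = C) : MeasurePreserving T (cond ν C) (cond ν C) := by
  have h1 := hT.restrict_preimage hC
  rw [hTC] at h1
  exact h1.smul_measure _

theorem partitionEntropy_partitionJoin_mul_le_of_measurePreserving (hT : MeasurePreserving T ν ν)
    (hP : Measurable P) (J q : ℕ) :
    partitionEntropy ν (partitionJoin T P (J * q)) ≤
      J * partitionEntropy ν (partitionJoin T P q) := by
  have h1 := partitionEntropy_partitionJoin_mul_le ν hT.measurable hP q J 0
  have h2 : ∀ i, partitionEntropy ν (partitionJoin T P q ∘ T^[i]) =
      partitionEntropy ν (partitionJoin T P q) := by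
    intro i
    rw [← partitionEntropy_map ν (hT.iterate i).measurable
      (measurable_partitionJoin hT.measurable hP q), (hT.iterate i).map_eq]
  simp only [h2, Finset.sum_const, Finset.card_range, nsmul_eq_mul] at h1
  simpa using h1

/-- Linear growth of entropy is inherited, on average, by the pieces of a finite invariant
partition. -/
theorem mul_le_sum_partitionEntropy_cond {κ : Type*} [Fintype κ] [MeasurableSpace κ]
    [MeasurableSingletonClass κ] (hT : MeasurePreserving T ν ν) (hP : Measurable P) {c : ℝ}
    (hc : ∀ n : ℕ, c * n ≤ partitionEntropy ν (partitionJoin T P n)) {Q : X → κ}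
    (hQ : Measurable[invariants T] Q) (q : ℕ) :
    c * q ≤
      ∑ a, ν.real (Q ⁻¹' {a}) * partitionEntropy (cond ν (Q ⁻¹' {a})) (partitionJoin T P q) := by
  classical
  set B := ∑ a, ν.real (Q ⁻¹' {a}) * partitionEntropy (cond ν (Q ⁻¹' {a})) (partitionJoin T P q)
    with hB
  have hQC : ∀ a, MeasurableSet[invariants T] (Q ⁻¹' {a}) := fun a =>
    hQ (measurableSet_singleton a)
  have hQm : Measurable Q := hQ.mono (invariants_le T) le_rfl
  -- conditioning on `Q` loses at most `log #κ`, uniformly in the length `J * q` of the join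
  have h1 : ∀ J : ℕ, J * (c * q - B) ≤ Real.log (Fintype.card κ) := by
    intro J
    have h2 := (hc (J * q)).trans (partitionEntropy_le_log_card_add_cond ν
      (measurable_partitionJoin hT.measurable hP (J * q)) hQm)
    have h3 : ∑ a, ν.real (Q ⁻¹' {a}) *
        partitionEntropy (cond ν (Q ⁻¹' {a})) (partitionJoin T P (J * q)) ≤ J * B := by
      rw [hB, Finset.mul_sum]
      refine Finset.sum_le_sum fun a _ => ?_
      rw [mul_left_comm]
      rcases eq_or_ne (ν (Q ⁻¹' {a})) 0 with h0 | h0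
      · simp [measureReal_def, h0]
      · have := cond_isProbabilityMeasure h0
        gcongr
        exact partitionEntropy_partitionJoin_mul_le_of_measurePreserving
          (measurePreserving_cond hT (hQC a).1 (hQC a).2) hP J q
    push_cast at h2
    linarith
  by_contra! hlt
  obtain ⟨J, hJ⟩ := exists_nat_gt (Real.log (Fintype.card κ) / (c * q - B))
  rw [div_lt_iff₀ (by linarith)] at hJ
  linarith [h1 J]

theorem exists_abs_negMulLog_sub_lt {ε : ℝ} (hε : 0 < ε) :
    ∃ η > 0, ∀ a ∈ Icc (0 : ℝ) 1, ∀ b ∈ Icc (0 : ℝ) 1, |a - b| < η →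
      |Real.negMulLog a - Real.negMulLog b| < ε := by
  obtain ⟨η, hη, h⟩ := Metric.uniformContinuousOn_iff.1
    (isCompact_Icc.uniformContinuousOn_of_continuous
      (Real.continuous_negMulLog.continuousOn (s := Icc (0 : ℝ) 1))) ε hε
  exact ⟨η, hη, fun a ha b hb hab => h a ha b hb hab⟩

omit [MeasurableSpace ι] [MeasurableSingletonClass ι] in
theorem partitionEntropy_le_add_of_abs_sub_lt {μ μ' : Measure X} [IsProbabilityMeasure μ]
    [IsProbabilityMeasure μ'] {ε η : ℝ}
    (hη : ∀ a ∈ Icc (0 : ℝ) 1, ∀ b ∈ Icc (0 : ℝ) 1, |a - b| < η →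
      |Real.negMulLog a - Real.negMulLog b| < ε)
    (h : ∀ i, |μ.real (P ⁻¹' {i}) - μ'.real (P ⁻¹' {i})| < η) :
    partitionEntropy μ P ≤ partitionEntropy μ' P + Fintype.card ι * ε := by
  have h1 : ∀ i, Real.negMulLog (μ.real (P ⁻¹' {i})) ≤
      Real.negMulLog (μ'.real (P ⁻¹' {i})) + ε := fun i => by
    have := (abs_lt.1 (hη _ ⟨measureReal_nonneg, measureReal_le_one⟩ _
      ⟨measureReal_nonneg, measureReal_le_one⟩ (h i))).2
    linarith
  refine (Finset.sum_le_sum fun i _ => h1 i).trans (le_of_eq ?_)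
  rw [Finset.sum_add_distrib, Finset.sum_const, Finset.card_univ, nsmul_eq_mul]
  rfl

variable [StandardBorelSpace X]

theorem measurable_partitionEntropy_condExpKernel (hP : Measurable P) :
    Measurable fun x => partitionEntropy (condExpKernel ν (invariants T) x) P := by
  refine Finset.measurable_fun_sum _ fun i _ => Real.continuous_negMulLog.measurable.comp ?_
  exact ((measurable_condExpKernel (hP (measurableSet_singleton i))).mono (invariants_le T)
    le_rfl).ennreal_toReal

theorem integrable_partitionEntropy_condExpKernel (hP : Measurable P) :
    Integrable (fun x => partitionEntropy (condExpKernel ν (invariants T) x) P) ν := by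
  refine Integrable.of_bound (C := Real.log (Fintype.card ι))
    (measurable_partitionEntropy_condExpKernel hP).aestronglyMeasurable
    (Eventually.of_forall fun x => ?_)
  rw [Real.norm_of_nonneg (partitionEntropy_nonneg _ _)]
  exact partitionEntropy_le_log_card _ hP

/-- Linear growth of entropy is inherited, on average, by the ergodic components. The conditional
measures are compared with their averages over the cells of a finite invariant partition on which
they are nearly constant. -/
theorem mul_le_integral_partitionEntropy_condExpKernel (hT : MeasurePreserving T ν ν)
    (hP : Measurable P) {c : ℝ} (hc : ∀ n : ℕ, c * n ≤ partitionEntropy ν (partitionJoin T P n))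
    (q : ℕ) :
    c * q ≤ ∫ x, partitionEntropy (condExpKernel ν (invariants T) x) (partitionJoin T P q) ∂ν := by
  classical
  set Pq := partitionJoin T P q with hPq
  have hPqm : Measurable Pq := measurable_partitionJoin hT.measurable hP q
  set κ := condExpKernel ν (invariants T) with hκ
  have hm := invariants_le T
  refine le_of_forall_pos_le_add fun ε hε => ?_
  set N := Fintype.card (Fin q → ι) with hN
  obtain ⟨η, hη, hηε⟩ := exists_abs_negMulLog_sub_lt (show 0 < ε / (N + 1) by positivity)
  obtain ⟨R, hR⟩ := exists_nat_gt (1 / η)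
  have hR0 : (0 : ℝ) < R := lt_trans (by positivity) hR
  have hRη : 1 / (R : ℝ) < η := by rwa [one_div_lt hR0 hη]
  set v : (Fin q → ι) → X → ℝ := fun w x => (κ x).real (Pq ⁻¹' {w}) with hv
  have hW : ∀ w, MeasurableSet (Pq ⁻¹' {w}) := fun w => hPqm (measurableSet_singleton w)
  have hvm : ∀ w, Measurable[invariants T] (v w) := fun w =>
    (measurable_condExpKernel (hW w)).ennreal_toReal
  -- group the points `x` for which the conditional laws of `Pq` agree up to `1 / R`
  set Q : X → (Fin q → ι) → Fin (R + 1) := fun x w => Fin.ofNat (R + 1) ⌊v w x * R⌋₊ with hQ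
  have hQm : Measurable[invariants T] Q := by
    refine @measurable_pi_lambda _ _ _ (invariants T) _ _ fun w => ?_
    exact (measurable_from_nat (f := Fin.ofNat (R + 1))).comp
      (Nat.measurable_floor.comp ((hvm w).mul_const _))
  have hclose : ∀ x y, Q y = Q x → ∀ w, |v w y - v w x| ≤ 1 / R := by
    intro x y hxy w
    have h0 : ∀ z, 0 ≤ v w z * R := fun z => mul_nonneg measureReal_nonneg hR0.le
    have hlt : ∀ z, ⌊v w z * R⌋₊ < R + 1 := fun z => by
      refine Nat.lt_succ_of_le (Nat.floor_le_of_le ?_)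
      exact mul_le_of_le_one_left hR0.le measureReal_le_one
    have h1 : ⌊v w y * R⌋₊ = ⌊v w x * R⌋₊ := by
      have := congrArg Fin.val (congrFun hxy w)
      simpa only [hQ, Fin.val_ofNat, Nat.mod_eq_of_lt (hlt _)] using this
    have h2 : |v w y * R - v w x * R| < 1 := by
      refine Int.abs_sub_lt_one_of_floor_eq_floor ?_
      rw [← Int.natCast_floor_eq_floor (h0 y), ← Int.natCast_floor_eq_floor (h0 x), h1]
    rw [← sub_mul, abs_mul, abs_of_pos hR0] at h2
    rw [le_div_iff₀ hR0]
    exact h2.le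
  set b : ((Fin q → ι) → Fin (R + 1)) → ℝ := fun a =>
    partitionEntropy (cond ν (Q ⁻¹' {a})) Pq with hb
  have hbQ : ∀ x, b (Q x) ≤ partitionEntropy (κ x) Pq + ε := by
    intro x
    set C := Q ⁻¹' {Q x} with hC
    have hCm : MeasurableSet[invariants T] C := hQm (measurableSet_singleton _)
    rcases eq_or_ne (ν C) 0 with h0 | h0
    · have h1 : b (Q x) = 0 := by
        simp only [hb, ← hC, cond_eq_zero_of_meas_eq_zero h0]
        simp [partitionEntropy]
      rw [h1]
      exact add_nonneg (partitionEntropy_nonneg _ _) hε.le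
    · have := cond_isProbabilityMeasure h0
      have hp : 0 < ν.real C := ENNReal.toReal_pos h0 (measure_ne_top _ _)
      refine (partitionEntropy_le_add_of_abs_sub_lt (μ' := κ x) hηε fun w => ?_).trans ?_
      · refine lt_of_le_of_lt ?_ hRη
        have h1 : (cond ν C).real (Pq ⁻¹' {w}) = (∫ y in C, v w y ∂ν) / ν.real C := by
          rw [hv, setIntegral_condExpKernel_real hm hCm (hW w), measureReal_def,
            cond_apply (hm _ hCm), ENNReal.toReal_mul, ENNReal.toReal_inv, inv_mul_eq_div]
          rfl
        have hvi : IntegrableOn (v w) C ν := by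
          refine (Integrable.of_bound (C := 1) ((hvm w).mono hm le_rfl).aestronglyMeasurable
            (Eventually.of_forall fun y => ?_)).integrableOn
          rw [Real.norm_of_nonneg measureReal_nonneg]
          exact measureReal_le_one
        have h2 : ‖∫ y in C, (v w y - v w x) ∂ν‖ ≤ 1 / R * ν.real C :=
          norm_setIntegral_le_of_norm_le_const (measure_lt_top _ _) fun y hy => hclose x y hy w
        rw [integral_sub hvi (integrable_const _), setIntegral_const, smul_eq_mul,
          Real.norm_eq_abs] at h2
        rw [h1, div_sub' hp.ne', abs_div, abs_of_pos hp, div_le_iff₀ hp]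
        exact h2
      · gcongr
        rw [mul_div_assoc', div_le_iff₀ (by positivity)]
        nlinarith
  have hQm' : Measurable Q := hQm.mono hm le_rfl
  have hsum : ∑ a, ν.real (Q ⁻¹' {a}) * b a = ∫ x, b (Q x) ∂ν := by
    have hbm : Measurable b := measurable_of_finite b
    rw [← integral_map hQm'.aemeasurable hbm.aestronglyMeasurable,
      integral_fintype (Integrable.of_finite)]
    refine Finset.sum_congr rfl fun a _ => ?_
    rw [map_measureReal_apply hQm' (measurableSet_singleton a), smul_eq_mul]
  have hint := integrable_partitionEntropy_condExpKernel (T := T) (ν := ν) hPqm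
  calc c * q ≤ ∫ x, b (Q x) ∂ν := (mul_le_sum_partitionEntropy_cond hT hP hc hQm q).trans_eq hsum
    _ ≤ ∫ x, (partitionEntropy (κ x) Pq + ε) ∂ν := by
        refine integral_mono ?_ (hint.add (integrable_const _)) hbQ
        exact (Integrable.of_finite (f := b) (μ := ν.map Q)).comp_measurable hQm'
    _ = _ := by
        rw [integral_add hint (integrable_const _), integral_const, probReal_univ, one_smul]

omit [StandardBorelSpace X] [IsProbabilityMeasure ν] in
theorem tendsto_partitionEntropy_div_of_metricEntropy_eq_zero [IsProbabilityMeasure ν] {k : ℕ}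
    {P : X → Fin k} (hP : Measurable P) (h : metricEntropy T ν = 0) :
    Tendsto (fun n : ℕ => partitionEntropy ν (partitionJoin T P n) / n) atTop (𝓝 0) := by
  have h1 : limsup (fun n : ℕ => ENNReal.ofReal (partitionEntropy ν (partitionJoin T P n) / n))
      atTop ≤ 0 := by
    rw [← h, metricEntropy]
    exact le_iSup_of_le k (le_iSup₂_of_le P hP le_rfl)
  have h2 : Tendsto (fun n : ℕ => ENNReal.ofReal (partitionEntropy ν (partitionJoin T P n) / n))
      atTop (𝓝 0) := tendsto_of_le_liminf_of_limsup_le zero_le h1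
  have h3 := (ENNReal.tendsto_toReal ENNReal.zero_ne_top).comp h2
  refine h3.congr fun n => ?_
  exact ENNReal.toReal_ofReal (div_nonneg (partitionEntropy_nonneg _ _) (Nat.cast_nonneg n))

/-- An invariant measure of positive entropy for which `γ` is integrable has an ergodic component
with the same properties. -/
theorem exists_ergodic_of_measurePreserving (hT : MeasurePreserving T ν ν) {k : ℕ} {P : X → Fin k}
    (hP : Measurable P) {c : ℝ} (hc0 : 0 < c)
    (hc : ∀ n : ℕ, c * n ≤ partitionEntropy ν (partitionJoin T P n)) {γ : X → ℝ≥0∞}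
    (hγ : Measurable γ) (hγν : ∫⁻ x, γ x ∂ν < ⊤) :
    ∃ m : Measure X, IsProbabilityMeasure m ∧ Ergodic T m ∧ 0 < metricEntropy T m ∧
      ∫⁻ x, γ x ∂m < ⊤ := by
  by_contra! hno
  have hm := invariants_le T
  have hγa : ∀ᵐ x ∂ν, ∫⁻ y, γ y ∂condExpKernel ν (invariants T) x < ⊤ := by
    refine ae_of_ae_trim hm (ae_lt_top ?_ ?_)
    · exact (Measure.measurable_lintegral hγ).comp (condExpKernel ν (invariants T)).measurable
    · rw [lintegral_lintegral_condExpKernel hm hγ]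
      exact hγν.ne
  have h0 : ∀ᵐ x ∂ν, Tendsto (fun n : ℕ => partitionEntropy (condExpKernel ν (invariants T) x)
      (partitionJoin T P n) / n) atTop (𝓝 0) := by
    filter_upwards [hγa, ae_ergodic_condExpKernel hT] with x h1 h2
    refine tendsto_partitionEntropy_div_of_metricEntropy_eq_zero hP ?_
    by_contra hne
    exact h1.not_ge (hno _ inferInstance h2 (pos_iff_ne_zero.2 hne))
  have hlim := tendsto_integral_of_dominated_convergence (μ := ν)
    (fun _ => Real.log (Fintype.card (Fin k)))
    (fun n : ℕ => ((measurable_partitionEntropy_condExpKernel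
      (measurable_partitionJoin hT.measurable hP n)).div_const (n : ℝ)).aestronglyMeasurable)
    (integrable_const _) (fun n => Eventually.of_forall fun x => ?_) h0
  · rw [integral_zero] at hlim
    refine hc0.not_ge (ge_of_tendsto hlim ?_)
    filter_upwards [eventually_gt_atTop 0] with n hn
    rw [integral_div, le_div_iff₀ (by exact_mod_cast hn)]
    exact mul_le_integral_partitionEntropy_condExpKernel hT hP hc n
  · rw [Real.norm_of_nonneg (div_nonneg (partitionEntropy_nonneg _ _) (Nat.cast_nonneg n))]
    have h1 := partitionEntropy_partitionJoin_le (condExpKernel ν (invariants T) x)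
      hT.measurable hP n 0
    rw [iterate_zero, comp_id] at h1
    exact div_le_of_le_mul₀ (Nat.cast_nonneg n) (Real.log_natCast_nonneg _) (by linarith)

end ErgodicEntropy

/-! ### Entropy of the singular suspension -/

section Main

theorem topEntropy_nonneg {X : Type*} [TopologicalSpace X] [CompactSpace X] [T2Space X] [Nonempty X]
    (T : X → X) : 0 ≤ topEntropy T := by
  let _ : UniformSpace X := uniformSpaceOfCompactR1
  exact Dynamics.coverEntropy_nonneg T univ_nonempty

theorem topEntropy_of_isEmpty {X : Type*} [TopologicalSpace X] [CompactSpace X] [T2Space X]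
    [IsEmpty X] (T : X → X) : topEntropy T = ⊥ := by
  let _ : UniformSpace X := uniformSpaceOfCompactR1
  change Dynamics.coverEntropy T univ = ⊥
  rw [univ_eq_empty_iff.2 inferInstance, Dynamics.coverEntropy_empty]

variable {d : ℕ} {M : Type*} [MetricSpace M] [CompactSpace M]
  [ChartedSpace (EuclideanSpace ℝ (Fin d)) M] [IsManifold (𝓡 d) 1 M]
  [MeasurableSpace M] [BorelSpace M]
  {f : M ≃ₘ^1⟮𝓡 d, 𝓡 d⟯ M} {α : SuspSpace f → ℝ} {ψ : Flow ℝ (SuspSpace f)}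

/-- If the singular suspension has positive entropy, then the return time is integrable for some
ergodic measure of positive entropy of the base map. -/
theorem IsSingularSuspension.exists_ergodic_of_topEntropy_pos (hψ : IsSingularSuspension f α ψ)
    (hpos : 0 < topEntropy (ψ 1)) :
    ∃ m : Measure M, IsProbabilityMeasure m ∧ Ergodic f m ∧ 0 < metricEntropy f m ∧
      ∫⁻ x, returnTime f α ψ x ∂m < ⊤ := by
  obtain ⟨δ, hδ, c, hc, D, hE⟩ := hψ.exists_many_isBowenSeparated hpos
  obtain ⟨ν, hν, hfν, hγ, k, P, hP, hH⟩ := exists_measurePreserving_of_isBowenSeparated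
    f.contMDiff.continuous hψ.lowerSemicontinuous_returnTime hδ hE
  exact exists_ergodic_of_measurePreserving hfν hP hc hH
    hψ.lowerSemicontinuous_returnTime.measurable hγ

/-- If the singular suspension has zero entropy, then an invariant measure of the base map for which
the return time is integrable has zero entropy. -/
theorem IsSingularSuspension.metricEntropy_eq_zero (hψ : IsSingularSuspension f α ψ)
    (h0 : topEntropy (ψ 1) = 0) {μ : Measure M} [IsProbabilityMeasure μ]
    (hμ : MeasurePreserving f μ μ) (hγ : ∫⁻ x, returnTime f α ψ x ∂μ ≠ ⊤) :
    metricEntropy f μ = 0 := by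
  refine metricEntropy_eq_zero_of_bowen_cover μ hμ fun ε hε δ hδ κ hκ => ?_
  set I := (∫⁻ x, returnTime f α ψ x ∂μ).toReal with hI
  have hI0 : 0 ≤ I := ENNReal.toReal_nonneg
  have hγm := hψ.lowerSemicontinuous_returnTime.measurable
  have hc : 0 < I / δ + 1 := by positivity
  -- with `c > I / δ` the mean return time exceeds `c` on a set of measure at most `δ`
  set c := I / δ + 1 with hcdef
  have hSm : ∀ n : ℕ, Measurable fun x => ∑ i ∈ Finset.range n, returnTime f α ψ (f^[i] x) :=
    fun n => Finset.measurable_fun_sum _ fun i _ => hγm.comp (hμ.measurable.iterate i)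
  filter_upwards [hψ.eventually_bowen_cover h0 hε hκ hc, eventually_gt_atTop 0] with n hn hn0
  obtain ⟨F, hF, hcov⟩ := hn
  refine ⟨F, {x | ∑ i ∈ Finset.range n, returnTime f α ψ (f^[i] x) ≤ ENNReal.ofReal (c * n)},
    hSm n measurableSet_Iic, ?_, hF, hcov⟩
  have hn0' : (0 : ℝ) < n := by exact_mod_cast hn0
  have hint : ∫⁻ x, ∑ i ∈ Finset.range n, returnTime f α ψ (f^[i] x) ∂μ =
      ENNReal.ofReal (n * I) := by
    rw [lintegral_finsetSum (f := fun i x => returnTime f α ψ (f^[i] x)) _ fun i _ =>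
      hγm.comp (hμ.measurable.iterate i)]
    have h1 : ∀ i, ∫⁻ x, returnTime f α ψ (f^[i] x) ∂μ = ∫⁻ x, returnTime f α ψ x ∂μ := fun i =>
      (hμ.iterate i).lintegral_comp hγm
    rw [Finset.sum_congr rfl fun i _ => h1 i, Finset.sum_const, Finset.card_range, nsmul_eq_mul,
      ENNReal.ofReal_mul hn0'.le, ENNReal.ofReal_natCast, hI, ENNReal.ofReal_toReal hγ]
  -- Markov's inequality for the sum of the first `n` return times
  have hmarkov := mul_meas_ge_le_lintegral (μ := μ) (hSm n) (ENNReal.ofReal (c * n))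
  rw [hint] at hmarkov
  have h2 : ENNReal.ofReal (c * n) * μ {x | ∑ i ∈ Finset.range n, returnTime f α ψ (f^[i] x) ≤
      ENNReal.ofReal (c * n)}ᶜ ≤ ENNReal.ofReal (n * I) := by
    refine le_trans (mul_le_mul_right ?_ _) hmarkov
    refine measure_mono fun x hx => ?_
    rw [mem_compl_iff, mem_ofPred_eq, not_le] at hx
    exact hx.le
  have h3 := ENNReal.toReal_mono ENNReal.ofReal_ne_top h2
  rw [ENNReal.toReal_mul, ENNReal.toReal_ofReal (by positivity),
    ENNReal.toReal_ofReal (by positivity)] at h3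
  change c * n * μ.real _ ≤ n * I at h3
  have h4 : c * δ = I + δ := by
    rw [hcdef]
    field_simp
  refine le_of_mul_le_mul_left (h3.trans ?_) (show 0 < c * n by positivity)
  nlinarith

omit [IsManifold (𝓡 d) 1 M] [BorelSpace M] [MeasurableSpace M]
  [ChartedSpace (EuclideanSpace ℝ (Fin d)) M] in
/-- The half of the variational principle bounding metric entropy by topological entropy, in the
case of zero topological entropy. -/
theorem metricEntropy_eq_zero_of_topEntropy_eq_zero [MeasurableSpace M] [BorelSpace M] {T : M → M}
    (h0 : topEntropy T = 0) {μ : Measure M} [IsProbabilityMeasure μ]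
    (hμ : MeasurePreserving T μ μ) : metricEntropy T μ = 0 := by
  refine metricEntropy_eq_zero_of_bowen_cover μ hμ fun ε hε δ hδ κ hκ => ?_
  filter_upwards [eventually_bowen_cover_of_topEntropy_eq_zero h0 hε hκ] with n hn
  obtain ⟨F, hF, hcov⟩ := hn
  exact ⟨F, univ, MeasurableSet.univ, by simp [hδ.le], hF, fun x _ => hcov x⟩

/-- The entropy criterion, without a condition on the entropy of `f`. -/
theorem IsSingularSuspension.topEntropy_eq_zero_iff (hψ : IsSingularSuspension f α ψ)
    [Nonempty M] :
    topEntropy (ψ 1) = 0 ↔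
      ∀ μ : Measure M, IsProbabilityMeasure μ → Ergodic f μ → 0 < metricEntropy f μ →
        ∫⁻ x, returnTime f α ψ x ∂μ = ⊤ := by
  constructor
  · intro h0 μ hμ herg hent
    by_contra hne
    exact hent.ne' (hψ.metricEntropy_eq_zero h0 herg.toMeasurePreserving hne)
  · intro hall
    by_contra hne
    have : Nonempty (SuspSpace f) := ‹Nonempty M›.map fun x => suspMk f (x, 0)
    obtain ⟨m, hm, herg, hent, hγ⟩ := hψ.exists_ergodic_of_topEntropy_pos
      (lt_of_le_of_ne (topEntropy_nonneg _) (Ne.symm hne))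
    exact hγ.ne (hall m hm herg hent)

end Main

theorem mainTheorem6 {d : ℕ} {M : Type*} [TopologicalSpace M] [CompactSpace M] [T2Space M]
    [ChartedSpace (EuclideanSpace ℝ (Fin d)) M] [IsManifold (𝓡 d) ∞ M]
    [MeasurableSpace M] [BorelSpace M]
    (f : M ≃ₘ^1⟮𝓡 d, 𝓡 d⟯ M) (α : SuspSpace f → ℝ) (ψ : Flow ℝ (SuspSpace f))
    (hψ : IsSingularSuspension f α ψ) :
    (0 < topEntropy f →
      (topEntropy (ψ 1) = 0 ↔
        ∀ μ : Measure M, IsProbabilityMeasure μ → Ergodic f μ → 0 < metricEntropy f μ →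
          ∫⁻ x, returnTime f α ψ x ∂μ = ⊤)) ∧
    (topEntropy f = 0 → topEntropy (ψ 1) = 0) := by
  rcases isEmpty_or_nonempty M with hM | hM
  -- the entropy of the empty map is `⊥`, which is neither positive nor zero
  · constructor <;> intro h <;> simp [topEntropy_of_isEmpty] at h
  have : IsManifold (𝓡 d) 1 M := IsManifold.of_le (n := ∞) (by simp)
  have := Manifold.metrizableSpace (𝓡 d) M
  let _ : MetricSpace M := TopologicalSpace.metrizableSpaceMetric M
  have h1 := hψ.topEntropy_eq_zero_iff
  refine ⟨fun _ => h1, fun h0 => h1.2 fun μ hμ herg hent => ?_⟩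
  exact absurd (metricEntropy_eq_zero_of_topEntropy_eq_zero h0 herg.toMeasurePreserving) hent.ne'
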